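/- Conventions. A prederivator is a strict 2-functor $\mathscr D\colon \mathrm{Cat}^{\mathrm{op}}\to\mathrm{CAT}$ from small categories to categories; for a functor $u\colon A\to B$ between small categories write $u^*\colon\mathscr D(B)\to\mathscr D(A)$ for restriction. It is a derivator if (Der1) $\mathscr D(\coprod_i B_i)\to\prod_i\mathscr D(B_i)$ is an equivalence for every small family, (Der2) a morphism $f$ of $\mathscr D(B)$ is an isomorphism if and only if $b^*f$ is one for every object $b\in B$, (Der3) every $u^*$ has a left adjoint $u_!$ and a right adjoint $u_*$, and (Der4) these Kan extensions are pointwise, i.e. the canonical maps $\mathrm{colim}_{(u/b)}p^*X\to u_!(X)_b$ and $u_*(X)_b\to\lim_{(b/u)}q^*X$ are isomorphisms, where $p\colon(u/b)\to A$ and $q\colon(b/u)\to A$ are the projections. A derivator is stable if $\mathscr D(\ast)$ has a zero object and a square $X\in\mathscr D([1]\times[1])$ is cocartesian (in the essential image of left Kan extension from the span $\ulcorner$) if and only if it is cartesian (in the essential image of right Kan extension from the cospan $\lrcorner$). Morphisms of derivators are pseudo-natural transformations and natural transformations between them are modifications; a morphism is exact if it preserves initial objects, pushouts, terminal objects and pullbacks.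 For a small category $A$, $\mathscr D^A$ denotes $B\mapsto\mathscr D(A\times B)$; this gives a 2-functor $(-)^A$ from the 2-category of stable derivators, exact morphisms and all natural transformations to the 2-category of derivators. Two small categories $A$, $A'$ are strongly stably equivalent if there is a pseudo-natural equivalence $\Phi\colon(-)^A\simeq(-)^{A'}$, that is, a pseudo-natural transformation between these 2-functors such that for every stable derivator $\mathscr D$ the component $\Phi_{\mathscr D}\colon\mathscr D^A\to\mathscr D^{A'}$ is an equivalence of derivators. A quiver is identified with the category of paths in it. **Corollary.** All $A_3$-quivers are strongly stably equivalent: if $Q$ and $Q'$ are quivers whose underlying unoriented graph is the path $\bullet - \bullet - \bullet$ on three vertices (so that each of them is, up to isomorphism, one of $1\to2\to3$, $1\leftarrow2\to3$, $1\to2\leftarrow3$, $1\leftarrow2\leftarrow3$), then $Q$ and $Q'$ are strongly stably equivalent. -/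

import Mathlib

open CategoryTheory Bicategory Opposite
open scoped CategoryTheory.Pseudofunctor.StrongTrans

universe w v u

set_option linter.checkUnivs false

namespace DerivatorTheory

/-! ### Prederivators -/

/-- A prederivator is a (strict) `2`-functor `Catᵒᵖ → CAT`. The opposite reverses functors
and keeps the direction of natural transformations; `Cat.{w, w}` is the `2`-category of small
categories, and the values are categories in arbitrary universes. -/
abbrev Prederivator : Type _ :=
  StrictPseudofunctor (Cat.{w, w})ᵒᵖ Cat.{v, u}

/-- The one-object shape `∗`. -/
abbrev Pt : Type w := Discrete PUnit.{w + 1}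

/-- The functor `A → ∗`. -/
abbrev toPt (A : Type w) [Category.{w} A] : A ⥤ Pt.{w} := Functor.star A

/-- The functor `∗ → B` classifying an object `b`. -/
abbrev ptAt {B : Type w} [Category.{w} B] (b : B) : Pt.{w} ⥤ B := Functor.fromPUnit b

namespace Prederivator

variable (D : Prederivator.{w, v, u})

/-- The category `D(A)` of coherent diagrams of shape `A`. -/
abbrev Coh (A : Type w) [Category.{w} A] : Cat.{v, u} := D.obj (op (Cat.of A))

section

variable {A B C : Type w} [Category.{w} A] [Category.{w} B] [Category.{w} C]

/-- The restriction functor `u^* : D(B) → D(A)`. -/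
abbrev res (u : A ⥤ B) : D.Coh B ⥤ D.Coh A := (D.map u.toCatHom.op).toFunctor

/-- The natural transformation `α^* : u^* → v^*`. -/
abbrev resMap {u v : A ⥤ B} (α : u ⟶ v) : D.res u ⟶ D.res v :=
  (D.map₂ (Bicategory.Opposite.op2 α.toCatHom₂)).toNatTrans

/-- The functoriality `(u ∘ p)^* = p^* u^*`, as an isomorphism (it is an `eqToIso`). -/
abbrev resComp (p : A ⥤ B) (u : B ⥤ C) : D.res (p ⋙ u) ≅ D.res u ⋙ D.res p :=
  Cat.Hom.toNatIso (D.mapComp u.toCatHom.op p.toCatHom.op)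

/-- Evaluation `b^* : D(B) → D(∗)` at an object. -/
abbrev eval (b : B) : D.Coh B ⥤ D.Coh Pt.{w} := D.res (ptAt b)

/-! ### The axioms of a derivator -/

variable (u : A ⥤ B) (b : B)

/-- The transformation `u ∘ p → b ∘ π` on the slice category `(u/b)`. -/
def sliceOver : CostructuredArrow.proj u b ⋙ u ⟶ toPt (CostructuredArrow u b) ⋙ ptAt b where
  app x := x.hom
  naturality _ _ f := (CostructuredArrow.w f).trans (Category.comp_id _).symm

/-- The transformation `b ∘ π → u ∘ q` on the slice category `(b/u)`. -/
def sliceUnder : toPt (StructuredArrow b u) ⋙ ptAt b ⟶ StructuredArrow.proj b u ⋙ u where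
  app x := x.hom
  naturality _ _ f := (Category.id_comp _).trans (StructuredArrow.w f).symm

/-- The induced transformation `p^* u^* → π^* b^*`. -/
def sliceOverSquare :
    TwoSquare (D.res u) (D.eval b) (D.res (CostructuredArrow.proj u b))
      (D.res (toPt (CostructuredArrow u b))) :=
  (D.resComp _ _).inv ≫ D.resMap (sliceOver u b) ≫ (D.resComp _ _).hom

/-- The induced transformation `π^* b^* → q^* u^*`. -/
def sliceUnderSquare :
    TwoSquare (D.eval b) (D.res u) (D.res (toPt (StructuredArrow b u)))
      (D.res (StructuredArrow.proj b u)) :=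
  (D.resComp _ _).inv ≫ D.resMap (sliceUnder u b) ≫ (D.resComp _ _).hom

end

/-- (Der1): coherent diagrams on a coproduct of small categories are families of coherent
diagrams on the summands. -/
def Der1 : Prop :=
  ∀ (I : Type w) (B : I → Type w) [∀ i, Category.{w} (B i)],
    (Functor.pi' fun i => D.res (Sigma.incl i : B i ⥤ Σ i, B i)).IsEquivalence

/-- (Der2): isomorphisms are detected pointwise. -/
def Der2 : Prop :=
  ∀ (B : Type w) [Category.{w} B] ⦃X Y : D.Coh B⦄ (f : X ⟶ Y),
    IsIso f ↔ ∀ b : B, IsIso ((D.eval b).map f)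

/-- (Der3): restriction functors have adjoints on both sides. -/
def Der3 : Prop :=
  ∀ (A B : Type w) [Category.{w} A] [Category.{w} B] (u : A ⥤ B),
    (D.res u).IsRightAdjoint ∧ (D.res u).IsLeftAdjoint

/-- (Der4): Kan extensions are pointwise: the canonical mates
`colim_{(u/b)} p^* → b^* u_!` and `b^* u_* → lim_{(b/u)} q^*` are invertible. Adjoints are
unique up to unique isomorphism, so it does not matter which ones are used. -/
def Der4 : Prop :=
  ∀ (A B : Type w) [Category.{w} A] [Category.{w} B] (u : A ⥤ B) (b : B),
    (∀ (lan : D.Coh A ⥤ D.Coh B) (adj : lan ⊣ D.res u)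
        (colim : D.Coh (CostructuredArrow u b) ⥤ D.Coh Pt.{w}) (adj' : colim ⊣ D.res (toPt _)),
      IsIso ((CategoryTheory.mateEquiv adj adj').symm (D.sliceOverSquare u b)).natTrans) ∧
    (∀ (ran : D.Coh A ⥤ D.Coh B) (adj : D.res u ⊣ ran)
        (lim : D.Coh (StructuredArrow b u) ⥤ D.Coh Pt.{w}) (adj' : D.res (toPt _) ⊣ lim),
      IsIso (CategoryTheory.mateEquiv adj adj' (D.sliceUnderSquare u b)).natTrans)

/-- A derivator is a prederivator satisfying (Der1)–(Der4). -/
structure IsDerivator : Prop where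
  der1 : D.Der1
  der2 : D.Der2
  der3 : D.Der3
  der4 : D.Der4

/-! ### Pointed and stable derivators -/

/-- A derivator is pointed if its underlying category `D(∗)` has a zero object. -/
def IsPointed : Prop := Limits.HasZeroObject (D.Coh Pt.{w})

end Prederivator

/-- The square `□ = [1] × [1]`, as a poset. -/
abbrev Sq : Type w := ULift.{w} (Fin 2 × Fin 2)

/-- The subposet `⌜` of the square: all vertices but the final one `(1,1)`. -/
abbrev SpanShape : Type w := {p : Sq.{w} // p ≠ ⟨(1, 1)⟩}

/-- The subposet `⌟` of the square: all vertices but the initial one `(0,0)`. -/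
abbrev CospanShape : Type w := {p : Sq.{w} // p ≠ ⟨(0, 0)⟩}

/-- The inclusion of `⌜` in the square. -/
abbrev spanIncl : SpanShape.{w} ⥤ Sq.{w} := (Subtype.mono_coe _).functor

/-- The inclusion of `⌟` in the square. -/
abbrev cospanIncl : CospanShape.{w} ⥤ Sq.{w} := (Subtype.mono_coe _).functor

namespace Prederivator

variable (D : Prederivator.{w, v, u})

/-- A square is cocartesian if it lies in the essential image of the left Kan extension
functor `D(⌜) → D(□)`. -/
def IsCocartesian (X : D.Coh Sq.{w}) : Prop :=
  ∃ (lan : D.Coh SpanShape.{w} ⥤ D.Coh Sq.{w}) (_ : lan ⊣ D.res spanIncl), lan.essImage X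

/-- A square is cartesian if it lies in the essential image of the right Kan extension
functor `D(⌟) → D(□)`. -/
def IsCartesian (X : D.Coh Sq.{w}) : Prop :=
  ∃ (ran : D.Coh CospanShape.{w} ⥤ D.Coh Sq.{w}) (_ : D.res cospanIncl ⊣ ran), ran.essImage X

/-- A stable derivator is a pointed derivator in which a square is cocartesian if and only if
it is cartesian. -/
structure IsStableDerivator : Prop extends D.IsDerivator where
  pointed : D.IsPointed
  cocartesian_iff_cartesian : ∀ X : D.Coh Sq.{w}, D.IsCocartesian X ↔ D.IsCartesian X

end Prederivator


/-! ### Exact morphisms -/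

/-- A morphism of prederivators is a pseudo-natural transformation. -/
abbrev Mor (D E : Prederivator.{w, v, u}) : Type _ := D.toPseudofunctor ⟶ E.toPseudofunctor

namespace Mor

variable {D E G : Prederivator.{w, v, u}}

/-- The component `F_A : D(A) → E(A)` of a morphism. -/
abbrev coh (F : Mor D E) (A : Type w) [Category.{w} A] : D.Coh A ⥤ E.Coh A :=
  (F.app (op (Cat.of A))).toFunctor

/-- The structure isomorphism between `F u^*` and `u^* F` of a morphism `F`. -/
abbrev cohRes (F : Mor D E) {A B : Type w} [Category.{w} A] [Category.{w} B] (u : A ⥤ B) :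
    D.res u ⋙ F.coh A ≅ F.coh B ⋙ E.res u :=
  Cat.Hom.toNatIso (F.naturality u.toCatHom.op)

/-- `F` preserves colimits of shape `A`: the canonical mate `colim_A F → F colim_A` is
invertible. -/
def PreservesColimitsOfShape (F : Mor D E) (A : Type w) [Category.{w} A] : Prop :=
  ∀ (colim : D.Coh A ⥤ D.Coh Pt.{w}) (adj : colim ⊣ D.res (toPt A))
    (colim' : E.Coh A ⥤ E.Coh Pt.{w}) (adj' : colim' ⊣ E.res (toPt A)),
    IsIso ((CategoryTheory.mateEquiv adj adj').symm
      (TwoSquare.mk _ _ _ _ (F.cohRes (toPt A)).hom)).natTrans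

/-- `F` preserves limits of shape `A`: the canonical mate `F lim_A → lim_A F` is invertible. -/
def PreservesLimitsOfShape (F : Mor D E) (A : Type w) [Category.{w} A] : Prop :=
  ∀ (lim : D.Coh A ⥤ D.Coh Pt.{w}) (adj : D.res (toPt A) ⊣ lim)
    (lim' : E.Coh A ⥤ E.Coh Pt.{w}) (adj' : E.res (toPt A) ⊣ lim'),
    IsIso (CategoryTheory.mateEquiv adj adj'
      (TwoSquare.mk _ _ _ _ (F.cohRes (toPt A)).inv)).natTrans

/-- A right exact morphism preserves initial objects and pushouts. -/
structure IsRightExact (F : Mor D E) : Prop where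
  initial : ∀ X : D.Coh Pt.{w},
    Nonempty (Limits.IsInitial X) → Nonempty (Limits.IsInitial ((F.coh Pt.{w}).obj X))
  pushouts : F.PreservesColimitsOfShape SpanShape.{w}

/-- A left exact morphism preserves terminal objects and pullbacks. -/
structure IsLeftExact (F : Mor D E) : Prop where
  terminal : ∀ X : D.Coh Pt.{w},
    Nonempty (Limits.IsTerminal X) → Nonempty (Limits.IsTerminal ((F.coh Pt.{w}).obj X))
  pullbacks : F.PreservesLimitsOfShape CospanShape.{w}

/-- An exact morphism is right exact and left exact. -/
structure IsExact (F : Mor D E) : Prop where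
  right : F.IsRightExact
  left : F.IsLeftExact

/-! Exact morphisms contain identities and are closed under composition. -/

section Mates

variable {C₁ C₂ C₃ D₁ D₂ D₃ : Type*} [Category* C₁] [Category* C₂] [Category* C₃]
  [Category* D₁] [Category* D₂] [Category* D₃]
  {L₁ : C₁ ⥤ D₁} {R₁ : D₁ ⥤ C₁} {L₂ : C₂ ⥤ D₂} {R₂ : D₂ ⥤ C₂} {L₃ : C₃ ⥤ D₃} {R₃ : D₃ ⥤ C₃}
  {F₁ : C₁ ⥤ C₂} {F₂ : C₂ ⥤ C₃} {H₁ : D₁ ⥤ D₂} {H₂ : D₂ ⥤ D₃}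

theorem isIso_mate_symm_vComp (a₁ : L₁ ⊣ R₁) (a₂ : L₂ ⊣ R₂) (a₃ : L₃ ⊣ R₃)
    (s : TwoSquare R₁ H₁ F₁ R₂) (t : TwoSquare R₂ H₂ F₂ R₃)
    (hs : IsIso ((CategoryTheory.mateEquiv a₁ a₂).symm s).natTrans)
    (ht : IsIso ((CategoryTheory.mateEquiv a₂ a₃).symm t).natTrans) :
    IsIso ((CategoryTheory.mateEquiv a₁ a₃).symm (s.vComp t)).natTrans := by
  have e := CategoryTheory.mateEquiv_vcomp a₁ a₂ a₃
    ((CategoryTheory.mateEquiv a₁ a₂).symm s) ((CategoryTheory.mateEquiv a₂ a₃).symm t)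
  rw [Equiv.apply_symm_apply, Equiv.apply_symm_apply, ← Equiv.eq_symm_apply] at e
  rw [← e]
  rw [NatTrans.isIso_iff_isIso_app] at hs ht ⊢
  intro X
  have h₁ := hs X
  have h₂ := ht (F₁.obj X)
  rw [TwoSquare.hComp_app]
  infer_instance

theorem isIso_mate_hComp (a₁ : L₁ ⊣ R₁) (a₂ : L₂ ⊣ R₂) (a₃ : L₃ ⊣ R₃)
    (s : TwoSquare F₁ L₁ L₂ H₁) (t : TwoSquare F₂ L₂ L₃ H₂)
    (hs : IsIso (CategoryTheory.mateEquiv a₁ a₂ s).natTrans)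
    (ht : IsIso (CategoryTheory.mateEquiv a₂ a₃ t).natTrans) :
    IsIso (CategoryTheory.mateEquiv a₁ a₃ (s.hComp t)).natTrans := by
  rw [CategoryTheory.mateEquiv_vcomp a₁ a₂ a₃]
  rw [NatTrans.isIso_iff_isIso_app] at hs ht ⊢
  intro X
  have h₁ := hs X
  have h₂ := ht (H₁.obj X)
  rw [TwoSquare.vComp_app]
  infer_instance

theorem isIso_mate_symm_id {L L' : C₁ ⥤ D₁} {R : D₁ ⥤ C₁} (a : L ⊣ R) (a' : L' ⊣ R)
    (s : TwoSquare R (𝟭 _) (𝟭 _) R) (hs : ∀ X, s.natTrans.app X = 𝟙 _) :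
    IsIso ((CategoryTheory.mateEquiv a a').symm s).natTrans := by
  have e := CategoryTheory.conjugateEquiv_symm_iso a a' (𝟙 _)
  rw [NatTrans.isIso_iff_isIso_app] at e ⊢
  intro X
  simpa [hs] using e X

theorem isIso_mate_id {L : C₁ ⥤ D₁} {R R' : D₁ ⥤ C₁} (a : L ⊣ R) (a' : L ⊣ R')
    (s : TwoSquare (𝟭 _) L L (𝟭 _)) (hs : ∀ X, s.natTrans.app X = 𝟙 _) :
    IsIso (CategoryTheory.mateEquiv a a' s).natTrans := by
  have e := CategoryTheory.conjugateEquiv_iso a a' (𝟙 _)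
  rw [NatTrans.isIso_iff_isIso_app] at e ⊢
  intro X
  simpa [hs] using e X

end Mates

theorem PreservesColimitsOfShape.id (A : Type w) [Category.{w} A] :
    PreservesColimitsOfShape (𝟙 D.toPseudofunctor : Mor D D) A :=
  fun _ adj _ adj' => isIso_mate_symm_id adj adj' _ fun _ => Category.comp_id _

theorem PreservesLimitsOfShape.id (A : Type w) [Category.{w} A] :
    PreservesLimitsOfShape (𝟙 D.toPseudofunctor : Mor D D) A :=
  fun _ adj _ adj' => isIso_mate_id adj adj' _ fun _ => Category.comp_id _

theorem PreservesColimitsOfShape.comp {F : Mor D E} {H : Mor E G} {A : Type w} [Category.{w} A]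
    (hE : (E.res (toPt A)).IsRightAdjoint)
    (hF : F.PreservesColimitsOfShape A) (hH : H.PreservesColimitsOfShape A) :
    PreservesColimitsOfShape (F ≫ H : Mor D G) A := fun _ adj _ adj' =>
  isIso_mate_symm_vComp adj (Adjunction.ofIsRightAdjoint (E.res (toPt A))) adj' _ _
    (hF _ _ _ _) (hH _ _ _ _)

theorem comp_ids {C : Type*} [Category* C] {a b c : C} (f : a ⟶ b) (g : b ⟶ c) :
    (((𝟙 _ ≫ f) ≫ 𝟙 _) ≫ g) ≫ 𝟙 _ = f ≫ g := by simp

theorem cohRes_comp_inv (F : Mor D E) (H : Mor E G) {A B : Type w} [Category.{w} A]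
    [Category.{w} B] (u : A ⥤ B) :
    TwoSquare.mk (F.coh B ⋙ H.coh B) (D.res u) (G.res u) (F.coh A ⋙ H.coh A)
      (cohRes (F ≫ H : Mor D G) u).inv =
      (TwoSquare.mk _ _ _ _ (F.cohRes u).inv).hComp (TwoSquare.mk _ _ _ _ (H.cohRes u).inv) := by
  apply TwoSquare.ext
  intro X
  rw [TwoSquare.hComp_app]
  exact comp_ids _ _

theorem PreservesLimitsOfShape.comp {F : Mor D E} {H : Mor E G} {A : Type w} [Category.{w} A]
    (hE : (E.res (toPt A)).IsLeftAdjoint)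
    (hF : F.PreservesLimitsOfShape A) (hH : H.PreservesLimitsOfShape A) :
    PreservesLimitsOfShape (F ≫ H : Mor D G) A := fun _ adj _ adj' => by
  have := isIso_mate_hComp adj (Adjunction.ofIsLeftAdjoint (E.res (toPt A))) adj' _ _
    (hF _ _ _ _) (hH _ _ _ _)
  rw [← cohRes_comp_inv] at this
  exact this

theorem IsExact.id : IsExact (𝟙 D.toPseudofunctor : Mor D D) :=
  ⟨⟨fun _ h => h, .id _⟩, ⟨fun _ h => h, .id _⟩⟩

theorem IsExact.comp (hE : E.IsDerivator) {F : Mor D E} {H : Mor E G} (hF : F.IsExact)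
    (hH : H.IsExact) : IsExact (F ≫ H : Mor D G) :=
  ⟨⟨fun X h => hH.right.initial _ (hF.right.initial X h),
      .comp (hE.der3 _ _ _).1 hF.right.pushouts hH.right.pushouts⟩,
    ⟨fun X h => hH.left.terminal _ (hF.left.terminal X h),
      .comp (hE.der3 _ _ _).2 hF.left.pullbacks hH.left.pullbacks⟩⟩

end Mor

/-! ### The `2`-categories of prederivators and of stable derivators -/

/-- The `2`-category of prederivators, pseudo-natural transformations and modifications. The
`2`-category of derivators is the full sub-`2`-category on the derivators: it has the same
morphisms and the same natural transformations, hence the same equivalences. -/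
abbrev PDer : Type _ :=
  InducedBicategory (Pseudofunctor (Cat.{w, w})ᵒᵖ Cat.{v, u})
    (fun D : Prederivator.{w, v, u} => D.toPseudofunctor)

/-- A prederivator as an object of the `2`-category of prederivators. -/
abbrev Prederivator.toPDer (D : Prederivator.{w, v, u}) : PDer.{w, v, u} := D

/-- The objects of the `2`-category of stable derivators. -/
structure StDer : Type _ where
  /-- The underlying prederivator. -/
  pre : Prederivator.{w, v, u}
  isStable : pre.IsStableDerivator

namespace StDer

/-- Exact morphisms of stable derivators. -/
structure Hom (D E : StDer.{w, v, u}) where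
  /-- The underlying morphism. -/
  mor : Mor D.pre E.pre
  isExact : mor.IsExact

instance : CategoryStruct StDer.{w, v, u} where
  Hom := Hom
  id D := ⟨𝟙 D.pre.toPseudofunctor, .id⟩
  comp {_ E _} F H := ⟨F.mor ≫ H.mor, .comp E.isStable.toIsDerivator F.isExact H.isExact⟩

/-- Natural transformations of exact morphisms are arbitrary modifications. -/
@[ext]
structure Hom₂ {D E : StDer.{w, v, u}} (F H : D ⟶ E) where
  /-- The underlying modification. -/
  mod : F.mor ⟶ H.mor

@[simps]
instance (D E : StDer.{w, v, u}) : Category (D ⟶ E) where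
  Hom := Hom₂
  id F := ⟨𝟙 F.mor⟩
  comp η θ := ⟨η.mod ≫ θ.mod⟩

@[ext]
theorem hom₂_ext {D E : StDer.{w, v, u}} {F H : D ⟶ E} {η θ : F ⟶ H} (h : η.mod = θ.mod) :
    η = θ :=
  Hom₂.ext h

/-- Invertible natural transformations from invertible modifications. -/
@[simps]
def isoMk {D E : StDer.{w, v, u}} {F H : D ⟶ E} (e : F.mor ≅ H.mor) : F ≅ H where
  hom := ⟨e.hom⟩
  inv := ⟨e.inv⟩

/-- The `2`-category of stable derivators, exact morphisms and all natural transformations. -/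
instance : Bicategory StDer.{w, v, u} where
  homCategory _ _ := inferInstance
  whiskerLeft {_ _ _} F {_ _} η := Hom₂.mk (F.mor ◁ Hom₂.mod η)
  whiskerRight {_ _ _} {_ _} η H := Hom₂.mk (Hom₂.mod η ▷ H.mor)
  associator F G H := isoMk (α_ F.mor G.mor H.mor)
  leftUnitor F := isoMk (λ_ F.mor)
  rightUnitor F := isoMk (ρ_ F.mor)
  whiskerLeft_id _ _ := hom₂_ext (Bicategory.whiskerLeft_id _ _)
  whiskerLeft_comp _ _ _ _ _ _ := hom₂_ext (Bicategory.whiskerLeft_comp _ _ _)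
  id_whiskerLeft _ := hom₂_ext (Bicategory.id_whiskerLeft _)
  comp_whiskerLeft _ _ _ _ _ := hom₂_ext (Bicategory.comp_whiskerLeft _ _ _)
  id_whiskerRight _ _ := hom₂_ext (Bicategory.id_whiskerRight _ _)
  comp_whiskerRight _ _ _ := hom₂_ext (Bicategory.comp_whiskerRight _ _ _)
  whiskerRight_id _ := hom₂_ext (Bicategory.whiskerRight_id _)
  whiskerRight_comp _ _ _ := hom₂_ext (Bicategory.whiskerRight_comp _ _ _)
  whisker_assoc _ _ _ _ _ := hom₂_ext (Bicategory.whisker_assoc _ _ _)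
  whisker_exchange _ _ := hom₂_ext (Bicategory.whisker_exchange _ _)
  pentagon _ _ _ _ := hom₂_ext (Bicategory.pentagon _ _ _ _)
  triangle _ _ := hom₂_ext (Bicategory.triangle _ _)

end StDer

/-! ### Exponentials -/

section Exponentials

variable (A : Type w) [Category.{w} A]

/-- The shape `A × B`. -/
abbrev prodObj (B : Cat.{w, w}) : Cat.{w, w} := Cat.of (A × B)

/-- The functor `id_A × u`. -/
abbrev prodMap {B C : Cat.{w, w}} (u : B ⟶ C) : prodObj A B ⟶ prodObj A C :=
  ((𝟭 A).prod u.toFunctor).toCatHom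

/-- The natural transformation `id_A × α`. -/
abbrev prodMap₂ {B C : Cat.{w, w}} {u u' : B ⟶ C} (α : u ⟶ u') : prodMap A u ⟶ prodMap A u' :=
  (NatTrans.prod (𝟙 (𝟭 A)) α.toNatTrans).toCatHom₂

theorem prodMap₂_comp {B C : Cat.{w, w}} {u u' u'' : B ⟶ C} (α : u ⟶ u') (β : u' ⟶ u'') :
    prodMap₂ A (α ≫ β) = prodMap₂ A α ≫ prodMap₂ A β := by
  ext X
  exact Prod.ext (Category.comp_id _).symm rfl

/-- The prederivator `D^A : B ↦ D(A × B)` of diagrams of shape `A` in `D`. -/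
def Prederivator.exp (D : Prederivator.{w, v, u}) : Prederivator.{w, v, u} where
  obj B := D.obj (op (prodObj A B.unop))
  map u := D.map (prodMap A u.unop).op
  map₂ α := D.map₂ (Bicategory.Opposite.op2 (prodMap₂ A α.unop2))
  map₂_id _ := D.map₂_id _
  map₂_comp α β :=
    (congrArg (fun γ => D.map₂ (Bicategory.Opposite.op2 γ))
      (prodMap₂_comp A α.unop2 β.unop2)).trans (D.map₂_comp _ _)
  mapId B := D.mapId (op (prodObj A B.unop))
  mapComp u u' := D.mapComp (prodMap A u.unop).op (prodMap A u'.unop).op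
  map₂_whisker_left f _ _ η :=
    D.map₂_whisker_left (prodMap A f.unop).op (Bicategory.Opposite.op2 (prodMap₂ A η.unop2))
  map₂_whisker_right η f :=
    D.map₂_whisker_right (Bicategory.Opposite.op2 (prodMap₂ A η.unop2)) (prodMap A f.unop).op
  map₂_associator f g h :=
    D.map₂_associator (prodMap A f.unop).op (prodMap A g.unop).op (prodMap A h.unop).op
  map₂_left_unitor f := D.map₂_left_unitor (prodMap A f.unop).op
  map₂_right_unitor f := D.map₂_right_unitor (prodMap A f.unop).op
  map_id _ := D.map_id _
  mapId_eq_eqToIso _ := D.mapId_eq_eqToIso _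
  map_comp u u' := D.map_comp (prodMap A u.unop).op (prodMap A u'.unop).op
  mapComp_eq_eqToIso u u' :=
    D.mapComp_eq_eqToIso (prodMap A u.unop).op (prodMap A u'.unop).op

variable {D E : Prederivator.{w, v, u}}

/-- The morphism `F^A : D^A → E^A` with components `F_{A × B}`. -/
def Mor.exp (F : Mor D E) : Mor (D.exp A) (E.exp A) where
  app B := F.app (op (prodObj A B.unop))
  naturality u := F.naturality (prodMap A u.unop).op
  naturality_naturality α :=
    F.naturality_naturality (Bicategory.Opposite.op2 (prodMap₂ A α.unop2))
  naturality_id B := F.naturality_id (op (prodObj A B.unop))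
  naturality_comp u u' := F.naturality_comp (prodMap A u.unop).op (prodMap A u'.unop).op

/-- The natural transformation `F^A → H^A` with components `η_{A × B}`. -/
def Mor.expMap {F H : Mor D E} (η : F ⟶ H) : Mor.exp A F ⟶ Mor.exp A H where
  as :=
    { app := fun B => η.as.app (op (prodObj A B.unop))
      naturality := fun u => η.as.naturality (prodMap A u.unop).op }

section

variable {X : Type*} [Bicategory X] {a b c d : X}

theorem id_comp_id {f g : a ⟶ b} (η : f ⟶ g) : 𝟙 f ≫ η ≫ 𝟙 g = η := by simp

theorem associator_ids (f : a ⟶ b) (g : b ⟶ c) (h : c ⟶ d) :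
    (α_ f g h).hom =
      𝟙 _ ≫ 𝟙 (f ≫ g) ▷ h ≫ (α_ f g h).hom ≫ f ◁ 𝟙 (g ≫ h) ≫ 𝟙 _ := by simp

theorem leftUnitor_ids (f : a ⟶ b) : (λ_ f).hom = 𝟙 _ ≫ 𝟙 (𝟙 a) ▷ f ≫ (λ_ f).hom := by simp

theorem rightUnitor_ids (f : a ⟶ b) : (ρ_ f).hom = 𝟙 _ ≫ f ◁ 𝟙 (𝟙 b) ≫ (ρ_ f).hom := by simp

end

/-- The `2`-functor `D ↦ D^A` on the `2`-category of stable derivators and exact morphisms. -/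
def expFunctor : Pseudofunctor StDer.{w, v, u} PDer.{w, v, u} where
  obj D := (D.pre.exp A).toPDer
  map F := InducedBicategory.mkHom (Mor.exp A F.mor)
  map₂ η := InducedBicategory.Hom₂.mk (Mor.expMap A η.mod)
  map₂_id _ := rfl
  map₂_comp _ _ := rfl
  mapId D := Iso.refl (𝟙 (D.pre.exp A).toPDer)
  mapComp {D E G} F H := Iso.refl
    ((InducedBicategory.mkHom (Mor.exp A F.mor) : (D.pre.exp A).toPDer ⟶ (E.pre.exp A).toPDer) ≫
      (InducedBicategory.mkHom (Mor.exp A H.mor) : _ ⟶ (G.pre.exp A).toPDer))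
  map₂_whisker_left _ _ _ _ := by
    apply InducedBicategory.hom₂_ext
    apply Pseudofunctor.StrongTrans.homCategory.ext
    intro B
    exact (id_comp_id _).symm
  map₂_whisker_right _ _ := by
    apply InducedBicategory.hom₂_ext
    apply Pseudofunctor.StrongTrans.homCategory.ext
    intro B
    exact (id_comp_id _).symm
  map₂_associator F H K := by
    apply InducedBicategory.hom₂_ext
    apply Pseudofunctor.StrongTrans.homCategory.ext
    intro B
    exact associator_ids _ _ _
  map₂_left_unitor F := by
    apply InducedBicategory.hom₂_ext
    apply Pseudofunctor.StrongTrans.homCategory.ext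
    intro B
    exact leftUnitor_ids _
  map₂_right_unitor F := by
    apply InducedBicategory.hom₂_ext
    apply Pseudofunctor.StrongTrans.homCategory.ext
    intro B
    exact rightUnitor_ids _

end Exponentials

/-! ### Strong stable equivalences -/

/-- Two small categories are strongly stably equivalent if there is a pseudo-natural
equivalence `(-)^A ≃ (-)^A'`, that is, a pseudo-natural transformation all of whose components
`Φ_D : D^A → D^A'` are equivalences (of derivators). -/
def StronglyStablyEquivalent (A A' : Type w) [Category.{w} A] [Category.{w} A'] : Prop :=
  ∃ Φ : expFunctor.{w, v, u} A ⟶ expFunctor.{w, v, u} A',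
    ∀ D : StDer.{w, v, u},
      ∃ e : Bicategory.Equivalence ((expFunctor A).obj D) ((expFunctor A').obj D), e.hom = Φ.app D

/-- A quiver of type `A_n`: its underlying unoriented graph is the path `0 — 1 — ⋯ — n-1`, so
there is exactly one arrow, in one of the two directions, between consecutive vertices, and
there are no other arrows. -/
def IsQuiverOfTypeA (n : ℕ) (Q : Type w) [Quiver.{w} Q] : Prop :=
  ∃ e : Fin n ≃ Q,
    (∀ i j : Fin n, i.val + 1 = j.val → Nonempty (Unique ((e i ⟶ e j) ⊕ (e j ⟶ e i)))) ∧
    (∀ i j : Fin n, i.val + 1 ≠ j.val → j.val + 1 ≠ i.val → IsEmpty (e i ⟶ e j))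

end DerivatorTheory

/-!
Two shapes are compared through a third one. Suppose that `A` and `A'` both map to a shape `K`, and
that in every stable derivator `D` there is a class of `K`-diagrams, with parameters in `B`, that is
stable under restriction in `B` and under exact morphisms, and on which restriction to `A` and
restriction to `A'` are both equivalences. These classes form a `2`-functor of `D`, and the two
restrictions are pseudo-natural transformations from it whose components are equivalences of
derivators. Inverting one of them (`exists_inverse_of_isEquiv₁_app`: the mates of the naturality
constraints make the adjoint inverses of the components pseudo-natural) gives a strong stable
equivalence between `A` and `A'`; this is `stronglyStablyEquivalent_of_pointwise_property`.

The classes that occur are described by Kan extensions. A diagram `X` on `K` is left extended from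
a full subcategory `A` if for each `k` the canonical cocone over the slice `(A/k)` exhibits `X k` as
a colimit. By (Der2) and (Der4) restriction to `A` is fully faithful on the left extended diagrams
and every `A`-diagram has a left extension (`LeftExtended.bijective_map`,
`IsDerivator.exists_leftExtended`). The parameters in `B` play no role, since the slice
`(A × B/(k,b))` contains `(A/k)` as a final subcategory (`leftExtended_prod_iff`). Dual statements
hold for right extensions.

* Spans and cospans: take the square for `K` and the cocartesian squares for the class. These are
  the squares that are left extended from the span and, by stability, the squares that are right
  extended from the cospan (`stronglyStablyEquivalent_span_cospan`).
* The linear shape `x → y → z` and the span `z ← y → w`: take for `K` the poset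

      x → y → z
      ↓   ↓
      o → w

  and the diagrams that are zero at `o` and whose square is cocartesian. Such a diagram is determined
  by `x → y → z` (extend by a terminal object at `o`, then by a pushout at `w`) and equally by
  `z ← y → w` (extend by an initial object at `o`, then by a pullback at `x`), because initial
  objects are terminal and cocartesian squares are cartesian (`stronglyStablyEquivalent_row_roof`).

The category of paths of a quiver of type `A₃` is a poset, and for each of the four orientations it
is the linear shape, the span or the cospan
(`IsQuiverOfTypeA.stronglyStablyEquivalent_row`).
-/

namespace DerivatorTheory

/-! ### Equivalences in bicategories of pseudofunctors -/

section BicatEquiv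

variable {B C : Type*} [Bicategory B] [Bicategory C]

section

variable {a b c d : C} {g g' : a ⟶ c} {h h' : b ⟶ d} {l₁ : a ⟶ b} {r₁ : b ⟶ a} {l₂ : c ⟶ d}
  {r₂ : d ⟶ c}

theorem isIso_mateEquiv (adj₁ : l₁ ⊣ r₁) (adj₂ : l₂ ⊣ r₂) [IsIso adj₁.counit] [IsIso adj₂.unit]
    (α : g ≫ l₂ ⟶ l₁ ≫ h) [IsIso α] : IsIso (Bicategory.mateEquiv adj₁ adj₂ α) := by
  rw [Bicategory.mateEquiv_apply']
  dsimp only [bicategoricalComp]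
  infer_instance

/-- Mates are compatible with pasting `2`-cells on the other two sides of the square. -/
theorem mateEquiv_naturality (adj₁ : l₁ ⊣ r₁) (adj₂ : l₂ ⊣ r₂) (α : g ≫ l₂ ⟶ l₁ ≫ h)
    (α' : g' ≫ l₂ ⟶ l₁ ≫ h') (σ : g ⟶ g') (τ : h ⟶ h') (w : σ ▷ l₂ ≫ α' = α ≫ l₁ ◁ τ) :
    Bicategory.mateEquiv adj₁ adj₂ α ≫ τ ▷ r₂ = r₁ ◁ σ ≫ Bicategory.mateEquiv adj₁ adj₂ α' := by
  rw [Bicategory.mateEquiv_apply', Bicategory.mateEquiv_apply']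
  calc
    _ = 𝟙 _ ⊗≫ r₁ ◁ g ◁ adj₂.unit ⊗≫ r₁ ◁ α ▷ r₂ ⊗≫
        (adj₁.counit ▷ h ≫ 𝟙 b ◁ τ) ▷ r₂ ⊗≫ 𝟙 _ := by bicategory
    _ = 𝟙 _ ⊗≫ r₁ ◁ g ◁ adj₂.unit ⊗≫ r₁ ◁ (α ≫ l₁ ◁ τ) ▷ r₂ ⊗≫ adj₁.counit ▷ h' ▷ r₂ ⊗≫ 𝟙 _ := by
      rw [← whisker_exchange]; bicategory
    _ = 𝟙 _ ⊗≫ r₁ ◁ (g ◁ adj₂.unit ≫ σ ▷ (l₂ ≫ r₂)) ⊗≫ r₁ ◁ α' ▷ r₂ ⊗≫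
        adj₁.counit ▷ h' ▷ r₂ ⊗≫ 𝟙 _ := by
      rw [← w]; bicategory
    _ = _ := by
      rw [whisker_exchange]; bicategory

/-- The mate of `α` corresponds to `α` under the units. -/
theorem unit_mateEquiv (adj₁ : l₁ ⊣ r₁) (adj₂ : l₂ ⊣ r₂) (α : g ≫ l₂ ⟶ l₁ ≫ h) :
    adj₁.unit ▷ g ⊗≫ l₁ ◁ Bicategory.mateEquiv adj₁ adj₂ α =
      𝟙 _ ⊗≫ g ◁ adj₂.unit ⊗≫ α ▷ r₂ ⊗≫ 𝟙 _ := by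
  rw [Bicategory.mateEquiv_apply']
  calc
    _ = 𝟙 _ ⊗≫ (adj₁.unit ▷ (g ≫ 𝟙 _) ≫ (l₁ ≫ r₁) ◁ (g ◁ adj₂.unit)) ⊗≫
          l₁ ◁ r₁ ◁ α ▷ r₂ ⊗≫ l₁ ◁ adj₁.counit ▷ h ▷ r₂ ⊗≫ 𝟙 _ := by bicategory
    _ = 𝟙 _ ⊗≫ g ◁ adj₂.unit ⊗≫ (adj₁.unit ▷ (g ≫ l₂) ≫ (l₁ ≫ r₁) ◁ α) ▷ r₂ ⊗≫
          l₁ ◁ adj₁.counit ▷ h ▷ r₂ ⊗≫ 𝟙 _ := by rw [← whisker_exchange]; bicategory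
    _ = 𝟙 _ ⊗≫ g ◁ adj₂.unit ⊗≫ α ▷ r₂ ⊗≫ (leftZigzag adj₁.unit adj₁.counit) ▷ h ▷ r₂ ⊗≫ 𝟙 _ := by
      rw [← whisker_exchange]; bicategory
    _ = _ := by rw [adj₁.left_triangle]; bicategory

/-- The mate of `α` corresponds to `α` under the counits. -/
theorem mateEquiv_counit (adj₁ : l₁ ⊣ r₁) (adj₂ : l₂ ⊣ r₂) (α : g ≫ l₂ ⟶ l₁ ≫ h) :
    Bicategory.mateEquiv adj₁ adj₂ α ▷ l₂ ⊗≫ h ◁ adj₂.counit =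
      𝟙 _ ⊗≫ r₁ ◁ α ⊗≫ adj₁.counit ▷ h ⊗≫ 𝟙 _ := by
  rw [Bicategory.mateEquiv_apply']
  calc
    _ = 𝟙 _ ⊗≫ r₁ ◁ g ◁ adj₂.unit ▷ l₂ ⊗≫ r₁ ◁ α ▷ r₂ ▷ l₂ ⊗≫
          (adj₁.counit ▷ (h ≫ r₂ ≫ l₂) ≫ 𝟙 _ ◁ (h ◁ adj₂.counit)) ⊗≫ 𝟙 _ := by bicategory
    _ = 𝟙 _ ⊗≫ r₁ ◁ g ◁ adj₂.unit ▷ l₂ ⊗≫ r₁ ◁ (α ▷ (r₂ ≫ l₂) ≫ (l₁ ≫ h) ◁ adj₂.counit) ⊗≫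
          adj₁.counit ▷ h ⊗≫ 𝟙 _ := by rw [← whisker_exchange]; bicategory
    _ = 𝟙 _ ⊗≫ r₁ ◁ g ◁ leftZigzag adj₂.unit adj₂.counit ⊗≫ r₁ ◁ α ⊗≫ adj₁.counit ▷ h ⊗≫ 𝟙 _ := by
      rw [← whisker_exchange]; bicategory
    _ = _ := by rw [adj₂.left_triangle]; bicategory

end

variable {F G : B ⥤ᵖ C} (Φ : F ⟶ G) (Ψ : ∀ a, G.obj a ⟶ F.obj a) (adj : ∀ a, Φ.app a ⊣ Ψ a)

/-- The mate of the naturality constraint of a strong transformation whose components have right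
adjoints. -/
abbrev mateNat {a b : B} (f : a ⟶ b) : Ψ a ≫ F.map f ⟶ G.map f ≫ Ψ b :=
  Bicategory.mateEquiv (adj a) (adj b) (Φ.naturality f).hom

theorem mateNat_naturality {a b : B} {f g : a ⟶ b} (η : f ⟶ g) :
    mateNat Φ Ψ adj f ≫ G.map₂ η ▷ Ψ b = Ψ a ◁ F.map₂ η ≫ mateNat Φ Ψ adj g :=
  mateEquiv_naturality _ _ _ _ _ _ (Φ.naturality_naturality η)

theorem mateNat_id (a : B) :
    mateNat Φ Ψ adj (𝟙 a) ≫ (G.mapId a).hom ▷ Ψ a =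
      Ψ a ◁ (F.mapId a).hom ≫ (ρ_ (Ψ a)).hom ≫ (λ_ (Ψ a)).inv := by
  rw [← Bicategory.mateEquiv_leftUnitor_hom_rightUnitor_inv (adj a)]
  exact mateEquiv_naturality _ _ _ _ _ _ ((Φ.naturality_id a).symm)

theorem mateNat_comp {a b c : B} (f : a ⟶ b) (g : b ⟶ c) :
    mateNat Φ Ψ adj (f ≫ g) ≫ (G.mapComp f g).hom ▷ Ψ c =
      Ψ a ◁ (F.mapComp f g).hom ≫ (α_ _ _ _).inv ≫ mateNat Φ Ψ adj f ▷ F.map g ≫ (α_ _ _ _).hom ≫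
        G.map f ◁ mateNat Φ Ψ adj g ≫ (α_ _ _ _).inv := by
  have e := mateEquiv_naturality (adj a) (adj c) (Φ.naturality (f ≫ g)).hom
    (leftAdjointSquare.vcomp (Φ.naturality f).hom (Φ.naturality g).hom)
    (F.mapComp f g).hom (G.mapComp f g).hom (by
      rw [Φ.naturality_comp f g]; simp [leftAdjointSquare.vcomp])
  rw [Bicategory.mateEquiv_vcomp (adj a) (adj b) (adj c)] at e
  rw [e]
  simp [rightAdjointSquare.vcomp]

variable [∀ a, IsIso (adj a).unit] [∀ a, IsIso (adj a).counit]

instance {a b : B} (f : a ⟶ b) : IsIso (mateNat Φ Ψ adj f) :=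
  isIso_mateEquiv (adj a) (adj b) _

/-- The strong transformation formed by the inverses of the components of a strong transformation
whose components are equivalences. -/
noncomputable def invTrans : G ⟶ F where
  app := Ψ
  naturality f := (asIso (mateNat Φ Ψ adj f)).symm
  naturality_naturality η := by
    simp only [Iso.symm_hom, asIso_inv]
    rw [IsIso.comp_inv_eq, Category.assoc, IsIso.eq_inv_comp]
    exact mateNat_naturality Φ Ψ adj η
  naturality_id a := by
    simp only [Iso.symm_hom, asIso_inv]
    rw [IsIso.inv_comp_eq, ← Category.assoc, mateNat_id]
    simp
  naturality_comp f g := by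
    simp only [Iso.symm_hom, asIso_inv]
    rw [IsIso.inv_comp_eq, ← Category.assoc, mateNat_comp]
    simp

/-- The units of the adjoint equivalences of the components form a modification. -/
theorem unit_naturality_invTrans {a b : B} (f : a ⟶ b) :
    F.map f ◁ (adj b).unit ≫ ((Φ ≫ invTrans Φ Ψ adj).naturality f).hom =
      ((𝟙 F : F ⟶ F).naturality f).hom ≫ (adj a).unit ▷ F.map f := by
  have e := unit_mateEquiv (adj a) (adj b) (Φ.naturality f).hom
  have h : Φ.app a ◁ mateNat Φ Ψ adj f ≫ Φ.app a ◁ inv (mateNat Φ Ψ adj f) = 𝟙 _ := by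
    rw [← Bicategory.whiskerLeft_comp, IsIso.hom_inv_id, Bicategory.whiskerLeft_id]
  rw [Pseudofunctor.StrongTrans.categoryStruct_comp_naturality_hom,
    Pseudofunctor.StrongTrans.categoryStruct_id_naturality_hom]
  change F.map f ◁ (adj b).unit ≫ (α_ _ _ _).inv ≫ (Φ.naturality f).hom ▷ Ψ b ≫ (α_ _ _ _).hom ≫
    Φ.app a ◁ inv (mateNat Φ Ψ adj f) ≫ (α_ _ _ _).inv = _
  have e' : F.map f ◁ (adj b).unit ≫ (α_ _ _ _).inv ≫ (Φ.naturality f).hom ▷ Ψ b ≫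
      (α_ _ _ _).hom = ((ρ_ (F.map f)).hom ≫ (λ_ (F.map f)).inv ≫ (adj a).unit ▷ F.map f ≫
        (α_ _ _ _).hom) ≫ Φ.app a ◁ mateNat Φ Ψ adj f := by
    simp only [Category.assoc]
    simp [bicategoricalComp] at e
    rw [e]
    simp
  simp only [Category.assoc] at e' ⊢
  rw [reassoc_of% e', reassoc_of% h]
  simp only [Iso.hom_inv_id, Category.comp_id]
  exact (Category.assoc _ _ _).symm

/-- The counits of the adjoint equivalences of the components form a modification. -/
theorem counit_naturality_invTrans {a b : B} (f : a ⟶ b) :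
    G.map f ◁ (adj b).counit ≫ ((𝟙 G : G ⟶ G).naturality f).hom =
      ((invTrans Φ Ψ adj ≫ Φ).naturality f).hom ≫ (adj a).counit ▷ G.map f := by
  have e := mateEquiv_counit (adj a) (adj b) (Φ.naturality f).hom
  have h : inv (mateNat Φ Ψ adj f) ▷ Φ.app b ≫ mateNat Φ Ψ adj f ▷ Φ.app b = 𝟙 _ := by
    rw [← Bicategory.comp_whiskerRight, IsIso.inv_hom_id, Bicategory.id_whiskerRight]
  rw [Pseudofunctor.StrongTrans.categoryStruct_comp_naturality_hom,
    Pseudofunctor.StrongTrans.categoryStruct_id_naturality_hom]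
  change _ = ((α_ _ _ _).inv ≫ inv (mateNat Φ Ψ adj f) ▷ Φ.app b ≫ (α_ _ _ _).hom ≫
    Ψ a ◁ (Φ.naturality f).hom ≫ (α_ _ _ _).inv) ≫ (adj a).counit ▷ G.map f
  have e' : Ψ a ◁ (Φ.naturality f).hom ≫ (α_ _ _ _).inv ≫ (adj a).counit ▷ G.map f =
      (α_ _ _ _).inv ≫ mateNat Φ Ψ adj f ▷ Φ.app b ≫ (α_ _ _ _).hom ≫
        G.map f ◁ (adj b).counit ≫ (ρ_ (G.map f)).hom ≫ (λ_ (G.map f)).inv := by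
    simp [bicategoricalComp] at e
    rw [reassoc_of% e]
    simp
  simp only [Category.assoc]
  rw [e', Iso.hom_inv_id_assoc, reassoc_of% h]
  exact (Iso.inv_hom_id_assoc _ _).symm

/-- A strong transformation whose components are equivalences is an equivalence. -/
noncomputable def transEquivalence : Bicategory.Equivalence F G :=
  Bicategory.Equivalence.mkOfAdjointifyCounit (f := Φ) (g := invTrans Φ Ψ adj)
    (Pseudofunctor.StrongTrans.isoMk
      (fun a => (asIso (adj a).unit : 𝟙 (F.obj a) ≅ Φ.app a ≫ Ψ a))
      (unit_naturality_invTrans Φ Ψ adj))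
    (Pseudofunctor.StrongTrans.isoMk
      (fun a => (asIso (adj a).counit : Ψ a ≫ Φ.app a ≅ 𝟙 (G.obj a)))
      (counit_naturality_invTrans Φ Ψ adj))

end BicatEquiv

/-- A `1`-morphism of a bicategory is an equivalence. -/
def IsEquiv₁ {C : Type*} [Bicategory C] {a b : C} (f : a ⟶ b) : Prop :=
  ∃ e : Bicategory.Equivalence a b, e.hom = f

section

variable {C : Type*} [Bicategory C] {a b c : C}

/-- Equivalences are the left adjoints with invertible unit and counit. -/
theorem isEquiv₁_iff {f : a ⟶ b} :
    IsEquiv₁ f ↔ ∃ (g : b ⟶ a) (adj : f ⊣ g), IsIso adj.unit ∧ IsIso adj.counit := by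
  constructor
  · rintro ⟨e, rfl⟩
    exact ⟨e.inv, ⟨e.unit.hom, e.counit.hom, e.left_triangle_hom, e.right_triangle_hom⟩,
      inferInstance, inferInstance⟩
  · rintro ⟨g, adj, h₁, h₂⟩
    exact ⟨.mkOfAdjointifyCounit (asIso adj.unit) (asIso adj.counit), rfl⟩

theorem IsEquiv₁.mk {f : a ⟶ b} {g : b ⟶ a} (i : 𝟙 a ≅ f ≫ g) (j : g ≫ f ≅ 𝟙 b) : IsEquiv₁ f :=
  ⟨.mkOfAdjointifyCounit i j, rfl⟩

theorem IsEquiv₁.comp {f : a ⟶ b} {g : b ⟶ c} (hf : IsEquiv₁ f) (hg : IsEquiv₁ g) :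
    IsEquiv₁ (f ≫ g) := by
  rw [isEquiv₁_iff] at hf hg ⊢
  obtain ⟨f', adj, h₁, h₂⟩ := hf
  obtain ⟨g', adj', h₁', h₂'⟩ := hg
  refine ⟨g' ≫ f', adj.comp adj', ?_, ?_⟩ <;>
  · simp only [Bicategory.Adjunction.comp_unit, Bicategory.Adjunction.comp_counit,
      Bicategory.Adjunction.compUnit, Bicategory.Adjunction.compCounit, bicategoricalComp]
    infer_instance

variable {B : Type*} [Bicategory B] {F G H : B ⥤ᵖ C}

/-- A strong transformation whose components are equivalences has an inverse. In contrast to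
`isEquiv₁_of_isEquiv₁_app`, only the components of the inverse are recorded. -/
theorem exists_inverse_of_isEquiv₁_app (Φ : F ⟶ G) (h : ∀ a, IsEquiv₁ (Φ.app a)) :
    ∃ Ψ : G ⟶ F, ∀ a, IsEquiv₁ (Ψ.app a) := by
  have h' := fun a => isEquiv₁_iff.1 (h a)
  choose Ψ adj h₁ h₂ using h'
  refine ⟨invTrans Φ Ψ adj, fun a => ⟨.mkOfAdjointifyCounit (asIso (adj a).counit).symm
    (asIso (adj a).unit).symm, rfl⟩⟩

theorem isEquiv₁_of_isEquiv₁_app (Φ : F ⟶ G) (h : ∀ a, IsEquiv₁ (Φ.app a)) : IsEquiv₁ Φ := by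
  have h' := fun a => isEquiv₁_iff.1 (h a)
  choose Ψ adj h₁ h₂ using h'
  exact ⟨transEquivalence Φ Ψ adj, rfl⟩

end

theorem isEquiv₁_cat {C D : Cat.{v, u}} (f : C ⟶ D) [f.toFunctor.IsEquivalence] :
    IsEquiv₁ f :=
  .mk (g := f.toFunctor.inv.toCatHom) (Cat.Hom.isoMk f.toFunctor.asEquivalence.unitIso)
    (Cat.Hom.isoMk f.toFunctor.asEquivalence.counitIso)

/-- Equivalences of prederivators can be tested in the ambient `2`-category of pseudofunctors. -/
theorem isEquiv₁_pder {D E : PDer.{w, v, u}} (f : D ⟶ E) (h : IsEquiv₁ f.hom) :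
    IsEquiv₁ f := by
  obtain ⟨g, ⟨i⟩, ⟨j⟩⟩ : ∃ g, Nonempty (𝟙 _ ≅ f.hom ≫ g) ∧ Nonempty (g ≫ f.hom ≅ 𝟙 _) := by
    rw [isEquiv₁_iff] at h
    obtain ⟨g, adj, h₁, h₂⟩ := h
    exact ⟨g, ⟨asIso adj.unit⟩, ⟨asIso adj.counit⟩⟩
  exact .mk (g := InducedBicategory.mkHom (X := E) (Y := D) g) (InducedBicategory.isoMk i)
    (InducedBicategory.isoMk j)

/-- Equivalences of prederivators are pointwise. -/
theorem isEquiv₁_pder_of_app {D E : PDer.{w, v, u}} (f : D ⟶ E)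
    (h : ∀ B, (f.hom.app B).toFunctor.IsEquivalence) : IsEquiv₁ f :=
  isEquiv₁_pder f (isEquiv₁_of_isEquiv₁_app f.hom fun B => have := h B; isEquiv₁_cat _)

theorem StronglyStablyEquivalent.symm {A A' : Type w} [Category.{w} A] [Category.{w} A']
    (h : StronglyStablyEquivalent.{w, v, u} A A') : StronglyStablyEquivalent.{w, v, u} A' A := by
  obtain ⟨Φ, h⟩ := h
  exact exists_inverse_of_isEquiv₁_app Φ h

theorem StronglyStablyEquivalent.trans {A A' A'' : Type w} [Category.{w} A] [Category.{w} A']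
    [Category.{w} A''] (h : StronglyStablyEquivalent.{w, v, u} A A')
    (h' : StronglyStablyEquivalent.{w, v, u} A' A'') :
    StronglyStablyEquivalent.{w, v, u} A A'' := by
  obtain ⟨Φ, h⟩ := h
  obtain ⟨Ψ, h'⟩ := h'
  exact ⟨Φ ≫ Ψ, fun D => IsEquiv₁.comp (h D) (h' D)⟩

/-- Two shapes are strongly stably equivalent if the `2`-functors they represent receive pointwise
equivalences from a common `2`-functor. -/
theorem stronglyStablyEquivalent_of_span {A A' : Type w} [Category.{w} A] [Category.{w} A']
    {T : StDer.{w, v, u} ⥤ᵖ PDer.{w, v, u}} (Φ : T ⟶ expFunctor A) (Ψ : T ⟶ expFunctor A')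
    (h : ∀ D, IsEquiv₁ (Φ.app D)) (h' : ∀ D, IsEquiv₁ (Ψ.app D)) :
    StronglyStablyEquivalent.{w, v, u} A A' := by
  obtain ⟨Φ', h⟩ := exists_inverse_of_isEquiv₁_app Φ h
  exact ⟨Φ' ≫ Ψ, fun D => IsEquiv₁.comp (h D) (h' D)⟩

/-! ### Sub-prederivators -/

/-- Functors to a full subcategory are equal if they are equal in the ambient category. The
strictness of sub-prederivators rests on this. -/
theorem fullSubcategory_functor_ext {C D : Type*} [Category* C] [Category* D] {P : ObjectProperty D}
    {F G : C ⥤ P.FullSubcategory} (h : F ⋙ P.ι = G ⋙ P.ι) : F = G := by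
  have ho : ∀ X, F.obj X = G.obj X := fun X =>
    ObjectProperty.FullSubcategory.ext (Functor.congr_obj h X)
  refine CategoryTheory.Functor.ext ho fun X Y f => ?_
  apply P.ι.map_injective
  rw [Functor.map_comp, Functor.map_comp, eqToHom_map, eqToHom_map]
  exact Functor.congr_hom h f

theorem ι_map_eqToHom {C : Type*} [Category* C] {P : ObjectProperty C} {X Y : P.FullSubcategory}
    (h : X = Y) (h' : X.obj = Y.obj) : P.ι.map (eqToHom h) = eqToHom h' := by
  subst h
  rfl

variable {D E G : Prederivator.{w, v, u}}

/-- The sub-prederivator of `D` formed by the objects with a property that is stable under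
restriction. -/
def Prederivator.sub (D : Prederivator.{w, v, u}) (P : D.toPseudofunctor.ObjectProperty)
    [P.IsClosedUnderMapObj] : Prederivator.{w, v, u} where
  toPseudofunctor := P.fullsubcategory
  map_id X := by
    apply Cat.Hom.ext
    apply fullSubcategory_functor_ext
    change (P.prop X).ι ⋙ (D.map (𝟙 X)).toFunctor = (P.prop X).ι ⋙ 𝟭 _
    rw [D.map_id]
    rfl
  map_comp {X Y Z} f g := by
    apply Cat.Hom.ext
    apply fullSubcategory_functor_ext
    change (P.prop X).ι ⋙ (D.map (f ≫ g)).toFunctor =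
      (P.prop X).ι ⋙ (D.map f).toFunctor ⋙ (D.map g).toFunctor
    rw [D.map_comp]
    rfl
  mapId_eq_eqToIso X := by
    ext M
    apply (P.prop X).ι.map_injective
    change (D.mapId X).hom.toNatTrans.app M.obj = _
    rw [D.mapId_eq_eqToIso]
    simp only [eqToIso.hom, Cat.Hom₂.eqToHom_toNatTrans, eqToHom_app]
    symm
    exact ι_map_eqToHom _ _
  mapComp_eq_eqToIso {X Y Z} f g := by
    ext M
    apply (P.prop Z).ι.map_injective
    change (D.mapComp f g).hom.toNatTrans.app M.obj = _
    rw [D.mapComp_eq_eqToIso]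
    simp only [eqToIso.hom, Cat.Hom₂.eqToHom_toNatTrans, eqToHom_app]
    symm
    exact ι_map_eqToHom _ _

section

variable (F : Mor D E) (P : D.toPseudofunctor.ObjectProperty) [P.IsClosedUnderMapObj]
  (Q : E.toPseudofunctor.ObjectProperty) [Q.IsClosedUnderMapObj]
  (h : ∀ X M, P.prop X M → Q.prop X ((F.app X).toFunctor.obj M))

/-- The restriction of a morphism of prederivators to sub-prederivators. -/
def Mor.restrict : Mor (D.sub P) (E.sub Q) where
  app X := Cat.Hom.ofFunctor ((Q.prop X).lift ((P.prop X).ι ⋙ (F.app X).toFunctor)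
    fun M => h X M.obj M.property)
  naturality {X Y} f := Cat.Hom.isoMk (((Q.prop Y).fullyFaithfulι.whiskeringRight _).preimageIso
    (Functor.isoWhiskerLeft (P.prop X).ι (Cat.Hom.toNatIso (F.naturality f))))
  naturality_naturality η := by
    ext M
    apply (Q.prop _).ι.map_injective
    exact congr(($(F.naturality_naturality η)).toNatTrans.app M.obj)
  naturality_id X := by
    ext M
    apply (Q.prop _).ι.map_injective
    exact congr(($(F.naturality_id X)).toNatTrans.app M.obj)
  naturality_comp f g := by
    ext M
    apply (Q.prop _).ι.map_injective
    exact congr(($(F.naturality_comp f g)).toNatTrans.app M.obj)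

end

section

variable {F H : Mor D E} (η : F ⟶ H) (P : D.toPseudofunctor.ObjectProperty)
  [P.IsClosedUnderMapObj] (Q : E.toPseudofunctor.ObjectProperty) [Q.IsClosedUnderMapObj]
  (h : ∀ X M, P.prop X M → Q.prop X ((F.app X).toFunctor.obj M))
  (h' : ∀ X M, P.prop X M → Q.prop X ((H.app X).toFunctor.obj M))

/-- The restriction of a natural transformation to sub-prederivators. -/
def Mor.restrictMap : F.restrict P Q h ⟶ H.restrict P Q h' where
  as :=
    { app := fun X => Cat.Hom₂.ofNatTrans (((Q.prop X).fullyFaithfulι.whiskeringRight _).preimage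
        (Functor.whiskerLeft (P.prop X).ι (η.as.app X).toNatTrans))
      naturality := fun {X Y} f => by
        ext M
        apply (Q.prop _).ι.map_injective
        exact congr(($(η.as.naturality f)).toNatTrans.app M.obj) }

end

/-! The naturality constraints of an inclusion of sub-prederivators are identities; componentwise,
its coherence conditions are the following identities. -/

section

variable {C C' C'' : Type*} [Category* C] [Category* C'] [Category* C'']

theorem whisker_ids {X : C} {X' : C''} (Φ : C ⥤ C') (Ψ : C'' ⥤ C')
    (x : Φ.obj X ⟶ Ψ.obj X') :
    𝟙 _ ≫ (𝟙 _ ≫ Φ.map (𝟙 X) ≫ 𝟙 _ ≫ x ≫ 𝟙 _) =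
      (𝟙 _ ≫ x ≫ 𝟙 _ ≫ 𝟙 _ ≫ 𝟙 _) ≫ Ψ.map (𝟙 X') := by simp

theorem whisker_ids' (Φ : C ⥤ C') (X : C) :
    𝟙 (Φ.obj X) ≫ 𝟙 _ = 𝟙 _ ≫ 𝟙 _ ≫ 𝟙 _ ≫ 𝟙 _ ≫ Φ.map (𝟙 X) ≫ 𝟙 _ := by simp

theorem unitor_ids (X : C) : 𝟙 X ≫ 𝟙 X = 𝟙 X ≫ 𝟙 X ≫ 𝟙 X := by simp

end

/-- The inclusion of a sub-prederivator. -/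
def Prederivator.subι (D : Prederivator.{w, v, u}) (P : D.toPseudofunctor.ObjectProperty)
    [P.IsClosedUnderMapObj] : Mor (D.sub P) D :=
  Pseudofunctor.ObjectProperty.ι P

section

variable (K : Type w) [Category.{w} K]
  (P : ∀ D : StDer.{w, v, u}, (D.pre.exp K).toPseudofunctor.ObjectProperty)
  [∀ D, (P D).IsClosedUnderMapObj]
  (h : ∀ {D E : StDer.{w, v, u}} (F : D ⟶ E) X M, (P D).prop X M →
    (P E).prop X (((Mor.exp K F.mor).app X).toFunctor.obj M))

/-- The `2`-functor that sends `D` to a sub-prederivator of `D^K` that is preserved by exact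
morphisms. -/
def subExpFunctor : StDer.{w, v, u} ⥤ᵖ PDer.{w, v, u} where
  obj D := ((D.pre.exp K).sub (P D)).toPDer
  map {D E} F := InducedBicategory.mkHom (Mor.restrict (Mor.exp K F.mor) (P D) (P E) (h F))
  map₂ {D E F H} η := InducedBicategory.Hom₂.mk
    (Mor.restrictMap (Mor.expMap K η.mod) (P D) (P E) (h F) (h H))
  map₂_id _ := rfl
  map₂_comp _ _ := rfl
  mapId D := Iso.refl (𝟙 ((D.pre.exp K).sub (P D)).toPDer)
  mapComp {D E G} F H := Iso.refl
    ((InducedBicategory.mkHom (Mor.restrict (Mor.exp K F.mor) (P D) (P E) (h F)) :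
        ((D.pre.exp K).sub (P D)).toPDer ⟶ ((E.pre.exp K).sub (P E)).toPDer) ≫
      (InducedBicategory.mkHom (Mor.restrict (Mor.exp K H.mor) (P E) (P G) (h H)) :
        _ ⟶ ((G.pre.exp K).sub (P G)).toPDer))
  map₂_whisker_left _ _ _ _ := by
    apply InducedBicategory.hom₂_ext
    apply Pseudofunctor.StrongTrans.homCategory.ext
    intro B
    exact (id_comp_id _).symm
  map₂_whisker_right _ _ := by
    apply InducedBicategory.hom₂_ext
    apply Pseudofunctor.StrongTrans.homCategory.ext
    intro B
    exact (id_comp_id _).symm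
  map₂_associator {D₁ D₂ D₃ D₄} F H L := by
    apply InducedBicategory.hom₂_ext
    apply Pseudofunctor.StrongTrans.homCategory.ext
    intro B
    exact associator_ids ((Mor.restrict (Mor.exp K F.mor) (P D₁) (P D₂) (h F)).app B)
      ((Mor.restrict (Mor.exp K H.mor) (P D₂) (P D₃) (h H)).app B)
      ((Mor.restrict (Mor.exp K L.mor) (P D₃) (P D₄) (h L)).app B)
  map₂_left_unitor {D₁ D₂} F := by
    apply InducedBicategory.hom₂_ext
    apply Pseudofunctor.StrongTrans.homCategory.ext
    intro B
    exact leftUnitor_ids ((Mor.restrict (Mor.exp K F.mor) (P D₁) (P D₂) (h F)).app B)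
  map₂_right_unitor {D₁ D₂} F := by
    apply InducedBicategory.hom₂_ext
    apply Pseudofunctor.StrongTrans.homCategory.ext
    intro B
    exact rightUnitor_ids ((Mor.restrict (Mor.exp K F.mor) (P D₁) (P D₂) (h F)).app B)

/-- The inclusion of `subExpFunctor K P` in `D ↦ D^K`. -/
def subExpFunctorι : subExpFunctor K P h ⟶ expFunctor K where
  app D := InducedBicategory.mkHom ((D.pre.exp K).subι (P D))
  naturality {D E} F := InducedBicategory.isoMk (Pseudofunctor.StrongTrans.isoMk
    (fun B => Iso.refl _) (by
      intro B B' f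
      ext M
      exact whisker_ids ((Mor.exp K F.mor).app B').toFunctor ((E.pre.exp K).map f).toFunctor
        (((Mor.exp K F.mor).naturality f).hom.toNatTrans.app M.obj)))
  naturality_naturality η := by
    apply InducedBicategory.hom₂_ext
    apply Pseudofunctor.StrongTrans.homCategory.ext
    intro B
    ext M
    exact (Category.comp_id _).trans (Category.id_comp _).symm
  naturality_id D := by
    apply InducedBicategory.hom₂_ext
    apply Pseudofunctor.StrongTrans.homCategory.ext
    intro B
    ext M
    exact unitor_ids M.obj
  naturality_comp {D₁ D₂ D₃} F H := by
    apply InducedBicategory.hom₂_ext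
    apply Pseudofunctor.StrongTrans.homCategory.ext
    intro B
    ext M
    exact whisker_ids' ((Mor.exp K H.mor).app B).toFunctor
      (((Mor.exp K F.mor).app B).toFunctor.obj M.obj)

end

/-! ### Restriction along a functor of shapes -/

section

/-- Conjugation by canonical isomorphisms, as a commutative square. -/
theorem comp_eqToHom_of_conj {C : Type*} [Category* C] {X Y X' Y' Z W : C} (h₁ : Z = X)
    (h₂ : Y = W) (h₃ : Z = X') (h₄ : Y' = W) (h₅ : Y = Y') (h₆ : X = X') (L : X ⟶ Y) (R : X' ⟶ Y')
    (e : eqToHom h₁ ≫ L ≫ eqToHom h₂ = eqToHom h₃ ≫ R ≫ eqToHom h₄) :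
    L ≫ eqToHom h₅ = eqToHom h₆ ≫ R := by
  subst h₁ h₄ h₆ h₅
  simpa using e

/-- The unit coherence of a strictly commutative square of strict functors. -/
theorem strict_naturality_id {C : Type*} [Bicategory C] [Strict C] {a b : C} {x : a ⟶ a}
    {y : b ⟶ b} {z : a ⟶ b} (h : x ≫ z = z ≫ y) (i : x ≅ 𝟙 a) (j : y ≅ 𝟙 b) {hx : x = 𝟙 a}
    (hi : i = eqToIso hx) {hy : y = 𝟙 b} (hj : j = eqToIso hy) :
    (eqToIso h).hom ≫ z ◁ j.hom = i.hom ▷ z ≫ (λ_ z).hom ≫ (ρ_ z).inv := by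
  subst hx hy hi hj
  simp [Strict.leftUnitor_eqToIso, Strict.rightUnitor_eqToIso]

/-- The composition coherence of strictly commutative squares of strict functors. -/
theorem strict_naturality_comp {C : Type*} [Bicategory C] [Strict C] {a b c a' b' c' : C}
    {x₁ : a ⟶ b} {x₂ : b ⟶ c} {x₁₂ : a ⟶ c} {y₁ : a' ⟶ b'} {y₂ : b' ⟶ c'} {y₁₂ : a' ⟶ c'}
    {z₁ : a ⟶ a'} {z₂ : b ⟶ b'} {z₃ : c ⟶ c'} (h : x₁₂ ≫ z₃ = z₁ ≫ y₁₂) (h₁ : x₁ ≫ z₂ = z₁ ≫ y₁)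
    (h₂ : x₂ ≫ z₃ = z₂ ≫ y₂) (i : x₁₂ ≅ x₁ ≫ x₂) (j : y₁₂ ≅ y₁ ≫ y₂) {hx : x₁₂ = x₁ ≫ x₂}
    (hi : i = eqToIso hx) {hy : y₁₂ = y₁ ≫ y₂} (hj : j = eqToIso hy) :
    (eqToIso h).hom ≫ z₁ ◁ j.hom = i.hom ▷ z₃ ≫ (α_ _ _ _).hom ≫ x₁ ◁ (eqToIso h₂).hom ≫
      (α_ _ _ _).inv ≫ (eqToIso h₁).hom ▷ y₂ ≫ (α_ _ _ _).hom := by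
  subst hx hy hi hj
  simp [Strict.associator_eqToIso]

theorem map_id_ids {C C' : Type*} [Category* C] [Category* C'] (Φ : C ⥤ C') (X : C) :
    (𝟙 (Φ.obj X) ≫ 𝟙 _) ≫ 𝟙 _ = Φ.map (𝟙 X) ≫ 𝟙 _ ≫ 𝟙 _ := by simp

theorem map_id_ids' {C C' : Type*} [Category* C] [Category* C'] (Φ : C ⥤ C') {X : C} {Y Z : C'}
    (f : Φ.obj X ⟶ Y) (g : Y ⟶ Z) :
    (((((𝟙 _ ≫ f) ≫ 𝟙 _) ≫ g) ≫ 𝟙 _) ≫ 𝟙 _) = Φ.map (𝟙 X) ≫ 𝟙 _ ≫ f ≫ 𝟙 _ ≫ g ≫ 𝟙 _ := by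
  simp

theorem iso_square {C : Type*} [Category* C] {X Y X' Y' : C} {f : X ⟶ X'} {g : Y ⟶ Y'} {i : X ≅ Y}
    {j : X' ≅ Y'} (e : f ≫ j.hom = i.hom ≫ g) : g ≫ j.symm.hom = i.symm.hom ≫ f := by
  rw [Iso.symm_hom, Iso.symm_hom, Iso.comp_inv_eq, Category.assoc, e, Iso.inv_hom_id_assoc]

/-- The naturality constraints of a strong transformation are compatible with the images of a
`2`-cell that fills a square. -/
theorem strongTrans_naturality_square {B C : Type*} [Bicategory B] [Bicategory C] {F G : B ⥤ᵖ C}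
    (φ : F ⟶ G) {a b a' b' : B} {x : a ⟶ b} {z' : b ⟶ b'} {z : a ⟶ a'} {y : a' ⟶ b'}
    (s : x ≫ z' ⟶ z ≫ y) {sF : F.map x ≫ F.map z' ⟶ F.map z ≫ F.map y}
    {sG : G.map x ≫ G.map z' ⟶ G.map z ≫ G.map y}
    (hF : (F.mapComp x z').hom ≫ sF = F.map₂ s ≫ (F.mapComp z y).hom)
    (hG : (G.mapComp x z').hom ≫ sG = G.map₂ s ≫ (G.mapComp z y).hom) :
    F.map x ◁ (φ.naturality z').inv ≫ (α_ _ _ _).inv ≫ sF ▷ φ.app b' ≫ (α_ _ _ _).hom ≫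
        F.map z ◁ (φ.naturality y).hom ≫ (α_ _ _ _).inv =
      ((α_ _ _ _).inv ≫ (φ.naturality x).hom ▷ G.map z' ≫ (α_ _ _ _).hom ≫ φ.app a ◁ sG ≫
        (α_ _ _ _).inv) ≫ (φ.naturality z).inv ▷ G.map y := by
  rw [← Iso.eq_inv_comp] at hF hG
  have e := φ.naturality_naturality s
  rw [φ.naturality_comp_hom, φ.naturality_comp_hom] at e
  rw [← cancel_epi ((F.mapComp x z').hom ▷ φ.app b' ≫ (α_ _ _ _).hom ≫
      F.map x ◁ (φ.naturality z').hom),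
    ← cancel_mono ((φ.naturality z).hom ▷ G.map y ≫ (α_ _ _ _).hom ≫
      φ.app a ◁ (G.mapComp z y).inv)]
  simp only [Category.assoc] at e ⊢
  subst hF hG
  simp only [Bicategory.whiskerLeft_comp, Bicategory.comp_whiskerRight, Category.assoc,
    Bicategory.whiskerLeft_hom_inv_assoc, Bicategory.hom_inv_whiskerRight_assoc,
    Bicategory.inv_hom_whiskerRight_assoc, Iso.hom_inv_id_assoc, Iso.inv_hom_id_assoc,
    Bicategory.whiskerLeft_hom_inv, Category.comp_id]
  rw [e]

variable {A K : Type w} [Category.{w} A] [Category.{w} K] (p : A ⥤ K)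

/-- The functor `p × id_B`. -/
abbrev prodLeft (B : Cat.{w, w}) : prodObj A B ⟶ prodObj K B := (p.prod (𝟭 B)).toCatHom

variable (D : Prederivator.{w, v, u})

/-- Restriction in `K` commutes strictly with restriction in the parameter. -/
theorem Prederivator.map_prodLeft_comm {B B' : Cat.{w, w}} (f : B ⟶ B') :
    D.map (prodMap K f).op ≫ D.map (prodLeft p B).op =
      D.map (prodLeft p B').op ≫ D.map (prodMap A f).op :=
  (D.map_comp (prodMap K f).op (prodLeft p B).op).symm.trans
    (D.map_comp (prodLeft p B').op (prodMap A f).op)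

/-- The morphism `D^K → D^A` given by restriction along `p : A → K`. -/
def resMor : Mor (D.exp K) (D.exp A) where
  app B := D.map (prodLeft p B.unop).op
  naturality {B B'} f := eqToIso (D.map_prodLeft_comm p f.unop)
  naturality_naturality {B B' f g} η := by
    have e₁ := D.map₂_whisker_right (Bicategory.Opposite.op2 (prodMap₂ K η.unop2))
      (prodLeft p B'.unop).op
    have e₂ := D.map₂_whisker_left (prodLeft p B.unop).op
      (Bicategory.Opposite.op2 (prodMap₂ A η.unop2))
    rw [D.mapComp_eq_eqToIso, D.mapComp_eq_eqToIso] at e₁ e₂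
    have e₃ : Bicategory.Opposite.op2 (prodMap₂ K η.unop2) ▷ (prodLeft p B'.unop).op =
        (prodLeft p B.unop).op ◁ Bicategory.Opposite.op2 (prodMap₂ A η.unop2) := by
      apply congrArg Bicategory.Opposite.op2
      ext X
      exact Prod.ext (p.map_id _).symm rfl
    have e := e₁.symm.trans ((congrArg (fun x => D.map₂ x) e₃).trans e₂)
    exact comp_eqToHom_of_conj (D.map_comp (prodMap K f.unop).op (prodLeft p B'.unop).op)
      (D.map_comp (prodMap K g.unop).op (prodLeft p B'.unop).op).symm
      (D.map_comp (prodLeft p B.unop).op (prodMap A f.unop).op)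
      (D.map_comp (prodLeft p B.unop).op (prodMap A g.unop).op).symm
      (D.map_prodLeft_comm p g.unop) (D.map_prodLeft_comm p f.unop) _ _ e
  naturality_id B :=
    strict_naturality_id (D.map_prodLeft_comm p (𝟙 B.unop)) _ _ ((D.exp K).mapId_eq_eqToIso B)
      ((D.exp A).mapId_eq_eqToIso B)
  naturality_comp {B B' B''} f g :=
    strict_naturality_comp (D.map_prodLeft_comm p (g.unop ≫ f.unop))
      (D.map_prodLeft_comm p f.unop) (D.map_prodLeft_comm p g.unop) _ _
      ((D.exp K).mapComp_eq_eqToIso f g) ((D.exp A).mapComp_eq_eqToIso f g)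

theorem mapComp_map_prodLeft_comm {B B' : Cat.{w, w}} (f : B ⟶ B') :
    (D.mapComp (prodMap K f).op (prodLeft p B).op).hom ≫ eqToHom (D.map_prodLeft_comm p f) =
      D.map₂ (𝟙 ((prodMap K f).op ≫ (prodLeft p B).op)) ≫
        (D.mapComp (prodLeft p B').op (prodMap A f).op).hom := by
  rw [D.mapComp_eq_eqToIso, D.mapComp_eq_eqToIso, D.map₂_id]
  exact (eqToHom_trans (D.map_comp (prodMap K f).op (prodLeft p B).op) _).trans
    (Category.id_comp _).symm

/-- Restriction along `p : A → K`, as a transformation from `D ↦ D^K` to `D ↦ D^A`. -/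
def resTrans : expFunctor.{w, v, u} K ⟶ expFunctor A where
  app D := InducedBicategory.mkHom (resMor p D.pre)
  naturality {D E} F := InducedBicategory.isoMk (Pseudofunctor.StrongTrans.isoMk
    (fun B => (F.mor.naturality (prodLeft p B.unop).op).symm) (by
      intro B B' f
      exact strongTrans_naturality_square F.mor (x := (prodMap K f.unop).op)
        (z' := (prodLeft p B'.unop).op) (z := (prodLeft p B.unop).op) (y := (prodMap A f.unop).op)
        (𝟙 _) (mapComp_map_prodLeft_comm p D.pre f.unop)
        (mapComp_map_prodLeft_comm p E.pre f.unop)))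
  naturality_naturality η := by
    apply InducedBicategory.hom₂_ext
    apply Pseudofunctor.StrongTrans.homCategory.ext
    intro B
    exact iso_square (η.mod.as.naturality (prodLeft p B.unop).op)
  naturality_id D := by
    apply InducedBicategory.hom₂_ext
    apply Pseudofunctor.StrongTrans.homCategory.ext
    intro B
    ext M
    exact map_id_ids (D.pre.map (prodLeft p B.unop).op).toFunctor M
  naturality_comp {D₁ D₂ D₃} F H := by
    apply InducedBicategory.hom₂_ext
    apply Pseudofunctor.StrongTrans.homCategory.ext
    intro B
    refine (congrArg (· ≫ 𝟙 _)
      (Pseudofunctor.StrongTrans.categoryStruct_comp_naturality_inv F.mor H.mor _)).trans ?_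
    ext M
    exact map_id_ids' (D₃.pre.map (prodLeft p B.unop).op).toFunctor
      ((H.mor.naturality (prodLeft p B.unop).op).inv.toNatTrans.app
        ((F.mor.app (op (prodObj K B.unop))).toFunctor.obj M))
      ((H.mor.app (op (prodObj A B.unop))).toFunctor.map
        ((F.mor.naturality (prodLeft p B.unop).op).inv.toNatTrans.app M))

end

/-! ### Strong stable equivalences from classes of diagrams -/

/-- Two shapes are strongly stably equivalent if they embed in a shape `K` and restriction to either
is an equivalence from a class of `K`-diagrams with parameters that is stable under restriction of
the parameters and under exact morphisms. -/
theorem stronglyStablyEquivalent_of_property {A A' K : Type w} [Category.{w} A] [Category.{w} A']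
    [Category.{w} K] (p : A ⥤ K) (p' : A' ⥤ K)
    (P : ∀ (D : StDer.{w, v, u}) (B : Cat.{w, w}), ObjectProperty (D.pre.Coh (K × B)))
    (hres : ∀ (D : StDer.{w, v, u}) {B B' : Cat.{w, w}} (f : B ⟶ B') (X : D.pre.Coh (K × B')),
      P D B' X → P D B ((D.pre.res ((𝟭 K).prod f.toFunctor)).obj X))
    (hmor : ∀ {D E : StDer.{w, v, u}} (F : D ⟶ E) (B : Cat.{w, w}) (X : D.pre.Coh (K × B)),
      P D B X → P E B ((F.mor.coh (K × B)).obj X))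
    (hp : ∀ (D : StDer.{w, v, u}) (B : Cat.{w, w}),
      ((P D B).ι ⋙ D.pre.res (p.prod (𝟭 B))).IsEquivalence)
    (hp' : ∀ (D : StDer.{w, v, u}) (B : Cat.{w, w}),
      ((P D B).ι ⋙ D.pre.res (p'.prod (𝟭 B))).IsEquivalence) :
    StronglyStablyEquivalent.{w, v, u} A A' := by
  let Q (D : StDer.{w, v, u}) : (D.pre.exp K).toPseudofunctor.ObjectProperty :=
    ⟨fun B => P D B.unop⟩
  have : ∀ D, (Q D).IsClosedUnderMapObj := fun D => ⟨fun {X Y M} hM f => hres D f.unop M hM⟩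
  exact stronglyStablyEquivalent_of_span
    (subExpFunctorι K Q (fun F X M hM => hmor F X.unop M hM) ≫ resTrans p)
    (subExpFunctorι K Q (fun F X M hM => hmor F X.unop M hM) ≫ resTrans p')
    (fun D => isEquiv₁_pder_of_app _ fun B => hp D B.unop)
    (fun D => isEquiv₁_pder_of_app _ fun B => hp' D B.unop)

namespace Prederivator

variable (D : Prederivator.{w, v, u})

section

variable {A B C E : Type w} [Category.{w} A] [Category.{w} B] [Category.{w} C] [Category.{w} E]

theorem resMap_id (p : A ⥤ B) : D.resMap (𝟙 p) = 𝟙 _ :=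
  congrArg Cat.Hom₂.toNatTrans (D.map₂_id p.toCatHom.op)

theorem resMap_comp {p p' p'' : A ⥤ B} (α : p ⟶ p') (β : p' ⟶ p'') :
    D.resMap (α ≫ β) = D.resMap α ≫ D.resMap β :=
  congrArg Cat.Hom₂.toNatTrans (D.map₂_comp (op2 α.toCatHom₂) (op2 β.toCatHom₂))

theorem resMap_comp_app {p p' p'' : A ⥤ B} (α : p ⟶ p') (β : p' ⟶ p'') (X : D.Coh B) :
    (D.resMap (α ≫ β)).app X = (D.resMap α).app X ≫ (D.resMap β).app X := by
  rw [resMap_comp, NatTrans.comp_app]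

/-- The isomorphism `p^* ≅ p'^*` induced by an isomorphism `p ≅ p'`. -/
def resMapIso {p p' : A ⥤ B} (e : p ≅ p') : D.res p ≅ D.res p' where
  hom := D.resMap e.hom
  inv := D.resMap e.inv
  hom_inv_id := by rw [← resMap_comp, e.hom_inv_id, resMap_id]
  inv_hom_id := by rw [← resMap_comp, e.inv_hom_id, resMap_id]

instance {p p' : A ⥤ B} (α : p ⟶ p') [IsIso α] : IsIso (D.resMap α) :=
  (D.resMapIso (asIso α)).isIso_hom

/-- The isomorphism `id^* ≅ id`. -/
def resId (A : Type w) [Category.{w} A] : D.res (𝟭 A) ≅ 𝟭 _ :=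
  Cat.Hom.toNatIso (D.mapId (op (Cat.of A)))

theorem resMap_whiskerRight {p p' : A ⥤ B} (α : p ⟶ p') (q : B ⥤ C) (X : D.Coh C) :
    (D.resMap (Functor.whiskerRight α q)).app X ≫ (D.resComp p' q).hom.app X =
      (D.resComp p q).hom.app X ≫ (D.resMap α).app ((D.res q).obj X) := by
  have e := D.map₂_whisker_left q.toCatHom.op (op2 α.toCatHom₂)
  rw [← Category.assoc, Iso.eq_comp_inv] at e
  exact congr(($e).toNatTrans.app X)

theorem resMap_whiskerLeft (p : A ⥤ B) {q q' : B ⥤ C} (β : q ⟶ q') (X : D.Coh C) :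
    (D.resMap (Functor.whiskerLeft p β)).app X ≫ (D.resComp p q').hom.app X =
      (D.resComp p q).hom.app X ≫ (D.res p).map ((D.resMap β).app X) := by
  have e := D.map₂_whisker_right (op2 β.toCatHom₂) p.toCatHom.op
  rw [← Category.assoc, Iso.eq_comp_inv] at e
  exact congr(($e).toNatTrans.app X)

/-- The isomorphisms `(q ∘ p)^* ≅ p^* q^*` are canonical, since prederivators are strict. Their
associativity `resComp_assoc` follows. -/
theorem resComp_hom_app (p : A ⥤ B) (q : B ⥤ C) (X : D.Coh C) :
    (D.resComp p q).hom.app X =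
      eqToHom (congrArg (fun f => f.toFunctor.obj X) (D.map_comp q.toCatHom.op p.toCatHom.op)) := by
  change (D.mapComp q.toCatHom.op p.toCatHom.op).hom.toNatTrans.app X = _
  rw [D.mapComp_eq_eqToIso]
  exact Cat.eqToHom_app _ _ (D.map_comp q.toCatHom.op p.toCatHom.op) _

theorem resComp_assoc (p : A ⥤ B) (q : B ⥤ C) (r : C ⥤ E) (X : D.Coh E) :
    (D.resComp p (q ⋙ r)).hom.app X ≫ (D.res p).map ((D.resComp q r).hom.app X) =
      (D.resComp (p ⋙ q) r).hom.app X ≫ (D.resComp p q).hom.app ((D.res r).obj X) := by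
  have e : (D.res p).map ((D.resComp q r).hom.app X) = eqToHom _ :=
    (congrArg _ (D.resComp_hom_app q r X)).trans
      (eqToHom_map (D.res p) (congrArg (fun f => f.toFunctor.obj X)
        (D.map_comp r.toCatHom.op q.toCatHom.op)))
  rw [e, resComp_hom_app, resComp_hom_app, resComp_hom_app]
  refine (eqToHom_trans (congrArg (fun f => f.toFunctor.obj X)
    (D.map_comp (q ⋙ r).toCatHom.op p.toCatHom.op)) _).trans (Eq.symm ?_)
  exact eqToHom_trans (congrArg (fun f => f.toFunctor.obj X)
    (D.map_comp r.toCatHom.op (p ⋙ q).toCatHom.op)) _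

theorem isEquivalence_res (f : A ⥤ B) [f.IsEquivalence] : (D.res f).IsEquivalence :=
  Functor.IsEquivalence.mk' (D.res f.inv)
    ((D.resId B).symm ≪≫ D.resMapIso f.asEquivalence.counitIso.symm ≪≫ D.resComp f.inv f)
    ((D.resComp f f.inv).symm ≪≫ D.resMapIso f.asEquivalence.unitIso.symm ≪≫ D.resId A)

end

end Prederivator

theorem stronglyStablyEquivalent_of_isEquivalence {A A' : Type w} [Category.{w} A]
    [Category.{w} A'] (f : A ⥤ A') [f.IsEquivalence] :
    StronglyStablyEquivalent.{w, v, u} A' A :=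
  ⟨resTrans f, fun D => isEquiv₁_pder_of_app _ fun B =>
    have : (f.prod (𝟭 B.unop)).IsEquivalence :=
      (f.asEquivalence.prod CategoryTheory.Equivalence.refl).isEquivalence_functor
    D.pre.isEquivalence_res (f.prod (𝟭 B.unop))⟩

/-! ### Coherent colimit cocones and limit cones -/

theorem cone_whiskerLeft_aux {C : Type*} [Category* C] {a a' b b' c d : C} {m : a ⟶ d} {R : d ⟶ b}
    {c₁ : a ⟶ c} {t : c ⟶ b} {k' : c ≅ b'} {k : a ≅ a'} {h : a' ⟶ b'} {t' : b' ⟶ b}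
    (e₁ : m ≫ R = c₁ ≫ t) (e₂ : c₁ ≫ k'.hom = k.hom ≫ h) (e₃ : t' = k'.inv ≫ t) :
    (k.inv ≫ m) ≫ R = h ≫ t' := by
  rw [← Iso.eq_comp_inv] at e₂
  rw [Category.assoc, Iso.inv_comp_eq, e₁, e₂, e₃]
  simp

theorem cocone_whiskerLeft_aux {C : Type*} [Category* C] {a a' b b' c d : C} {m : d ⟶ a} {R : d ⟶ b}
    {c₁ : a ⟶ c} {t : b ⟶ c} {k' : c ≅ b'} {k : a ≅ a'} {h : a' ≅ b'} {t' : b ⟶ b'}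
    (e₁ : m ≫ c₁ = R ≫ t) (e₂ : c₁ ≫ k'.hom = k.hom ≫ h.hom) (e₃ : t' = t ≫ k'.hom) :
    m ≫ k.hom = R ≫ t' ≫ h.inv := by
  rw [e₃, Category.assoc, ← reassoc_of% e₁, reassoc_of% e₂]
  simp

namespace Prederivator

section

variable {D : Prederivator.{w, v, u}} {J J' : Type w} [Category.{w} J] [Category.{w} J']

/-- A coherent cocone `Y ⟶ π^* Z` is a colimit cocone. -/
def IsColim {Y : D.Coh J} {Z : D.Coh Pt.{w}} (c : Y ⟶ (D.res (toPt J)).obj Z) : Prop :=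
  ∀ W : D.Coh Pt.{w}, Function.Bijective fun f : Z ⟶ W => c ≫ (D.res (toPt J)).map f

/-- A coherent cone `π^* Z ⟶ Y` is a limit cone. -/
def IsLim {Y : D.Coh J} {Z : D.Coh Pt.{w}} (c : (D.res (toPt J)).obj Z ⟶ Y) : Prop :=
  ∀ W : D.Coh Pt.{w}, Function.Bijective fun f : W ⟶ Z => (D.res (toPt J)).map f ≫ c

theorem isColim_of_iso {Y Y' : D.Coh J} {Z Z' : D.Coh Pt.{w}} {c : Y ⟶ (D.res (toPt J)).obj Z}
    {c' : Y' ⟶ (D.res (toPt J)).obj Z'} (y : Y' ≅ Y) (z : Z' ≅ Z)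
    (h : c' ≫ (D.res (toPt J)).map z.hom = y.hom ≫ c) (hc : IsColim c) : IsColim c' := fun W => by
  have e : (fun f : Z' ⟶ W => c' ≫ (D.res (toPt J)).map f) =
      (fun f => y.hom ≫ f) ∘ (fun f => c ≫ (D.res (toPt J)).map f) ∘ (fun f => z.inv ≫ f) := by
    funext f
    simp only [Function.comp_apply]
    rw [← reassoc_of% h, ← Functor.map_comp, Iso.hom_inv_id_assoc]
  rw [e]
  exact (y.homFromEquiv (Z := _)).symm.bijective.comp ((hc W).comp z.homFromEquiv.bijective)

theorem isColim_iff_of_iso {Y Y' : D.Coh J} {Z Z' : D.Coh Pt.{w}} {c : Y ⟶ (D.res (toPt J)).obj Z}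
    {c' : Y' ⟶ (D.res (toPt J)).obj Z'} (y : Y' ≅ Y) (z : Z' ≅ Z)
    (h : c' ≫ (D.res (toPt J)).map z.hom = y.hom ≫ c) : IsColim c ↔ IsColim c' :=
  ⟨isColim_of_iso y z h, isColim_of_iso y.symm z.symm (by
    rw [Iso.symm_hom, Iso.symm_hom, Iso.eq_inv_comp, ← reassoc_of% h, ← Functor.map_comp]
    simp)⟩

theorem isLim_of_iso {Y Y' : D.Coh J} {Z Z' : D.Coh Pt.{w}} {c : (D.res (toPt J)).obj Z ⟶ Y}
    {c' : (D.res (toPt J)).obj Z' ⟶ Y'} (y : Y' ≅ Y) (z : Z' ≅ Z)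
    (h : c' ≫ y.hom = (D.res (toPt J)).map z.hom ≫ c) (hc : IsLim c) : IsLim c' := fun W => by
  have e : (fun f : W ⟶ Z' => (D.res (toPt J)).map f ≫ c') =
      (fun f => f ≫ y.inv) ∘ (fun f => (D.res (toPt J)).map f ≫ c) ∘ (fun f => f ≫ z.hom) := by
    funext f
    simp only [Function.comp_apply]
    rw [Functor.map_comp, Category.assoc, Category.assoc, ← reassoc_of% h, Iso.hom_inv_id,
      Category.comp_id]
  rw [e]
  exact y.homToEquiv.symm.bijective.comp ((hc W).comp z.homToEquiv.bijective)

theorem isLim_iff_of_iso {Y Y' : D.Coh J} {Z Z' : D.Coh Pt.{w}} {c : (D.res (toPt J)).obj Z ⟶ Y}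
    {c' : (D.res (toPt J)).obj Z' ⟶ Y'} (y : Y' ≅ Y) (z : Z' ≅ Z)
    (h : c' ≫ y.hom = (D.res (toPt J)).map z.hom ≫ c) : IsLim c ↔ IsLim c' :=
  ⟨isLim_of_iso y z h, isLim_of_iso y.symm z.symm (by
    rw [Iso.symm_hom, Iso.symm_hom, Iso.comp_inv_eq, Category.assoc, h, ← Functor.map_comp_assoc]
    simp)⟩

section Finality

/-- The opposite of an adjunction of functors, as an adjunction in `Catᵒᵖ`. -/
def opAdjunction {l : J ⥤ J'} {r : J' ⥤ J} (adj : l ⊣ r) :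
    Bicategory.Adjunction r.toCatHom.op l.toCatHom.op where
  unit := op2 adj.toCat.unit
  counit := op2 adj.toCat.counit
  left_triangle := by
    apply congrArg op2 (a₁ := _ ≫ _ ≫ _) (a₂ := _ ≫ _)
    ext X
    simp
    change adj.unit.app (r.obj X) ≫ 𝟙 _ ≫ r.map (adj.counit.app X) = 𝟙 _ ≫ 𝟙 _
    rw [Category.id_comp, Category.id_comp]
    exact adj.right_triangle_components X
  right_triangle := by
    apply congrArg op2 (a₁ := _ ≫ _ ≫ _) (a₂ := _ ≫ _)
    ext X
    simp
    change l.map (adj.unit.app X) ≫ 𝟙 _ ≫ adj.counit.app (l.obj X) = 𝟙 _ ≫ 𝟙 _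
    rw [Category.id_comp, Category.id_comp]
    exact adj.left_triangle_components X

variable (D) in
/-- If `l ⊣ r`, then `r^* ⊣ l^*`. -/
def resAdjunction {l : J ⥤ J'} {r : J' ⥤ J} (adj : l ⊣ r) : D.res r ⊣ D.res l :=
  CategoryTheory.Adjunction.ofCat (D.mapAdjunction (opAdjunction adj))

variable {l : J ⥤ J'} {r : J' ⥤ J} (adj : l ⊣ r)

/-- A natural transformation acts invertibly on constant diagrams. -/
theorem isIso_resMap_app_toPt {p p' : J ⥤ J'} (α : p ⟶ p') (W : D.Coh Pt.{w}) :
    IsIso ((D.resMap α).app ((D.res (toPt J')).obj W)) := by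
  have : IsIso (Functor.whiskerRight α (toPt J')) := by
    rw [NatTrans.isIso_iff_isIso_app]
    intro X
    infer_instance
  have e := D.resMap_whiskerRight α (toPt J') W
  rw [← Iso.app_hom (D.resComp p (toPt J')), ← Iso.inv_comp_eq] at e
  rw [← e]
  infer_instance

theorem isIso_resAdjunction_unit (W : D.Coh Pt.{w}) :
    IsIso ((D.resAdjunction adj).unit.app ((D.res (toPt J)).obj W)) := by
  have h := D.isIso_resMap_app_toPt adj.unit W
  change IsIso ((D.resId J).inv.app _ ≫ (D.resMap adj.unit).app _ ≫ (D.resComp l r).hom.app _)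
  infer_instance

theorem isIso_resAdjunction_counit (W : D.Coh Pt.{w}) :
    IsIso ((D.resAdjunction adj).counit.app ((D.res (toPt J')).obj W)) := by
  have h := D.isIso_resMap_app_toPt adj.counit W
  change IsIso ((D.resComp r l).inv.app _ ≫ (D.resMap adj.counit).app _ ≫ (D.resId J').hom.app _)
  infer_instance

/-- The restriction of a coherent cocone along a functor. -/
def precomp (r : J' ⥤ J) {Y : D.Coh J} {Z : D.Coh Pt.{w}} (c : Y ⟶ (D.res (toPt J)).obj Z) :
    (D.res r).obj Y ⟶ (D.res (toPt J')).obj Z :=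
  (D.res r).map c ≫ (D.resComp r (toPt J)).inv.app Z

/-- The restriction of a coherent cone along a functor. -/
def precomp' (r : J' ⥤ J) {Y : D.Coh J} {Z : D.Coh Pt.{w}} (c : (D.res (toPt J)).obj Z ⟶ Y) :
    (D.res (toPt J')).obj Z ⟶ (D.res r).obj Y :=
  (D.resComp r (toPt J)).hom.app Z ≫ (D.res r).map c

include adj in
/-- Right adjoints are final. -/
theorem isColim_precomp_iff {Y : D.Coh J} {Z : D.Coh Pt.{w}}
    (c : Y ⟶ (D.res (toPt J)).obj Z) : IsColim (precomp r c) ↔ IsColim c := by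
  refine forall_congr' fun W => ?_
  have hb : Function.Bijective fun f : Y ⟶ (D.res (toPt J)).obj W =>
      (D.res r).map f ≫ (D.resComp r (toPt J)).inv.app W := by
    have := isIso_resAdjunction_unit adj W
    have e : (fun f : Y ⟶ (D.res (toPt J)).obj W =>
        (D.res r).map f ≫ (D.resComp r (toPt J)).inv.app W) =
        (fun g => g ≫ (D.resComp r (toPt J)).inv.app W) ∘
          ((D.resAdjunction adj).homEquiv _ _).symm ∘
            (fun g => g ≫ (D.resAdjunction adj).unit.app ((D.res (toPt J)).obj W)) := by
      funext f
      simp only [Function.comp_apply]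
      refine congrArg (· ≫ _) ?_
      rw [Equiv.eq_symm_apply, CategoryTheory.Adjunction.homEquiv_unit]
      exact ((D.resAdjunction adj).unit_naturality f)
    rw [e]
    exact (((D.resComp r (toPt J)).symm.app W).homToEquiv.bijective).comp
      ((Equiv.bijective _).comp (asIso ((D.resAdjunction adj).unit.app _)).homToEquiv.bijective)
  rw [← hb.of_comp_iff']
  have e : (fun f : Z ⟶ W => precomp r c ≫ (D.res (toPt J')).map f) =
      (fun f => (D.res r).map f ≫ (D.resComp r (toPt J)).inv.app W) ∘
        (fun f => c ≫ (D.res (toPt J)).map f) := by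
    funext f
    simp only [Function.comp_apply, precomp, Functor.map_comp, Category.assoc]
    exact (Category.assoc _ _ _).trans
      (congrArg ((D.res r).map c ≫ ·) ((D.resComp r (toPt J)).inv.naturality f).symm)
  exact e ▸ Iff.rfl

include adj in
/-- Left adjoints are initial. -/
theorem isLim_precomp'_iff {Y : D.Coh J'} {Z : D.Coh Pt.{w}}
    (c : (D.res (toPt J')).obj Z ⟶ Y) : IsLim (precomp' l c) ↔ IsLim c := by
  refine forall_congr' fun W => ?_
  have hb : Function.Bijective fun f : (D.res (toPt J')).obj W ⟶ Y =>
      (D.resComp l (toPt J')).hom.app W ≫ (D.res l).map f := by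
    have := isIso_resAdjunction_counit adj W
    have e : (fun f : (D.res (toPt J')).obj W ⟶ Y =>
        (D.resComp l (toPt J')).hom.app W ≫ (D.res l).map f) =
        (fun g => (D.resComp l (toPt J')).hom.app W ≫ g) ∘
          ((D.resAdjunction adj).homEquiv _ _) ∘
            (fun g => (D.resAdjunction adj).counit.app ((D.res (toPt J')).obj W) ≫ g) := by
      funext f
      simp only [Function.comp_apply]
      refine congrArg (_ ≫ ·) ?_
      rw [← Equiv.symm_apply_eq, CategoryTheory.Adjunction.homEquiv_counit]
      exact ((D.resAdjunction adj).counit_naturality f)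
    rw [e]
    exact (((D.resComp l (toPt J')).symm.app W).homFromEquiv.bijective).comp
      ((Equiv.bijective _).comp
        (asIso ((D.resAdjunction adj).counit.app _)).symm.homFromEquiv.bijective)
  rw [← hb.of_comp_iff']
  have e : (fun f : W ⟶ Z => (D.res (toPt J)).map f ≫ precomp' l c) =
      (fun f => (D.resComp l (toPt J')).hom.app W ≫ (D.res l).map f) ∘
        (fun f => (D.res (toPt J')).map f ≫ c) := by
    funext f
    simp only [Function.comp_apply, precomp', Functor.map_comp, ← Category.assoc]
    exact (Category.assoc _ _ _).symm.trans
      (congrArg (· ≫ (D.res l).map c) ((D.resComp l (toPt J')).hom.naturality f))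
  exact e ▸ Iff.rfl

end Finality

end

section

variable (D : Prederivator.{w, v, u}) {J J' K K' : Type w} [Category.{w} J] [Category.{w} J']
  [Category.{w} K] [Category.{w} K']

/-- The coherent cocone on `q^* X` with vertex `κ^* X` induced by a cocone `θ` on `q`. -/
def coconeMap {q : J ⥤ K} {κ : Pt.{w} ⥤ K} (θ : q ⟶ toPt J ⋙ κ) (X : D.Coh K) :
    (D.res q).obj X ⟶ (D.res (toPt J)).obj ((D.res κ).obj X) :=
  (D.resMap θ).app X ≫ (D.resComp (toPt J) κ).hom.app X

/-- The coherent cone on `q^* X` with vertex `κ^* X` induced by a cone `θ` on `q`. -/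
def coneMap {q : J ⥤ K} {κ : Pt.{w} ⥤ K} (θ : toPt J ⋙ κ ⟶ q) (X : D.Coh K) :
    (D.res (toPt J)).obj ((D.res κ).obj X) ⟶ (D.res q).obj X :=
  (D.resComp (toPt J) κ).inv.app X ≫ (D.resMap θ).app X

variable {D}

theorem coconeMap_naturality {q : J ⥤ K} {κ : Pt.{w} ⥤ K} (θ : q ⟶ toPt J ⋙ κ) {X X' : D.Coh K}
    (f : X ⟶ X') : D.coconeMap θ X ≫ (D.res (toPt J)).map ((D.res κ).map f) =
      (D.res q).map f ≫ D.coconeMap θ X' :=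
  ((D.resMap θ ≫ (D.resComp (toPt J) κ).hom).naturality f).symm

theorem coneMap_naturality {q : J ⥤ K} {κ : Pt.{w} ⥤ K} (θ : toPt J ⋙ κ ⟶ q) {X X' : D.Coh K}
    (f : X ⟶ X') : D.coneMap θ X ≫ (D.res q).map f =
      (D.res (toPt J)).map ((D.res κ).map f) ≫ D.coneMap θ X' :=
  (((D.resComp (toPt J) κ).inv ≫ D.resMap θ).naturality f).symm

/-- Restriction of the diagram along `g` and pushing the cocone forward along `g` agree. -/
theorem coconeMap_whiskerRight {q : J ⥤ K} {κ : Pt.{w} ⥤ K} (θ : q ⟶ toPt J ⋙ κ) (g : K ⥤ K')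
    (X : D.Coh K') :
    D.coconeMap (q := q ⋙ g) (κ := κ ⋙ g) (Functor.whiskerRight θ g) X ≫
        (D.res (toPt J)).map ((D.resComp κ g).hom.app X) =
      (D.resComp q g).hom.app X ≫ D.coconeMap θ ((D.res g).obj X) := by
  have e₁ := D.resMap_whiskerRight θ g X
  have e₂ := D.resComp_assoc (toPt J) κ g X
  simp only [coconeMap]
  rw [← Category.assoc (D.resComp q g |>.hom.app X)]
  erw [← e₁]
  rw [Category.assoc, Category.assoc]
  exact congrArg _ e₂

/-- Restriction of the diagram along `g` and pushing the cone forward along `g` agree. -/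
theorem coneMap_whiskerRight {q : J ⥤ K} {κ : Pt.{w} ⥤ K} (θ : toPt J ⋙ κ ⟶ q) (g : K ⥤ K')
    (X : D.Coh K') :
    D.coneMap (q := q ⋙ g) (κ := κ ⋙ g) (Functor.whiskerRight θ g) X ≫
        (D.resComp q g).hom.app X =
      (D.res (toPt J)).map ((D.resComp κ g).hom.app X) ≫ D.coneMap θ ((D.res g).obj X) := by
  have e₁ := D.resMap_whiskerRight θ g X
  have e₂ := D.resComp_assoc (toPt J) κ g X
  simp only [coneMap, Category.assoc]
  erw [e₁]
  rw [← cancel_epi ((D.resComp (toPt J) (κ ⋙ g)).hom.app X)]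
  rw [reassoc_of% e₂]
  simp

/-- Restricting the cocone along `r` amounts to restricting the coherent cocone along `r`. -/
theorem coconeMap_whiskerLeft {q : J ⥤ K} {κ : Pt.{w} ⥤ K} (θ : q ⟶ toPt J ⋙ κ) (r : J' ⥤ J)
    (X : D.Coh K) :
    D.coconeMap (q := r ⋙ q) (κ := κ) (Functor.whiskerLeft r θ) X =
      (D.resComp r q).hom.app X ≫ precomp r (D.coconeMap θ X) := by
  have e₁ := D.resMap_whiskerLeft r θ X
  have e₂ := D.resComp_assoc r (toPt J) κ X
  exact cocone_whiskerLeft_aux (k' := (D.res r).mapIso ((D.resComp (toPt J) κ).app X))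
    (k := (D.resComp (r ⋙ toPt J) κ).app X) (h := (D.resComp r (toPt J)).app _) e₁ e₂
    ((D.res r).map_comp _ _)

/-- Restricting the cone along `r` amounts to restricting the coherent cone along `r`. -/
theorem coneMap_whiskerLeft {q : J ⥤ K} {κ : Pt.{w} ⥤ K} (θ : toPt J ⋙ κ ⟶ q) (r : J' ⥤ J)
    (X : D.Coh K) :
    D.coneMap (q := r ⋙ q) (κ := κ) (Functor.whiskerLeft r θ) X ≫ (D.resComp r q).hom.app X =
      precomp' r (D.coneMap θ X) := by
  have e₁ := D.resMap_whiskerLeft r θ X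
  have e₂ := D.resComp_assoc r (toPt J) κ X
  exact cone_whiskerLeft_aux (k' := (D.res r).mapIso ((D.resComp (toPt J) κ).app X))
    (k := (D.resComp (r ⋙ toPt J) κ).app X) e₁ e₂ ((D.res r).map_comp _ _)

theorem coconeMap_congr {q q' : J ⥤ K} {κ κ' : Pt.{w} ⥤ K} (θ : q ⟶ toPt J ⋙ κ)
    (θ' : q' ⟶ toPt J ⋙ κ') (a : q ⟶ q') (b : κ ⟶ κ')
    (h : θ ≫ Functor.whiskerLeft (toPt J) b = a ≫ θ') (X : D.Coh K) :
    D.coconeMap θ X ≫ (D.res (toPt J)).map ((D.resMap b).app X) =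
      (D.resMap a).app X ≫ D.coconeMap θ' X := by
  have e := D.resMap_whiskerLeft (toPt J) b X
  simp only [coconeMap, Category.assoc]
  rw [← e, ← reassoc_of% (D.resMap_comp_app θ), h, reassoc_of% (D.resMap_comp_app a)]

theorem coneMap_congr {q q' : J ⥤ K} {κ κ' : Pt.{w} ⥤ K} (θ : toPt J ⋙ κ ⟶ q)
    (θ' : toPt J ⋙ κ' ⟶ q') (a : q ⟶ q') (b : κ ⟶ κ')
    (h : θ ≫ a = Functor.whiskerLeft (toPt J) b ≫ θ') (X : D.Coh K) :
    D.coneMap θ X ≫ (D.resMap a).app X =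
      (D.res (toPt J)).map ((D.resMap b).app X) ≫ D.coneMap θ' X := by
  have e := D.resMap_whiskerLeft (toPt J) b X
  simp only [coneMap, Category.assoc]
  rw [← resMap_comp_app, h, resMap_comp_app]
  rw [← cancel_epi ((D.resComp (toPt J) κ).hom.app X)]
  rw [← reassoc_of% e]
  simp

end

end Prederivator

/-! ### Colimits and limits in a coherent diagram -/

namespace Prederivator

section

variable (D : Prederivator.{w, v, u}) {J J' K K' : Type w} [Category.{w} J] [Category.{w} J']
  [Category.{w} K] [Category.{w} K'] {q : J ⥤ K} {κ : Pt.{w} ⥤ K}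

/-- The coherent diagram `X` sends the cocone `θ` to a colimit cocone. -/
def IsColimAt (θ : q ⟶ toPt J ⋙ κ) (X : D.Coh K) : Prop :=
  IsColim (D.coconeMap θ X)

/-- The coherent diagram `X` sends the cone `θ` to a limit cone. -/
def IsLimAt (θ : toPt J ⋙ κ ⟶ q) (X : D.Coh K) : Prop :=
  IsLim (D.coneMap θ X)

variable {D}

theorem isColimAt_iff_of_iso (θ : q ⟶ toPt J ⋙ κ) {X X' : D.Coh K} (e : X ≅ X') :
    D.IsColimAt θ X ↔ D.IsColimAt θ X' :=
  (isColim_iff_of_iso ((D.res q).mapIso e) ((D.res κ).mapIso e) (coconeMap_naturality θ e.hom)).symm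

theorem isLimAt_iff_of_iso (θ : toPt J ⋙ κ ⟶ q) {X X' : D.Coh K} (e : X ≅ X') :
    D.IsLimAt θ X ↔ D.IsLimAt θ X' :=
  (isLim_iff_of_iso ((D.res q).mapIso e) ((D.res κ).mapIso e) (coneMap_naturality θ e.hom)).symm

theorem isColimAt_res (θ : q ⟶ toPt J ⋙ κ) (g : K ⥤ K') (X : D.Coh K') :
    D.IsColimAt θ ((D.res g).obj X) ↔
      D.IsColimAt (q := q ⋙ g) (κ := κ ⋙ g) (Functor.whiskerRight θ g) X :=
  isColim_iff_of_iso ((D.resComp q g).app X) ((D.resComp κ g).app X) (coconeMap_whiskerRight θ g X)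

theorem isLimAt_res (θ : toPt J ⋙ κ ⟶ q) (g : K ⥤ K') (X : D.Coh K') :
    D.IsLimAt θ ((D.res g).obj X) ↔
      D.IsLimAt (q := q ⋙ g) (κ := κ ⋙ g) (Functor.whiskerRight θ g) X :=
  isLim_iff_of_iso ((D.resComp q g).app X) ((D.resComp κ g).app X) (coneMap_whiskerRight θ g X)

theorem isColimAt_congr {q' : J ⥤ K} {κ' : Pt.{w} ⥤ K} {θ : q ⟶ toPt J ⋙ κ}
    {θ' : q' ⟶ toPt J ⋙ κ'} (a : q ≅ q') (b : κ ≅ κ')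
    (h : θ ≫ Functor.whiskerLeft (toPt J) b.hom = a.hom ≫ θ') (X : D.Coh K) :
    D.IsColimAt θ X ↔ D.IsColimAt θ' X :=
  (isColim_iff_of_iso ((D.resMapIso a).app X) ((D.resMapIso b).app X)
    (coconeMap_congr θ θ' a.hom b.hom h X)).symm

theorem isLimAt_congr {q' : J ⥤ K} {κ' : Pt.{w} ⥤ K} {θ : toPt J ⋙ κ ⟶ q}
    {θ' : toPt J ⋙ κ' ⟶ q'} (a : q ≅ q') (b : κ ≅ κ')
    (h : θ ≫ a.hom = Functor.whiskerLeft (toPt J) b.hom ≫ θ') (X : D.Coh K) :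
    D.IsLimAt θ X ↔ D.IsLimAt θ' X :=
  (isLim_iff_of_iso ((D.resMapIso a).app X) ((D.resMapIso b).app X)
    (coneMap_congr θ θ' a.hom b.hom h X)).symm

/-- Colimits may be computed after restriction along a right adjoint. -/
theorem isColimAt_whiskerLeft {l : J ⥤ J'} {r : J' ⥤ J} (adj : l ⊣ r) (θ : q ⟶ toPt J ⋙ κ)
    (X : D.Coh K) :
    D.IsColimAt (q := r ⋙ q) (κ := κ) (Functor.whiskerLeft r θ) X ↔ D.IsColimAt θ X := by
  refine Iff.trans ?_ (isColim_precomp_iff adj (D.coconeMap θ X))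
  refine (isColim_iff_of_iso ((D.resComp r q).app X) (Iso.refl _) ?_).symm
  rw [Iso.refl_hom, CategoryTheory.Functor.map_id]
  exact (Category.comp_id _).trans (coconeMap_whiskerLeft θ r X)

/-- Limits may be computed after restriction along a left adjoint. -/
theorem isLimAt_whiskerLeft {l : J' ⥤ J} {r : J ⥤ J'} (adj : l ⊣ r) (θ : toPt J ⋙ κ ⟶ q)
    (X : D.Coh K) :
    D.IsLimAt (q := l ⋙ q) (κ := κ) (Functor.whiskerLeft l θ) X ↔ D.IsLimAt θ X := by
  refine Iff.trans ?_ (isLim_precomp'_iff adj (D.coneMap θ X))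
  refine (isLim_iff_of_iso ((D.resComp l q).app X) (Iso.refl _) ?_).symm
  rw [Iso.refl_hom, CategoryTheory.Functor.map_id]
  exact (coneMap_whiskerLeft θ l X).trans (Category.id_comp _).symm

end

section Mates

variable {C₁ C₂ D₁ D₂ : Type*} [Category* C₁] [Category* C₂] [Category* D₁] [Category* D₂]
  {L₁ : C₁ ⥤ D₁} {R₁ : D₁ ⥤ C₁} {L₂ : C₂ ⥤ D₂} {R₂ : D₂ ⥤ C₂} {F : C₁ ⥤ C₂} {H : D₁ ⥤ D₂}

/-- The mate of a square describes the passage to transposes. -/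
theorem homEquiv_symm_square (a₁ : L₁ ⊣ R₁) (a₂ : L₂ ⊣ R₂) (s : TwoSquare R₁ H F R₂)
    {Y : C₁} {Z : D₁} (c : Y ⟶ R₁.obj Z) :
    (a₂.homEquiv _ _).symm (F.map c ≫ s.natTrans.app Z) =
      ((CategoryTheory.mateEquiv a₁ a₂).symm s).natTrans.app Y ≫
        H.map ((a₁.homEquiv _ _).symm c) := by
  have e := s.natTrans.naturality ((a₁.homEquiv _ _).symm c)
  simp only [Functor.comp_map] at e
  rw [Equiv.symm_apply_eq, CategoryTheory.Adjunction.homEquiv_naturality_right]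
  have : a₂.homEquiv _ _ (((CategoryTheory.mateEquiv a₁ a₂).symm s).natTrans.app Y) =
      F.map (a₁.unit.app Y) ≫ s.natTrans.app (L₁.obj Y) := by
    rw [← Equiv.eq_symm_apply, CategoryTheory.Adjunction.homEquiv_counit]
    simp [CategoryTheory.mateEquiv]
  rw [this, Category.assoc, ← e, ← Functor.map_comp_assoc]
  exact congrArg (fun g => F.map g ≫ _)
    (((a₁.homEquiv Y Z).apply_symm_apply c).symm.trans (a₁.homEquiv_unit _ _ _))

/-- The mate of a square describes the passage to transposes, on the right adjoint side. -/
theorem homEquiv_square (a₁ : L₁ ⊣ R₁) (a₂ : L₂ ⊣ R₂) (t : TwoSquare F L₁ L₂ H)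
    {Y : C₁} {Z : D₁} (c : L₁.obj Y ⟶ Z) :
    a₂.homEquiv _ _ (t.natTrans.app Y ≫ H.map c) =
      F.map (a₁.homEquiv _ _ c) ≫ (CategoryTheory.mateEquiv a₁ a₂ t).natTrans.app Z := by
  have e := t.natTrans.naturality (a₁.homEquiv _ _ c)
  simp only [Functor.comp_map] at e
  rw [← Equiv.eq_symm_apply, CategoryTheory.Adjunction.homEquiv_naturality_left_symm]
  have : (a₂.homEquiv _ _).symm ((CategoryTheory.mateEquiv a₁ a₂ t).natTrans.app Z) =
      t.natTrans.app (R₁.obj Z) ≫ H.map (a₁.counit.app Z) := by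
    rw [Equiv.symm_apply_eq, CategoryTheory.Adjunction.homEquiv_unit]
    simp [CategoryTheory.mateEquiv]
  refine Eq.trans ?_ (congrArg (L₂.map _ ≫ ·) this.symm)
  rw [reassoc_of% e, ← Functor.map_comp]
  exact congrArg (fun g => _ ≫ H.map g)
    (((a₁.homEquiv Y Z).symm_apply_apply c).symm.trans (a₁.homEquiv_counit _ _ _))

end Mates

section

variable {D : Prederivator.{w, v, u}} {J : Type w} [Category.{w} J]

/-- A cocone is a colimit cocone if and only if its transpose from the colimit is invertible. -/
theorem isColim_iff_isIso {colim : D.Coh J ⥤ D.Coh Pt.{w}} (adj : colim ⊣ D.res (toPt J))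
    {Y : D.Coh J} {Z : D.Coh Pt.{w}} (c : Y ⟶ (D.res (toPt J)).obj Z) :
    IsColim c ↔ IsIso ((adj.homEquiv _ _).symm c) := by
  rw [isIso_iff_coyoneda_map_bijective]
  refine forall_congr' fun W => ?_
  rw [← (adj.homEquiv Y W).bijective.of_comp_iff']
  have e : (fun f : Z ⟶ W => c ≫ (D.res (toPt J)).map f) =
      (adj.homEquiv Y W) ∘ fun f => (adj.homEquiv _ _).symm c ≫ f := by
    funext f
    simp [CategoryTheory.Adjunction.homEquiv_naturality_right]
  rw [e]

/-- A cone is a limit cone if and only if its transpose to the limit is invertible. -/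
theorem isLim_iff_isIso {lim : D.Coh J ⥤ D.Coh Pt.{w}} (adj : D.res (toPt J) ⊣ lim)
    {Y : D.Coh J} {Z : D.Coh Pt.{w}} (c : (D.res (toPt J)).obj Z ⟶ Y) :
    IsLim c ↔ IsIso (adj.homEquiv _ _ c) := by
  rw [isIso_iff_yoneda_map_bijective]
  refine forall_congr' fun W => ?_
  rw [← (adj.homEquiv W Y).symm.bijective.of_comp_iff']
  have e : (fun f : W ⟶ Z => (D.res (toPt J)).map f ≫ c) =
      (adj.homEquiv W Y).symm ∘ fun f => f ≫ adj.homEquiv _ _ c := by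
    funext f
    simp [CategoryTheory.Adjunction.homEquiv_naturality_left_symm]
  rw [e]

end

end Prederivator

namespace Mor

open Prederivator

variable {D E : Prederivator.{w, v, u}} (F : Mor D E) {J K : Type w} [Category.{w} J]
  [Category.{w} K] {q : J ⥤ K} {κ : Pt.{w} ⥤ K}

theorem cohRes_resMap {p p' : J ⥤ K} (α : p ⟶ p') (X : D.Coh K) :
    (F.coh J).map ((D.resMap α).app X) ≫ (F.cohRes p').hom.app X =
      (F.cohRes p).hom.app X ≫ (E.resMap α).app ((F.coh K).obj X) :=
  congr($(F.naturality_naturality (op2 α.toCatHom₂)).toNatTrans.app X)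

theorem cohRes_resComp {J' : Type w} [Category.{w} J'] (p : J' ⥤ J) (q : J ⥤ K) (X : D.Coh K) :
    (F.cohRes (p ⋙ q)).hom.app X ≫ (E.resComp p q).hom.app ((F.coh K).obj X) =
      (F.coh J').map ((D.resComp p q).hom.app X) ≫ (F.cohRes p).hom.app ((D.res q).obj X) ≫
        (E.res p).map ((F.cohRes q).hom.app X) := by
  refine (congr($(F.naturality_comp q.toCatHom.op p.toCatHom.op).toNatTrans.app X)).trans ?_
  change (F.coh J').map ((D.resComp p q).hom.app X) ≫ 𝟙 _ ≫
    (F.cohRes p).hom.app ((D.res q).obj X) ≫ 𝟙 _ ≫ (E.res p).map ((F.cohRes q).hom.app X) ≫ 𝟙 _ = _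
  rw [Category.id_comp, Category.id_comp, Category.comp_id]

theorem map_coconeMap (θ : q ⟶ toPt J ⋙ κ) (X : D.Coh K) :
    ((F.coh J).map (D.coconeMap θ X) ≫ (F.cohRes (toPt J)).hom.app ((D.res κ).obj X)) ≫
        (E.res (toPt J)).map ((F.cohRes κ).hom.app X) =
      (F.cohRes q).hom.app X ≫ E.coconeMap θ ((F.coh K).obj X) := by
  simp only [coconeMap, Functor.map_comp, Category.assoc]
  rw [← cohRes_resComp]
  exact (Category.assoc _ _ _).symm.trans ((congrArg (· ≫ _) (F.cohRes_resMap θ X)).trans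
    (Category.assoc _ _ _))

variable {F}

/-- Preservation of colimits in terms of colimit cocones. -/
theorem PreservesColimitsOfShape.isColimAt (hF : F.PreservesColimitsOfShape J)
    (hD : D.Der3) (hE : E.Der3) {θ : q ⟶ toPt J ⋙ κ} {X : D.Coh K} (h : D.IsColimAt θ X) :
    E.IsColimAt θ ((F.coh K).obj X) := by
  have := (hD _ _ (toPt J)).1
  have := (hE _ _ (toPt J)).1
  let a := CategoryTheory.Adjunction.ofIsRightAdjoint (D.res (toPt J))
  let a' := CategoryTheory.Adjunction.ofIsRightAdjoint (E.res (toPt J))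
  refine (isColim_iff_of_iso ((F.cohRes q).app X) ((F.cohRes κ).app X)
    (F.map_coconeMap θ X)).2 ((isColim_iff_isIso a' _).2 ?_)
  have e := homEquiv_symm_square a a' (TwoSquare.mk _ _ _ _ (F.cohRes (toPt J)).hom)
    (D.coconeMap θ X)
  have h₁ := (isColim_iff_isIso a _).1 h
  have h₂ := hF _ a _ a'
  rw [NatTrans.isIso_iff_isIso_app] at h₂
  have h₃ := h₂ ((D.res q).obj X)
  have h₄ := IsIso.comp_isIso' h₃ (Functor.map_isIso (F.coh Pt)
    ((a.homEquiv _ _).symm (D.coconeMap θ X)))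
  rw [← e] at h₄
  exact h₄

end Mor

/-! ### Pointwise Kan extensions -/

/-- A terminal object, as a right adjoint. -/
def adjunctionOfIsTerminal {J : Type w} [Category.{w} J] {t : J} (h : Limits.IsTerminal t) :
    toPt J ⊣ ptAt t where
  unit := { app := fun j => h.from j, naturality := fun _ _ _ => h.hom_ext _ _ }
  counit := { app := fun _ => 𝟙 _, naturality := fun _ _ _ => Subsingleton.elim _ _ }
  left_triangle_components _ := Subsingleton.elim _ _
  right_triangle_components _ := h.hom_ext _ _

/-- An initial object, as a left adjoint. -/
def adjunctionOfIsInitial {J : Type w} [Category.{w} J] {t : J} (h : Limits.IsInitial t) :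
    ptAt t ⊣ toPt J where
  unit := { app := fun _ => 𝟙 _, naturality := fun _ _ _ => Subsingleton.elim _ _ }
  counit := { app := fun j => h.to j, naturality := fun _ _ _ => h.hom_ext _ _ }
  left_triangle_components _ := h.hom_ext _ _
  right_triangle_components _ := Subsingleton.elim _ _

/-- Functors out of the point are isomorphic if their values are. -/
def ptIso {A : Type w} [Category.{w} A] {F G : Pt.{w} ⥤ A}
    (e : F.obj ⟨⟨⟩⟩ ≅ G.obj ⟨⟨⟩⟩) : F ≅ G :=
  Discrete.natIso fun _ => e

namespace Prederivator

variable {D : Prederivator.{w, v, u}}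

section

variable (D) in
/-- Restriction along `∗ → ∗` is isomorphic to the identity. -/
def resPt : D.res (toPt Pt.{w}) ≅ 𝟭 _ :=
  D.resMapIso (NatIso.ofComponents (fun _ => Iso.refl _) fun _ => Subsingleton.elim _ _) ≪≫
    D.resId Pt.{w}

theorem isColim_pt_iff {Y Z : D.Coh Pt.{w}} (c : Y ⟶ (D.res (toPt Pt)).obj Z) :
    IsColim c ↔ IsIso c := by
  have : IsIso c ↔ IsIso (c ≫ D.resPt.hom.app Z) :=
    ⟨fun _ => inferInstance, fun _ => IsIso.of_isIso_comp_right c (D.resPt.hom.app Z)⟩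
  rw [this, isIso_iff_coyoneda_map_bijective]
  refine forall_congr' fun W => ?_
  rw [← (D.resPt.app W).homToEquiv.bijective.of_comp_iff']
  have e : (D.resPt.app W).homToEquiv ∘ (fun f : Z ⟶ W => c ≫ (D.res (toPt Pt)).map f) =
      fun f : Z ⟶ W => (c ≫ D.resPt.hom.app Z) ≫ f := by
    funext f
    exact ((Category.assoc _ _ _).trans (congrArg _ (D.resPt.hom.naturality f))).trans
      (Category.assoc _ _ _).symm
  rw [e]
  exact Iff.rfl

theorem isLim_pt_iff {Y Z : D.Coh Pt.{w}} (c : (D.res (toPt Pt)).obj Z ⟶ Y) :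
    IsLim c ↔ IsIso c := by
  have : IsIso c ↔ IsIso (D.resPt.inv.app Z ≫ c) :=
    ⟨fun _ => inferInstance, fun _ => IsIso.of_isIso_comp_left (D.resPt.inv.app Z) c⟩
  rw [this, isIso_iff_yoneda_map_bijective]
  refine forall_congr' fun W => ?_
  rw [← (D.resPt.app W).homFromEquiv.bijective.of_comp_iff']
  have e : (D.resPt.app W).homFromEquiv ∘ (fun f : W ⟶ Z => (D.res (toPt Pt)).map f ≫ c) =
      fun f : W ⟶ Z => f ≫ D.resPt.inv.app Z ≫ c := by
    funext f
    exact ((Category.assoc _ _ _).symm.trans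
      (congrArg (· ≫ c) (D.resPt.inv.naturality f).symm)).trans (Category.assoc _ _ _)
  rw [e]
  exact Iff.rfl

variable {J : Type w} [Category.{w} J]

/-- The colimit of a diagram whose shape has a terminal object is its value there. -/
theorem isColim_iff_of_isTerminal {t : J} (h : Limits.IsTerminal t) {Y : D.Coh J}
    {Z : D.Coh Pt.{w}} (c : Y ⟶ (D.res (toPt J)).obj Z) :
    IsColim c ↔ IsIso ((D.res (ptAt t)).map c) := by
  rw [← isColim_precomp_iff (adjunctionOfIsTerminal h), isColim_pt_iff]
  refine ⟨fun h => ?_, fun h => ?_⟩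
  · exact @IsIso.of_isIso_comp_right _ _ _ _ _ ((D.res (ptAt t)).map c)
      ((D.resComp (ptAt t) (toPt J)).inv.app Z) _ h
  · exact IsIso.comp_isIso' h (inferInstanceAs (IsIso ((D.resComp (ptAt t) (toPt J)).inv.app Z)))

/-- The limit of a diagram whose shape has an initial object is its value there. -/
theorem isLim_iff_of_isInitial {t : J} (h : Limits.IsInitial t) {Y : D.Coh J}
    {Z : D.Coh Pt.{w}} (c : (D.res (toPt J)).obj Z ⟶ Y) :
    IsLim c ↔ IsIso ((D.res (ptAt t)).map c) := by
  rw [← isLim_precomp'_iff (adjunctionOfIsInitial h), isLim_pt_iff]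
  refine ⟨fun h => ?_, fun h => ?_⟩
  · exact @IsIso.of_isIso_comp_left _ _ _ _ _ ((D.resComp (ptAt t) (toPt J)).hom.app Z)
      ((D.res (ptAt t)).map c) _ h
  · exact IsIso.comp_isIso' (inferInstanceAs (IsIso ((D.resComp (ptAt t) (toPt J)).hom.app Z))) h

/-- The vertices of two colimit cocones on the same diagram are isomorphic. -/
theorem IsColim.isIso {Y : D.Coh J} {Z Z' : D.Coh Pt.{w}} {c : Y ⟶ (D.res (toPt J)).obj Z}
    {c' : Y ⟶ (D.res (toPt J)).obj Z'} (hc : IsColim c) (hc' : IsColim c') {f : Z ⟶ Z'}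
    (h : c ≫ (D.res (toPt J)).map f = c') : IsIso f := by
  rw [isIso_iff_coyoneda_map_bijective]
  intro W
  rw [← (hc W).of_comp_iff']
  convert hc' W using 1
  funext g
  simp [← h]

theorem IsLim.isIso {Y : D.Coh J} {Z Z' : D.Coh Pt.{w}} {c : (D.res (toPt J)).obj Z ⟶ Y}
    {c' : (D.res (toPt J)).obj Z' ⟶ Y} (hc : IsLim c) (hc' : IsLim c') {f : Z' ⟶ Z}
    (h : (D.res (toPt J)).map f ≫ c = c') : IsIso f := by
  rw [isIso_iff_yoneda_map_bijective]
  intro W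
  rw [← (hc W).of_comp_iff']
  convert hc' W using 1
  funext g
  simp [← h]

end

section

variable {A K : Type w} [Category.{w} A] [Category.{w} K] (u : A ⥤ K)

variable (D) in
/-- The canonical cocone on `u^* X`, restricted to the slice `(u/k)`. -/
def kanCocone (k : K) (X : D.Coh K) :
    (D.res (CostructuredArrow.proj u k)).obj ((D.res u).obj X) ⟶
      (D.res (toPt (CostructuredArrow u k))).obj ((D.eval k).obj X) :=
  (D.sliceOverSquare u k).natTrans.app X

variable (D) in
/-- The canonical cone on `u^* X`, restricted to the slice `(k/u)`. -/
def kanCone (k : K) (X : D.Coh K) :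
    (D.res (toPt (StructuredArrow k u))).obj ((D.eval k).obj X) ⟶
      (D.res (StructuredArrow.proj k u)).obj ((D.res u).obj X) :=
  (D.sliceUnderSquare u k).natTrans.app X

theorem isColim_kanCocone_iff (k : K) (X : D.Coh K) :
    IsColim (D.kanCocone u k X) ↔ D.IsColimAt (sliceOver u k) X := by
  refine isColim_iff_of_iso ((D.resComp (CostructuredArrow.proj u k) u).app X) (Iso.refl _) ?_
  rw [Iso.refl_hom, CategoryTheory.Functor.map_id]
  exact (Category.comp_id _).trans
    (((D.resComp (CostructuredArrow.proj u k) u).app X).hom_inv_id_assoc _).symm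

theorem isLim_kanCone_iff (k : K) (X : D.Coh K) :
    IsLim (D.kanCone u k X) ↔ D.IsLimAt (sliceUnder u k) X := by
  refine isLim_iff_of_iso ((D.resComp (StructuredArrow.proj k u) u).app X) (Iso.refl _) ?_
  rw [Iso.refl_hom, CategoryTheory.Functor.map_id]
  exact (Category.assoc _ _ _).trans (Category.id_comp _).symm

/-- Left Kan extensions are given by pointwise colimits. -/
theorem IsDerivator.isColim_lan (hD : D.IsDerivator) {lan : D.Coh A ⥤ D.Coh K}
    (adj : lan ⊣ D.res u) (Y : D.Coh A) (k : K) :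
    IsColim ((D.res (CostructuredArrow.proj u k)).map (adj.unit.app Y) ≫
      D.kanCocone u k (lan.obj Y)) := by
  have := (hD.der3 _ _ (toPt (CostructuredArrow u k))).1
  let a := CategoryTheory.Adjunction.ofIsRightAdjoint (D.res (toPt (CostructuredArrow u k)))
  rw [isColim_iff_isIso a]
  have e := homEquiv_symm_square (Y := Y) adj a (D.sliceOverSquare u k) (adj.unit.app Y)
  have h₂ := (hD.der4 _ _ u k).1 _ adj _ a
  rw [NatTrans.isIso_iff_isIso_app] at h₂
  have h₄ := IsIso.comp_isIso' (h₂ Y) (Functor.map_isIso (D.eval k) (𝟙 (lan.obj Y)))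
  -- The unit is the transpose of the identity.
  have e' : 𝟙 (lan.obj Y) = (adj.homEquiv Y _).symm (adj.unit.app Y) := by
    simp [CategoryTheory.Adjunction.homEquiv_counit]
  rw [e'] at h₄
  rw [← e] at h₄
  exact h₄

/-- Right Kan extensions are given by pointwise limits. -/
theorem IsDerivator.isLim_ran (hD : D.IsDerivator) {ran : D.Coh A ⥤ D.Coh K}
    (adj : D.res u ⊣ ran) (Y : D.Coh A) (k : K) :
    IsLim (D.kanCone u k (ran.obj Y) ≫
      (D.res (StructuredArrow.proj k u)).map (adj.counit.app Y)) := by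
  have := (hD.der3 _ _ (toPt (StructuredArrow k u))).2
  let a := CategoryTheory.Adjunction.ofIsLeftAdjoint (D.res (toPt (StructuredArrow k u)))
  rw [isLim_iff_isIso a]
  have e := homEquiv_square (Z := Y) adj a (D.sliceUnderSquare u k) (adj.counit.app Y)
  have h₂ := (hD.der4 _ _ u k).2 _ adj _ a
  rw [NatTrans.isIso_iff_isIso_app] at h₂
  have h₄ := IsIso.comp_isIso' (Functor.map_isIso (D.eval k) (𝟙 (ran.obj Y))) (h₂ Y)
  -- The counit is the transpose of the identity.
  have e' : 𝟙 (ran.obj Y) = adj.homEquiv _ Y (adj.counit.app Y) := by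
    simp [CategoryTheory.Adjunction.homEquiv_unit]
  rw [e'] at h₄
  rw [← e] at h₄
  exact h₄

variable (D) in
/-- The coherent diagrams on `K` that are pointwise left Kan extensions of their restrictions
along `u`. -/
def LeftExtended : ObjectProperty (D.Coh K) := fun X => ∀ k, D.IsColimAt (sliceOver u k) X

variable (D) in
/-- The coherent diagrams on `K` that are pointwise right Kan extensions of their restrictions
along `u`. -/
def RightExtended : ObjectProperty (D.Coh K) := fun X => ∀ k, D.IsLimAt (sliceUnder u k) X

theorem isIso_map_resComp {A' B' C' : Type w} [Category.{w} A'] [Category.{w} B'] [Category.{w} C']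
    (p : A' ⥤ B') (q : B' ⥤ C') {X Y : D.Coh C'} (f : X ⟶ Y) :
    IsIso ((D.res p).map ((D.res q).map f)) ↔ IsIso ((D.res (p ⋙ q)).map f) :=
  NatIso.isIso_map_iff (D.resComp p q).symm f

/-- A left extended diagram is the left Kan extension of its restriction: both have the same
pointwise colimits, and isomorphisms are detected pointwise. -/
theorem LeftExtended.isIso_counit (hD : D.IsDerivator) {lan : D.Coh A ⥤ D.Coh K}
    (adj : lan ⊣ D.res u) {X : D.Coh K} (hX : D.LeftExtended u X) : IsIso (adj.counit.app X) := by
  rw [hD.der2]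
  intro k
  refine (hD.isColim_lan u adj ((D.res u).obj X) k).isIso
    ((isColim_kanCocone_iff u k X).2 (hX k)) ?_
  -- Restricting along the counit undoes the unit, by a triangle identity.
  have e := (D.sliceOverSquare u k).natTrans.naturality (adj.counit.app X)
  refine (Category.assoc _ _ _).trans ((congrArg _ e.symm).trans ?_)
  refine (Category.assoc _ _ _).symm.trans ?_
  refine Eq.trans (congrArg (· ≫ D.kanCocone u k X) ?_) (Category.id_comp _)
  refine ((D.res (CostructuredArrow.proj u k)).map_comp _ _).symm.trans ?_
  exact (congrArg (D.res (CostructuredArrow.proj u k)).map (adj.right_triangle_components X)).trans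
    ((D.res (CostructuredArrow.proj u k)).map_id _)

/-- A right extended diagram is the right Kan extension of its restriction. -/
theorem RightExtended.isIso_unit (hD : D.IsDerivator) {ran : D.Coh A ⥤ D.Coh K}
    (adj : D.res u ⊣ ran) {X : D.Coh K} (hX : D.RightExtended u X) : IsIso (adj.unit.app X) := by
  rw [hD.der2]
  intro k
  refine (hD.isLim_ran u adj ((D.res u).obj X) k).isIso ((isLim_kanCone_iff u k X).2 (hX k)) ?_
  have e := (D.sliceUnderSquare u k).natTrans.naturality (adj.unit.app X)
  refine (Category.assoc _ _ _).symm.trans ((congrArg (· ≫ _) e).trans ?_)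
  refine (Category.assoc _ _ _).trans ?_
  refine Eq.trans (congrArg (D.kanCone u k X ≫ ·) ?_) (Category.comp_id _)
  refine ((D.res (StructuredArrow.proj k u)).map_comp _ _).symm.trans ?_
  exact (congrArg (D.res (StructuredArrow.proj k u)).map (adj.left_triangle_components X)).trans
    ((D.res (StructuredArrow.proj k u)).map_id _)

variable {u}

/-- Morphisms out of a left extended diagram are determined by their restrictions. -/
theorem LeftExtended.bijective_map (hD : D.IsDerivator) {X : D.Coh K} (hX : D.LeftExtended u X)
    (X' : D.Coh K) : Function.Bijective fun f : X ⟶ X' => (D.res u).map f := by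
  have := (hD.der3 _ _ u).1
  let adj := CategoryTheory.Adjunction.ofIsRightAdjoint (D.res u)
  have := hX.isIso_counit u hD adj
  have e : (fun f : X ⟶ X' => (D.res u).map f) =
      adj.homEquiv _ _ ∘ fun f => adj.counit.app X ≫ f := by
    funext f
    simp [CategoryTheory.Adjunction.homEquiv_unit]
  rw [e]
  exact (Equiv.bijective _).comp (asIso (adj.counit.app X)).homFromEquiv.symm.bijective

/-- Morphisms to a right extended diagram are determined by their restrictions. -/
theorem RightExtended.bijective_map (hD : D.IsDerivator) {X : D.Coh K} (hX : D.RightExtended u X)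
    (X' : D.Coh K) : Function.Bijective fun f : X' ⟶ X => (D.res u).map f := by
  have := (hD.der3 _ _ u).2
  let adj := CategoryTheory.Adjunction.ofIsLeftAdjoint (D.res u)
  have := hX.isIso_unit u hD adj
  have e : (fun f : X' ⟶ X => (D.res u).map f) =
      (adj.homEquiv _ _).symm ∘ fun f => f ≫ adj.unit.app X := by
    funext f
    simp [CategoryTheory.Adjunction.homEquiv_counit]
  rw [e]
  exact (Equiv.bijective _).comp (asIso (adj.unit.app X)).homToEquiv.bijective

variable (u)

theorem isEquivalence_ι_res (P : ObjectProperty (D.Coh K))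
    (h : ∀ X X', P X → P X' → Function.Bijective fun f : X ⟶ X' => (D.res u).map f)
    (h' : ∀ Y, ∃ X, P X ∧ Nonempty ((D.res u).obj X ≅ Y)) : (P.ι ⋙ D.res u).IsEquivalence where
  faithful := ⟨fun {X X'} f g e => ObjectProperty.hom_ext _ ((h _ _ X.2 X'.2).1 e)⟩
  full := ⟨fun {X X'} f => by
    obtain ⟨g, hg⟩ := (h _ _ X.2 X'.2).2 f
    exact ⟨ObjectProperty.homMk g, hg⟩⟩
  essSurj := ⟨fun Y => by
    obtain ⟨X, hX, ⟨e⟩⟩ := h' Y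
    exact ⟨⟨X, hX⟩, ⟨e⟩⟩⟩

variable [u.Full] [u.Faithful]

/-- At the objects in the image of a fully faithful functor `u`, the canonical cocones are
colimit cocones. -/
theorem isColimAt_sliceOver_obj (a : A) (X : D.Coh K) :
    D.IsColimAt (sliceOver u (u.obj a)) X := by
  rw [← isColimAt_whiskerLeft (adjunctionOfIsTerminal (CostructuredArrow.mkIdTerminal (S := u)))]
  refine (isColim_pt_iff _).2 ?_
  have : IsIso (Functor.whiskerLeft (ptAt (CostructuredArrow.mk (𝟙 (u.obj a))))
      (sliceOver u (u.obj a))) := by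
    rw [NatTrans.isIso_iff_isIso_app]
    intro _
    exact inferInstanceAs (IsIso (𝟙 (u.obj a)))
  exact IsIso.comp_isIso' (inferInstanceAs (IsIso ((D.resMap _).app X)))
    (inferInstanceAs (IsIso ((D.resComp _ _).hom.app X)))

theorem isLimAt_sliceUnder_obj (a : A) (X : D.Coh K) :
    D.IsLimAt (sliceUnder u (u.obj a)) X := by
  rw [← isLimAt_whiskerLeft (adjunctionOfIsInitial (StructuredArrow.mkIdInitial (T := u)))]
  refine (isLim_pt_iff _).2 ?_
  have : IsIso (Functor.whiskerLeft (ptAt (StructuredArrow.mk (𝟙 (u.obj a))))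
      (sliceUnder u (u.obj a))) := by
    rw [NatTrans.isIso_iff_isIso_app]
    intro _
    exact inferInstanceAs (IsIso (𝟙 (u.obj a)))
  exact IsIso.comp_isIso' (inferInstanceAs (IsIso ((D.resComp _ _).inv.app X)))
    (inferInstanceAs (IsIso ((D.resMap _).app X)))

/-- Left Kan extension along a fully faithful functor is fully faithful. -/
theorem IsDerivator.isIso_unit_lan (hD : D.IsDerivator) {lan : D.Coh A ⥤ D.Coh K}
    (adj : lan ⊣ D.res u) (Y : D.Coh A) : IsIso (adj.unit.app Y) := by
  rw [hD.der2]
  intro a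
  have h₁ := hD.isColim_lan u adj Y (u.obj a)
  have h₂ := (isColim_kanCocone_iff u (u.obj a) (lan.obj Y)).2 (isColimAt_sliceOver_obj u a _)
  rw [isColim_iff_of_isTerminal (CostructuredArrow.mkIdTerminal (S := u))] at h₁ h₂
  rw [Functor.map_comp] at h₁
  have h₃ := @IsIso.of_isIso_comp_right _ _ _ _ _ _ _ h₂ h₁
  have h₄ := (isIso_map_resComp _ _ _).1 h₃
  exact (NatIso.isIso_map_iff (D.resMapIso (ptIso (Iso.refl a))) _).1 h₄

/-- Right Kan extension along a fully faithful functor is fully faithful. -/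
theorem IsDerivator.isIso_counit_ran (hD : D.IsDerivator) {ran : D.Coh A ⥤ D.Coh K}
    (adj : D.res u ⊣ ran) (Y : D.Coh A) : IsIso (adj.counit.app Y) := by
  rw [hD.der2]
  intro a
  have h₁ := hD.isLim_ran u adj Y (u.obj a)
  have h₂ := (isLim_kanCone_iff u (u.obj a) (ran.obj Y)).2 (isLimAt_sliceUnder_obj u a _)
  rw [isLim_iff_of_isInitial (StructuredArrow.mkIdInitial (T := u))] at h₁ h₂
  rw [Functor.map_comp] at h₁
  have h₃ := @IsIso.of_isIso_comp_left _ _ _ _ _ _ _ h₂ h₁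
  have h₄ := (isIso_map_resComp _ _ _).1 h₃
  exact (NatIso.isIso_map_iff (D.resMapIso (ptIso (Iso.refl a))) _).1 h₄

theorem IsDerivator.leftExtended_lan (hD : D.IsDerivator) {lan : D.Coh A ⥤ D.Coh K}
    (adj : lan ⊣ D.res u) (Y : D.Coh A) : D.LeftExtended u (lan.obj Y) := fun k => by
  have := hD.isIso_unit_lan u adj Y
  rw [← isColim_kanCocone_iff]
  refine isColim_of_iso ((D.res (CostructuredArrow.proj u k)).mapIso
    (asIso (adj.unit.app Y)).symm) (Iso.refl _) ?_ (hD.isColim_lan u adj Y k)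
  rw [Iso.refl_hom, CategoryTheory.Functor.map_id]
  exact (Category.comp_id _).trans (((D.res (CostructuredArrow.proj u k)).mapIso
    (asIso (adj.unit.app Y))).inv_hom_id_assoc _).symm

theorem IsDerivator.rightExtended_ran (hD : D.IsDerivator) {ran : D.Coh A ⥤ D.Coh K}
    (adj : D.res u ⊣ ran) (Y : D.Coh A) : D.RightExtended u (ran.obj Y) := fun k => by
  have := hD.isIso_counit_ran u adj Y
  rw [← isLim_kanCone_iff]
  refine isLim_of_iso ((D.res (StructuredArrow.proj k u)).mapIso
    (asIso (adj.counit.app Y))) (Iso.refl _) ?_ (hD.isLim_ran u adj Y k)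
  rw [Iso.refl_hom, CategoryTheory.Functor.map_id]
  exact (Category.id_comp _).symm

theorem IsDerivator.exists_leftExtended (hD : D.IsDerivator) (Y : D.Coh A) :
    ∃ X, D.LeftExtended u X ∧ Nonempty ((D.res u).obj X ≅ Y) := by
  have := (hD.der3 _ _ u).1
  let adj := CategoryTheory.Adjunction.ofIsRightAdjoint (D.res u)
  have := hD.isIso_unit_lan u adj Y
  exact ⟨_, hD.leftExtended_lan u adj Y, ⟨(asIso (adj.unit.app Y)).symm⟩⟩

theorem IsDerivator.exists_rightExtended (hD : D.IsDerivator) (Y : D.Coh A) :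
    ∃ X, D.RightExtended u X ∧ Nonempty ((D.res u).obj X ≅ Y) := by
  have := (hD.der3 _ _ u).2
  let adj := CategoryTheory.Adjunction.ofIsLeftAdjoint (D.res u)
  have := hD.isIso_counit_ran u adj Y
  exact ⟨_, hD.rightExtended_ran u adj Y, ⟨asIso (adj.counit.app Y)⟩⟩

end

end Prederivator

/-! ### Parameters, empty shapes and slices of preorders -/

namespace Prederivator

variable {D : Prederivator.{w, v, u}}

section Empty

variable {J K : Type w} [Category.{w} J] [Category.{w} K] [IsEmpty J] {q : J ⥤ K} {κ : Pt.{w} ⥤ K}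

/-- The category of coherent diagrams on the empty category is contractible. -/
theorem IsDerivator.nonempty_unique_hom (hD : D.IsDerivator) (X Y : D.Coh J) :
    Nonempty (Unique (X ⟶ Y)) := by
  have := hD.der1 PEmpty.{w + 1} (fun _ => Pt.{w})
  let e : (Σ _ : PEmpty.{w + 1}, Pt.{w}) ≌ J := equivalenceOfIsEmpty _ _
  have := D.isEquivalence_res e.functor
  let F := D.res e.functor ⋙ Functor.pi' fun i : PEmpty.{w + 1} =>
    D.res (Sigma.incl (C := fun _ => Pt.{w}) i)
  have : F.IsEquivalence := inferInstance
  exact ⟨⟨⟨F.preimage fun i => i.elim⟩, fun f => F.map_injective (funext fun i => i.elim)⟩⟩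

/-- Colimits of empty diagrams are initial objects. -/
theorem IsDerivator.isColimAt_iff_isInitial (hD : D.IsDerivator) (θ : q ⟶ toPt J ⋙ κ)
    (X : D.Coh K) : D.IsColimAt θ X ↔ Nonempty (Limits.IsInitial ((D.res κ).obj X)) := by
  constructor
  · intro h
    have (W : D.Coh Pt.{w}) : Nonempty (Unique ((D.res κ).obj X ⟶ W)) := by
      obtain ⟨i⟩ := hD.nonempty_unique_hom ((D.res q).obj X) ((D.res (toPt J)).obj W)
      exact ⟨(Equiv.ofBijective _ (h W)).unique⟩
    exact ⟨Limits.IsInitial.ofUnique (h := fun W => (this W).some) _⟩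
  · rintro ⟨h⟩ W
    obtain ⟨i⟩ := hD.nonempty_unique_hom ((D.res q).obj X) ((D.res (toPt J)).obj W)
    exact ⟨fun _ _ _ => h.hom_ext _ _, fun _ => ⟨h.to W, Subsingleton.elim _ _⟩⟩

/-- Limits of empty diagrams are terminal objects. -/
theorem IsDerivator.isLimAt_iff_isTerminal (hD : D.IsDerivator) (θ : toPt J ⋙ κ ⟶ q)
    (X : D.Coh K) : D.IsLimAt θ X ↔ Nonempty (Limits.IsTerminal ((D.res κ).obj X)) := by
  constructor
  · intro h
    have (W : D.Coh Pt.{w}) : Nonempty (Unique (W ⟶ (D.res κ).obj X)) := by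
      obtain ⟨i⟩ := hD.nonempty_unique_hom ((D.res (toPt J)).obj W) ((D.res q).obj X)
      exact ⟨(Equiv.ofBijective _ (h W)).unique⟩
    exact ⟨Limits.IsTerminal.ofUnique (h := fun W => (this W).some) _⟩
  · rintro ⟨h⟩ W
    obtain ⟨i⟩ := hD.nonempty_unique_hom ((D.res (toPt J)).obj W) ((D.res q).obj X)
    exact ⟨fun _ _ _ => h.hom_ext _ _, fun _ => ⟨h.from W, Subsingleton.elim _ _⟩⟩

end Empty

section Prod

variable {A K B : Type w} [Category.{w} A] [Category.{w} K] [Category.{w} B] (i : A ⥤ K)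

/-- The inclusion of the slice `(i/k)` in the slice `(i × B/(k,b))`. -/
def overIncl (k : K) (b : B) :
    CostructuredArrow i k ⥤ CostructuredArrow (i.prod (𝟭 B)) (k, b) where
  obj x := CostructuredArrow.mk (Y := (x.left, b)) (x.hom, 𝟙 b)
  map f := CostructuredArrow.homMk (f.left, 𝟙 b) (Prod.ext (CostructuredArrow.w f) (by simp))

/-- The projection of the slice `(i × B/(k,b))` to the slice `(i/k)`. -/
def overProj (k : K) (b : B) :
    CostructuredArrow (i.prod (𝟭 B)) (k, b) ⥤ CostructuredArrow i k where
  obj x := CostructuredArrow.mk (Y := x.left.1) x.hom.1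
  map f := CostructuredArrow.homMk f.left.1 (congrArg (·.1) (CostructuredArrow.w f))

/-- The inclusion `(i/k) → (i × B/(k,b))` is a right adjoint, hence final. -/
def overAdjunction (k : K) (b : B) : overProj i k b ⊣ overIncl i k b where
  unit :=
    { app := fun x => CostructuredArrow.homMk (𝟙 x.left.1, x.hom.2)
        (Prod.ext (by simp [overIncl, overProj]) (by simp [overIncl, overProj]))
      naturality := fun x y f => by
        ext
        · simp [overIncl, overProj]
        · simpa [overIncl, overProj] using congrArg (·.2) (CostructuredArrow.w f) }
  counit :=
    { app := fun x => 𝟙 x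
      naturality := fun _ _ _ => (Category.comp_id _).trans (Category.id_comp _).symm }
  left_triangle_components _ := CostructuredArrow.hom_ext _ _ (Category.comp_id _)
  right_triangle_components _ :=
    CostructuredArrow.hom_ext _ _ (Prod.ext (Category.comp_id _) (Category.comp_id _))

/-- The inclusion of the slice `(k/i)` in the slice `((k,b)/i × B)`. -/
def underIncl (k : K) (b : B) :
    StructuredArrow k i ⥤ StructuredArrow (k, b) (i.prod (𝟭 B)) where
  obj x := StructuredArrow.mk (Y := (x.right, b)) (x.hom, 𝟙 b)
  map f := StructuredArrow.homMk (f.right, 𝟙 b) (Prod.ext (StructuredArrow.w f) (by simp))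

/-- The projection of the slice `((k,b)/i × B)` to the slice `(k/i)`. -/
def underProj (k : K) (b : B) :
    StructuredArrow (k, b) (i.prod (𝟭 B)) ⥤ StructuredArrow k i where
  obj x := StructuredArrow.mk (Y := x.right.1) x.hom.1
  map f := StructuredArrow.homMk f.right.1 (congrArg (·.1) (StructuredArrow.w f))

/-- The inclusion `(k/i) → ((k,b)/i × B)` is a left adjoint, hence initial. -/
def underAdjunction (k : K) (b : B) : underIncl i k b ⊣ underProj i k b where
  unit :=
    { app := fun x => 𝟙 x
      naturality := fun _ _ _ => (Category.comp_id _).trans (Category.id_comp _).symm }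
  counit :=
    { app := fun x => StructuredArrow.homMk (𝟙 x.right.1, x.hom.2)
        (Prod.ext (by simp [underIncl, underProj]) (by simp [underIncl, underProj]))
      naturality := fun x y f => by
        ext
        · simp [underIncl, underProj]
        · simpa [underIncl, underProj] using (congrArg (·.2) (StructuredArrow.w f)).symm }
  left_triangle_components _ :=
    StructuredArrow.hom_ext _ _ (Prod.ext (Category.id_comp _) (Category.id_comp _))
  right_triangle_components _ := StructuredArrow.hom_ext _ _ (Category.id_comp _)

theorem isColimAt_sliceOver_prod (k : K) (b : B) (X : D.Coh (K × B)) :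
    D.IsColimAt (sliceOver (i.prod (𝟭 B)) (k, b)) X ↔
      D.IsColimAt (sliceOver i k) ((D.res (Prod.sectL K b)).obj X) := by
  rw [← isColimAt_whiskerLeft (overAdjunction i k b), isColimAt_res]
  refine isColimAt_congr (NatIso.ofComponents (fun _ => Iso.refl _) ?_) (ptIso (Iso.refl _)) ?_ X
  · intro x y f
    simp [overIncl]
  · exact NatTrans.ext (funext fun x => (Category.comp_id _).trans (Category.id_comp _).symm)

theorem isLimAt_sliceUnder_prod (k : K) (b : B) (X : D.Coh (K × B)) :
    D.IsLimAt (sliceUnder (i.prod (𝟭 B)) (k, b)) X ↔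
      D.IsLimAt (sliceUnder i k) ((D.res (Prod.sectL K b)).obj X) := by
  rw [← isLimAt_whiskerLeft (underAdjunction i k b), isLimAt_res]
  refine isLimAt_congr (NatIso.ofComponents (fun _ => Iso.refl _) ?_) (ptIso (Iso.refl _)) ?_ X
  · intro x y f
    simp [underIncl]
  · exact NatTrans.ext (funext fun x => (Category.comp_id _).trans (Category.id_comp _).symm)

/-- Left Kan extensions with parameters are computed parameterwise. -/
theorem leftExtended_prod_iff (X : D.Coh (K × B)) :
    D.LeftExtended (i.prod (𝟭 B)) X ↔
      ∀ b, D.LeftExtended i ((D.res (Prod.sectL K b)).obj X) :=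
  ⟨fun h b k => (isColimAt_sliceOver_prod i k b X).1 (h (k, b)),
    fun h x => (isColimAt_sliceOver_prod i x.1 x.2 X).2 (h x.2 x.1)⟩

/-- Right Kan extensions with parameters are computed parameterwise. -/
theorem rightExtended_prod_iff (X : D.Coh (K × B)) :
    D.RightExtended (i.prod (𝟭 B)) X ↔
      ∀ b, D.RightExtended i ((D.res (Prod.sectL K b)).obj X) :=
  ⟨fun h b k => (isLimAt_sliceUnder_prod i k b X).1 (h (k, b)),
    fun h x => (isLimAt_sliceUnder_prod i x.1 x.2 X).2 (h x.2 x.1)⟩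

end Prod

theorem leftExtended_iff_of_iso {A K : Type w} [Category.{w} A] [Category.{w} K] (i : A ⥤ K)
    {X X' : D.Coh K} (e : X ≅ X') : D.LeftExtended i X ↔ D.LeftExtended i X' :=
  forall_congr' fun _ => isColimAt_iff_of_iso _ e

theorem rightExtended_iff_of_iso {A K : Type w} [Category.{w} A] [Category.{w} K] (i : A ⥤ K)
    {X X' : D.Coh K} (e : X ≅ X') : D.RightExtended i X ↔ D.RightExtended i X' :=
  forall_congr' fun _ => isLimAt_iff_of_iso _ e

section Thin

/-- A functor from a preorder to a thin category is a right adjoint if each of its comma categories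
under an object has a least element. -/
theorem isRightAdjoint_of_isThin {J : Type*} [Preorder J] {C : Type*} [Category* C]
    [Quiver.IsThin C] (F : J ⥤ C)
    (h : ∀ Y, ∃ j, ∀ j', Nonempty (Y ⟶ F.obj j') ↔ j ≤ j') : F.IsRightAdjoint := by
  choose l hl using h
  exact (CategoryTheory.Adjunction.adjunctionOfEquivLeft (F_obj := l) (G := F)
    (fun Y j => ⟨fun f => ((hl Y j).2 (leOfHom f)).some, fun f => homOfLE ((hl Y j).1 ⟨f⟩),
      fun _ => Subsingleton.elim _ _, fun _ => Subsingleton.elim _ _⟩)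
    (fun _ _ _ _ _ => Subsingleton.elim _ _)).isRightAdjoint

/-- A functor from a preorder to a thin category is a left adjoint if each of its comma categories
over an object has a greatest element. -/
theorem isLeftAdjoint_of_isThin {J : Type*} [Preorder J] {C : Type*} [Category* C]
    [Quiver.IsThin C] (F : J ⥤ C)
    (h : ∀ Y, ∃ j, ∀ j', Nonempty (F.obj j' ⟶ Y) ↔ j' ≤ j) : F.IsLeftAdjoint := by
  choose r hr using h
  exact (CategoryTheory.Adjunction.adjunctionOfEquivRight (G_obj := r) (F := F)
    (fun j Y => ⟨fun f => homOfLE ((hr Y j).1 ⟨f⟩), fun f => ((hr Y j).2 (leOfHom f)).some,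
      fun _ => Subsingleton.elim _ _, fun _ => Subsingleton.elim _ _⟩)
    (fun _ _ _ _ _ => Subsingleton.elim _ _)).isLeftAdjoint

variable {J A K : Type w} [Preorder J] [Preorder A] [Preorder K] (i : A ⥤ K) {k : K} {q : J ⥤ K}
  {κ : Pt.{w} ⥤ K}

/-- A cocone `θ` in a preorder `K` whose diagram factors through a functor `c` to `A` is a
colimit cocone if and only if the canonical cocone is, provided that `c` is final in the
slice `(i/k)`. -/
theorem isColimAt_sliceOver_iff (c : J ⥤ A) (θ : q ⟶ toPt J ⋙ κ) (hκ : κ.obj ⟨⟨⟩⟩ = k)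
    (hq : ∀ j, i.obj (c.obj j) = q.obj j)
    (h : ∀ a, i.obj a ≤ k → ∃ j, ∀ j', a ≤ c.obj j' ↔ j ≤ j') (X : D.Coh K) :
    D.IsColimAt (sliceOver i k) X ↔ D.IsColimAt θ X := by
  have hle (j : J) : i.obj (c.obj j) ≤ k := by
    rw [hq, ← hκ]
    exact leOfHom (θ.app j)
  let r : J ⥤ CostructuredArrow i k :=
    { obj := fun j => CostructuredArrow.mk (Y := c.obj j) (homOfLE (hle j))
      map := fun f => CostructuredArrow.homMk (c.map f) (Subsingleton.elim _ _)
      map_id := fun _ => CostructuredArrow.hom_ext _ _ (Subsingleton.elim _ _)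
      map_comp := fun _ _ => CostructuredArrow.hom_ext _ _ (Subsingleton.elim _ _) }
  have : Quiver.IsThin (CostructuredArrow i k) := fun _ _ =>
    ⟨fun _ _ => CostructuredArrow.hom_ext _ _ (Subsingleton.elim _ _)⟩
  have : r.IsRightAdjoint := isRightAdjoint_of_isThin r fun y => by
    obtain ⟨j, hj⟩ := h y.left (leOfHom y.hom)
    refine ⟨j, fun j' => Iff.trans ⟨?_, ?_⟩ (hj j')⟩
    · rintro ⟨f⟩
      exact leOfHom f.left
    · intro f
      exact ⟨CostructuredArrow.homMk (homOfLE f) (Subsingleton.elim _ _)⟩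
  rw [← isColimAt_whiskerLeft (CategoryTheory.Adjunction.ofIsRightAdjoint r)]
  exact isColimAt_congr
    (NatIso.ofComponents (fun j => eqToIso (hq j)) fun _ => Subsingleton.elim _ _)
    (ptIso (eqToIso hκ.symm)) (by ext; exact Subsingleton.elim _ _) X

/-- A cone `θ` in a preorder `K` whose diagram factors through a functor `c` to `A` is a limit cone
if and only if the canonical cone is, provided that `c` is initial in the slice `(k/i)`. -/
theorem isLimAt_sliceUnder_iff (c : J ⥤ A) (θ : toPt J ⋙ κ ⟶ q) (hκ : κ.obj ⟨⟨⟩⟩ = k)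
    (hq : ∀ j, i.obj (c.obj j) = q.obj j)
    (h : ∀ a, k ≤ i.obj a → ∃ j, ∀ j', c.obj j' ≤ a ↔ j' ≤ j) (X : D.Coh K) :
    D.IsLimAt (sliceUnder i k) X ↔ D.IsLimAt θ X := by
  have hle (j : J) : k ≤ i.obj (c.obj j) := by
    rw [hq, ← hκ]
    exact leOfHom (θ.app j)
  let r : J ⥤ StructuredArrow k i :=
    { obj := fun j => StructuredArrow.mk (Y := c.obj j) (homOfLE (hle j))
      map := fun f => StructuredArrow.homMk (c.map f) (Subsingleton.elim _ _)
      map_id := fun _ => StructuredArrow.hom_ext _ _ (Subsingleton.elim _ _)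
      map_comp := fun _ _ => StructuredArrow.hom_ext _ _ (Subsingleton.elim _ _) }
  have : Quiver.IsThin (StructuredArrow k i) := fun _ _ =>
    ⟨fun _ _ => StructuredArrow.hom_ext _ _ (Subsingleton.elim _ _)⟩
  have : r.IsLeftAdjoint := isLeftAdjoint_of_isThin r fun y => by
    obtain ⟨j, hj⟩ := h y.right (leOfHom y.hom)
    refine ⟨j, fun j' => Iff.trans ⟨?_, ?_⟩ (hj j')⟩
    · rintro ⟨f⟩
      exact leOfHom f.right
    · intro f
      exact ⟨StructuredArrow.homMk (homOfLE f) (Subsingleton.elim _ _)⟩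
  rw [← isLimAt_whiskerLeft (CategoryTheory.Adjunction.ofIsLeftAdjoint r)]
  exact isLimAt_congr
    (NatIso.ofComponents (fun j => eqToIso (hq j)) fun _ => Subsingleton.elim _ _)
    (ptIso (eqToIso hκ.symm)) (by ext; exact Subsingleton.elim _ _) X

theorem IsDerivator.isColimAt_sliceOver_iff_isInitial (hD : D.IsDerivator)
    (h : ∀ a, ¬ i.obj a ≤ k) (X : D.Coh K) :
    D.IsColimAt (sliceOver i k) X ↔ Nonempty (Limits.IsInitial ((D.eval k).obj X)) := by
  have : IsEmpty (CostructuredArrow i k) := ⟨fun x => h x.left (leOfHom x.hom)⟩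
  exact hD.isColimAt_iff_isInitial _ _

theorem IsDerivator.isLimAt_sliceUnder_iff_isTerminal (hD : D.IsDerivator)
    (h : ∀ a, ¬ k ≤ i.obj a) (X : D.Coh K) :
    D.IsLimAt (sliceUnder i k) X ↔ Nonempty (Limits.IsTerminal ((D.eval k).obj X)) := by
  have : IsEmpty (StructuredArrow k i) := ⟨fun x => h x.right (leOfHom x.hom)⟩
  exact hD.isLimAt_iff_isTerminal _ _

end Thin

end Prederivator

/-! ### Stability and the comparison of the posets of type `A₃` -/

/-- The inclusion of the complement of a point in a preorder. -/
abbrev punctureIncl {P : Type w} [Preorder P] (a : P) : {p : P // p ≠ a} ⥤ P :=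
  (Subtype.mono_coe _).functor

instance {P : Type w} [Preorder P] (a : P) : (punctureIncl a).Full :=
  ⟨fun f => ⟨homOfLE (leOfHom f), Subsingleton.elim _ _⟩⟩

instance {P : Type w} [Preorder P] (a : P) : (punctureIncl a).Faithful :=
  ⟨fun _ => Subsingleton.elim _ _⟩

instance {A K B : Type*} [Category* A] [Category* K] [Category* B] (i : A ⥤ K) [i.Full] :
    (i.prod (𝟭 B)).Full :=
  ⟨fun f => ⟨(i.preimage f.1, f.2), Prod.ext (i.map_preimage _) rfl⟩⟩

instance {A K B : Type*} [Category* A] [Category* K] [Category* B] (i : A ⥤ K) [i.Faithful] :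
    (i.prod (𝟭 B)).Faithful :=
  ⟨fun h => Prod.ext (i.map_injective congr(($h).1)) congr(($h).2)⟩

/-- The canonical cocone on the span in the square. -/
def spanCocone : spanIncl.{w} ⟶ toPt SpanShape.{w} ⋙ ptAt (⟨(1, 1)⟩ : Sq.{w}) where
  app p := homOfLE ⟨Fin.le_last p.1.down.1, Fin.le_last p.1.down.2⟩
  naturality _ _ _ := Subsingleton.elim _ _

/-- The canonical cone on the cospan in the square. -/
def cospanCone : toPt CospanShape.{w} ⋙ ptAt (⟨(0, 0)⟩ : Sq.{w}) ⟶ cospanIncl.{w} where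
  app p := homOfLE ⟨Fin.zero_le p.1.down.1, Fin.zero_le p.1.down.2⟩
  naturality _ _ _ := Subsingleton.elim _ _

namespace Prederivator

variable {D : Prederivator.{w, v, u}}

/-- Being left extended from the complement of `a` is a condition at `a` only. -/
theorem leftExtended_punctureIncl_iff {P : Type w} [Preorder P] (a : P) (X : D.Coh P) :
    D.LeftExtended (punctureIncl a) X ↔ D.IsColimAt (sliceOver (punctureIncl a) a) X := by
  refine ⟨fun h => h a, fun h k => ?_⟩
  by_cases hk : k = a
  · exact hk ▸ h
  · exact isColimAt_sliceOver_obj (punctureIncl a) ⟨k, hk⟩ X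

/-- Being right extended from the complement of `a` is a condition at `a` only. -/
theorem rightExtended_punctureIncl_iff {P : Type w} [Preorder P] (a : P) (X : D.Coh P) :
    D.RightExtended (punctureIncl a) X ↔ D.IsLimAt (sliceUnder (punctureIncl a) a) X := by
  refine ⟨fun h => h a, fun h k => ?_⟩
  by_cases hk : k = a
  · exact hk ▸ h
  · exact isLimAt_sliceUnder_obj (punctureIncl a) ⟨k, hk⟩ X

theorem leftExtended_spanIncl_iff (X : D.Coh Sq.{w}) :
    D.LeftExtended spanIncl X ↔ D.IsColimAt spanCocone X := by
  rw [← isColimAt_sliceOver_iff (k := ⟨(1, 1)⟩) spanIncl (𝟭 _) spanCocone rfl (fun _ => rfl)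
    (fun a _ => ⟨a, fun _ => Iff.rfl⟩)]
  exact leftExtended_punctureIncl_iff _ X

theorem rightExtended_cospanIncl_iff (X : D.Coh Sq.{w}) :
    D.RightExtended cospanIncl X ↔ D.IsLimAt cospanCone X := by
  rw [← isLimAt_sliceUnder_iff (k := ⟨(0, 0)⟩) cospanIncl (𝟭 _) cospanCone rfl (fun _ => rfl)
    (fun a _ => ⟨a, fun _ => Iff.rfl⟩)]
  exact rightExtended_punctureIncl_iff _ X

theorem IsDerivator.isCocartesian_iff (hD : D.IsDerivator) (X : D.Coh Sq.{w}) :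
    D.IsCocartesian X ↔ D.LeftExtended spanIncl X := by
  constructor
  · rintro ⟨lan, adj, Y, ⟨e⟩⟩
    exact (leftExtended_iff_of_iso _ e).1 (hD.leftExtended_lan (punctureIncl _) adj Y)
  · intro h
    have := (hD.der3 _ _ spanIncl).1
    let adj := CategoryTheory.Adjunction.ofIsRightAdjoint (D.res spanIncl)
    have := h.isIso_counit _ hD adj
    exact ⟨_, adj, _, ⟨asIso (adj.counit.app X)⟩⟩

theorem IsDerivator.isCartesian_iff (hD : D.IsDerivator) (X : D.Coh Sq.{w}) :
    D.IsCartesian X ↔ D.RightExtended cospanIncl X := by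
  constructor
  · rintro ⟨ran, adj, Y, ⟨e⟩⟩
    exact (rightExtended_iff_of_iso _ e).1 (hD.rightExtended_ran (punctureIncl _) adj Y)
  · intro h
    have := (hD.der3 _ _ cospanIncl).2
    let adj := CategoryTheory.Adjunction.ofIsLeftAdjoint (D.res cospanIncl)
    have := h.isIso_unit _ hD adj
    exact ⟨_, adj, _, ⟨(asIso (adj.unit.app X)).symm⟩⟩

theorem IsStableDerivator.leftExtended_iff_rightExtended (hD : D.IsStableDerivator)
    (X : D.Coh Sq.{w}) : D.LeftExtended spanIncl X ↔ D.RightExtended cospanIncl X := by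
  rw [← hD.isCocartesian_iff, ← hD.isCartesian_iff, hD.cocartesian_iff_cartesian]

theorem IsStableDerivator.isInitial_iff_isTerminal (hD : D.IsStableDerivator)
    (X : D.Coh Pt.{w}) : Nonempty (Limits.IsInitial X) ↔ Nonempty (Limits.IsTerminal X) := by
  have : Limits.HasZeroObject (D.Coh Pt.{w}) := hD.pointed
  constructor
  · rintro ⟨h⟩
    exact ⟨((Limits.isZero_zero _).of_iso
      (h.uniqueUpToIso (Limits.isZero_zero _).isInitial)).isTerminal⟩
  · rintro ⟨h⟩
    exact ⟨((Limits.isZero_zero _).of_iso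
      (h.uniqueUpToIso (Limits.isZero_zero _).isTerminal)).isInitial⟩

/-- If the span of a square `s` in `K` is final in the slice of `i` over the last vertex of `s`, then
the canonical cocone at that vertex is a colimit cocone if and only if `s` becomes cocartesian. -/
theorem isColimAt_sliceOver_iff_spanIncl {A K : Type w} [Preorder A] [Preorder K] (i : A ⥤ K)
    (s : Sq.{w} ⥤ K) (c : SpanShape.{w} ⥤ A) (hc : ∀ j, i.obj (c.obj j) = s.obj j.1)
    (h : ∀ a, i.obj a ≤ s.obj ⟨(1, 1)⟩ → ∃ j, ∀ j', a ≤ c.obj j' ↔ j ≤ j') (X : D.Coh K) :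
    D.IsColimAt (sliceOver i (s.obj ⟨(1, 1)⟩)) X ↔
      D.LeftExtended spanIncl ((D.res s).obj X) := by
  rw [leftExtended_spanIncl_iff, isColimAt_res]
  exact isColimAt_sliceOver_iff i c (κ := ptAt _ ⋙ s) (q := spanIncl ⋙ s) _ rfl hc h X

/-- If the cospan of a square `s` in `K` is initial in the slice of `i` under the first vertex of `s`,
then the canonical cone at that vertex is a limit cone if and only if `s` becomes cartesian. -/
theorem isLimAt_sliceUnder_iff_cospanIncl {A K : Type w} [Preorder A] [Preorder K] (i : A ⥤ K)
    (s : Sq.{w} ⥤ K) (c : CospanShape.{w} ⥤ A) (hc : ∀ j, i.obj (c.obj j) = s.obj j.1)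
    (h : ∀ a, s.obj ⟨(0, 0)⟩ ≤ i.obj a → ∃ j, ∀ j', c.obj j' ≤ a ↔ j' ≤ j) (X : D.Coh K) :
    D.IsLimAt (sliceUnder i (s.obj ⟨(0, 0)⟩)) X ↔
      D.RightExtended cospanIncl ((D.res s).obj X) := by
  rw [rightExtended_cospanIncl_iff, isLimAt_res]
  exact isLimAt_sliceUnder_iff i c (κ := ptAt _ ⋙ s) (q := cospanIncl ⋙ s) _ rfl hc h X

section TwoStep

variable {A K₁ K B : Type w} [Category.{w} A] [Category.{w} K₁] [Category.{w} K] [Category.{w} B]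
  (i₀ : A ⥤ K₁) (i₁ : K₁ ⥤ K) [i₀.Full] [i₀.Faithful] [i₁.Full] [i₁.Faithful]

omit [i₀.Full] [i₀.Faithful] [i₁.Full] [i₁.Faithful] in
theorem bijective_map_res_comp {X X' : D.Coh K}
    (h₁ : Function.Bijective fun f : X ⟶ X' => (D.res i₁).map f)
    (h₀ : Function.Bijective fun f : (D.res i₁).obj X ⟶ (D.res i₁).obj X' => (D.res i₀).map f) :
    Function.Bijective fun f : X ⟶ X' => (D.res (i₀ ⋙ i₁)).map f := by
  have e : (fun f : X ⟶ X' => (D.res (i₀ ⋙ i₁)).map f) =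
      (((D.resComp i₀ i₁).app X).homCongr ((D.resComp i₀ i₁).app X')).symm ∘
        (fun f => (D.res i₀).map f) ∘ fun f => (D.res i₁).map f := by
    funext f
    refine (Equiv.eq_symm_apply _).2 ?_
    exact (NatIso.naturality_1 (D.resComp i₀ i₁) f)
  rw [e]
  exact (Equiv.bijective _).comp (h₀.comp h₁)

/-- Diagrams on `A` extend uniquely to `K` by a right extension to `K₁` followed by a left
extension. -/
theorem IsDerivator.isEquivalence_left_right (hD : D.IsDerivator) (P : ObjectProperty (D.Coh K))
    (hP : ∀ X, P X ↔ D.LeftExtended i₁ X ∧ D.RightExtended i₀ ((D.res i₁).obj X)) :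
    (P.ι ⋙ D.res (i₀ ⋙ i₁)).IsEquivalence := by
  refine isEquivalence_ι_res _ _ (fun X X' h h' => ?_) fun Y => ?_
  · exact bijective_map_res_comp _ _ (((hP X).1 h).1.bijective_map hD X')
      (((hP X').1 h').2.bijective_map hD _)
  · obtain ⟨X₁, h₁, ⟨e₁⟩⟩ := hD.exists_rightExtended i₀ Y
    obtain ⟨X, h, ⟨e⟩⟩ := hD.exists_leftExtended i₁ X₁
    exact ⟨X, (hP X).2 ⟨h, (rightExtended_iff_of_iso _ e).2 h₁⟩,
      ⟨(D.resComp i₀ i₁).app X ≪≫ (D.res i₀).mapIso e ≪≫ e₁⟩⟩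

/-- Diagrams on `A` extend uniquely to `K` by a left extension to `K₁` followed by a right
extension. -/
theorem IsDerivator.isEquivalence_right_left (hD : D.IsDerivator) (P : ObjectProperty (D.Coh K))
    (hP : ∀ X, P X ↔ D.RightExtended i₁ X ∧ D.LeftExtended i₀ ((D.res i₁).obj X)) :
    (P.ι ⋙ D.res (i₀ ⋙ i₁)).IsEquivalence := by
  refine isEquivalence_ι_res _ _ (fun X X' h h' => ?_) fun Y => ?_
  · exact bijective_map_res_comp _ _ (((hP X').1 h').1.bijective_map hD X)
      (((hP X).1 h).2.bijective_map hD _)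
  · obtain ⟨X₁, h₁, ⟨e₁⟩⟩ := hD.exists_leftExtended i₀ Y
    obtain ⟨X, h, ⟨e⟩⟩ := hD.exists_rightExtended i₁ X₁
    exact ⟨X, (hP X).2 ⟨h, (leftExtended_iff_of_iso _ e).2 h₁⟩,
      ⟨(D.resComp i₀ i₁).app X ≪≫ (D.res i₀).mapIso e ≪≫ e₁⟩⟩

variable (D) in
/-- Evaluation of a restriction. -/
def evalRes {K K' : Type w} [Category.{w} K] [Category.{w} K'] (i : K ⥤ K') (k : K)
    (X : D.Coh K') : (D.eval k).obj ((D.res i).obj X) ≅ (D.eval (i.obj k)).obj X :=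
  ((D.resComp (ptAt k) i).app X).symm ≪≫ (D.resMapIso (ptIso (Iso.refl (i.obj k)))).app X

variable (D) in
/-- Restriction commutes with evaluation at a parameter. -/
def resSectL {K K' B : Type w} [Category.{w} K] [Category.{w} K'] [Category.{w} B] (i : K ⥤ K')
    (b : B) (X : D.Coh (K' × B)) :
    (D.res (Prod.sectL K b)).obj ((D.res (i.prod (𝟭 B))).obj X) ≅
      (D.res i).obj ((D.res (Prod.sectL K' b)).obj X) :=
  ((D.resComp (Prod.sectL K b) (i.prod (𝟭 B))).app X).symm ≪≫
    (D.resMapIso (NatIso.ofComponents (fun _ => Iso.refl _) fun _ =>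
      (Category.comp_id _).trans (Category.id_comp _).symm)).app X ≪≫
    (D.resComp i (Prod.sectL K' b)).app X

theorem IsDerivator.isEquivalence_left_right_prod (hD : D.IsDerivator)
    (P : ObjectProperty (D.Coh K))
    (hP : ∀ X, P X ↔ D.LeftExtended i₁ X ∧ D.RightExtended i₀ ((D.res i₁).obj X)) :
    (ObjectProperty.ι (fun X : D.Coh (K × B) => ∀ b, P ((D.res (Prod.sectL K b)).obj X)) ⋙
      D.res ((i₀ ⋙ i₁).prod (𝟭 B))).IsEquivalence := by
  refine hD.isEquivalence_left_right (i₀.prod (𝟭 B)) (i₁.prod (𝟭 B)) _ fun X => ?_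
  simp only [leftExtended_prod_iff, rightExtended_prod_iff, hP, forall_and,
    fun b => rightExtended_iff_of_iso i₀ (D.resSectL i₁ b X)]

theorem IsDerivator.isEquivalence_right_left_prod (hD : D.IsDerivator)
    (P : ObjectProperty (D.Coh K))
    (hP : ∀ X, P X ↔ D.RightExtended i₁ X ∧ D.LeftExtended i₀ ((D.res i₁).obj X)) :
    (ObjectProperty.ι (fun X : D.Coh (K × B) => ∀ b, P ((D.res (Prod.sectL K b)).obj X)) ⋙
      D.res ((i₀ ⋙ i₁).prod (𝟭 B))).IsEquivalence := by
  refine hD.isEquivalence_right_left (i₀.prod (𝟭 B)) (i₁.prod (𝟭 B)) _ fun X => ?_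
  simp only [leftExtended_prod_iff, rightExtended_prod_iff, hP, forall_and,
    fun b => leftExtended_iff_of_iso i₀ (D.resSectL i₁ b X)]

end TwoStep

end Prederivator

/-- Right exact morphisms preserve cocartesian squares. -/
theorem Mor.IsRightExact.leftExtended_spanIncl {D E : Prederivator.{w, v, u}} {F : Mor D E}
    (hF : F.IsRightExact) (hD : D.IsDerivator) (hE : E.IsDerivator) {X : D.Coh Sq.{w}}
    (h : D.LeftExtended spanIncl X) : E.LeftExtended spanIncl ((F.coh Sq).obj X) := by
  rw [Prederivator.leftExtended_spanIncl_iff] at h ⊢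
  exact hF.pushouts.isColimAt hD.der3 hE.der3 h

/-- A criterion for strong stable equivalences: both shapes embed in a shape `K` such that, in
every stable derivator, the diagrams on either of them extend uniquely to the diagrams on `K`
that have a given exact property. -/
theorem stronglyStablyEquivalent_of_pointwise_property {A A' K : Type w} [Category.{w} A]
    [Category.{w} A'] [Category.{w} K] (p : A ⥤ K) (p' : A' ⥤ K)
    (P : ∀ D : StDer.{w, v, u}, ObjectProperty (D.pre.Coh K))
    (hiso : ∀ (D : StDer.{w, v, u}) {X X' : D.pre.Coh K}, (X ≅ X') → P D X → P D X')
    (hmor : ∀ {D E : StDer.{w, v, u}} (F : D ⟶ E) (X : D.pre.Coh K),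
      P D X → P E ((F.mor.coh K).obj X))
    (hp : ∀ (D : StDer.{w, v, u}) (B : Cat.{w, w}),
      (ObjectProperty.ι (fun X : D.pre.Coh (K × B) =>
        ∀ b, P D ((D.pre.res (Prod.sectL K b)).obj X)) ⋙
          D.pre.res (p.prod (𝟭 B))).IsEquivalence)
    (hp' : ∀ (D : StDer.{w, v, u}) (B : Cat.{w, w}),
      (ObjectProperty.ι (fun X : D.pre.Coh (K × B) =>
        ∀ b, P D ((D.pre.res (Prod.sectL K b)).obj X)) ⋙
          D.pre.res (p'.prod (𝟭 B))).IsEquivalence) :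
    StronglyStablyEquivalent.{w, v, u} A A' := by
  refine stronglyStablyEquivalent_of_property p p'
    (fun D B X => ∀ b, P D ((D.pre.res (Prod.sectL K b)).obj X)) ?_ ?_ hp hp'
  · intro D B B' f X h b
    refine hiso D ?_ (h (f.toFunctor.obj b))
    refine ?_ ≪≫ (D.pre.resComp (Prod.sectL K b) ((𝟭 K).prod f.toFunctor)).app X
    exact (D.pre.resMapIso (NatIso.ofComponents (F := Prod.sectL K (f.toFunctor.obj b))
      (G := Prod.sectL K b ⋙ (𝟭 K).prod f.toFunctor) (fun _ => Iso.refl _) fun g => by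
        refine (Category.comp_id _).trans (Eq.trans ?_ (Category.id_comp _).symm)
        exact Prod.ext rfl (f.toFunctor.map_id b).symm)).app X
  · intro D E F B X h b
    exact hiso E ((F.mor.cohRes (Prod.sectL K b)).app X) (hmor F _ (h b))

/-- Cocartesian squares are determined by their spans and, being cartesian, by their cospans. -/
theorem stronglyStablyEquivalent_span_cospan :
    StronglyStablyEquivalent.{w, v, u} SpanShape.{w} CospanShape.{w} := by
  refine stronglyStablyEquivalent_of_pointwise_property spanIncl cospanIncl
    (fun D => D.pre.LeftExtended spanIncl)
    (fun D _ _ e => (Prederivator.leftExtended_iff_of_iso _ e).1)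
    (fun {D E} F X => F.isExact.right.leftExtended_spanIncl D.isStable.toIsDerivator
      E.isStable.toIsDerivator) ?_ ?_
  · intro D B
    have hD := D.isStable.toIsDerivator
    refine Prederivator.isEquivalence_ι_res _ _ ?_ ?_
    all_goals simp only [← Prederivator.leftExtended_prod_iff]
    · intro X X' h _
      exact h.bijective_map hD X'
    · exact hD.exists_leftExtended ((punctureIncl _).prod (𝟭 B))
  · intro D B
    have hD := D.isStable.toIsDerivator
    refine Prederivator.isEquivalence_ι_res _ _ ?_ ?_
    all_goals simp only [D.isStable.leftExtended_iff_rightExtended,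
      ← Prederivator.rightExtended_prod_iff]
    · intro X X' _ h
      exact h.bijective_map hD X
    · exact hD.exists_rightExtended ((punctureIncl _).prod (𝟭 B))

/-- The poset `x < y < z`, `x < o < w`, `y < w`, where `x, y, z, o, w` are the points `(0,0)`,
`(1,0)`, `(2,0)`, `(0,1)`, `(1,1)`. -/
abbrev Stair : Type w := {p : ULift.{w} (Fin 3 × Fin 2) // p ≠ ⟨(2, 1)⟩}

namespace Stair

/-- The minimum of the stair. -/
abbrev x : Stair.{w} := ⟨⟨(0, 0)⟩, by decide⟩

/-- The corner of the stair, which carries a zero object. -/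
abbrev o : Stair.{w} := ⟨⟨(0, 1)⟩, by decide⟩

/-- The vertex opposite to `x` in the square `x, y, o, w`. -/
abbrev w : Stair.{w} := ⟨⟨(1, 1)⟩, by decide⟩

instance : DecidableLE (ULift.{w} (Fin 3 × Fin 2)) :=
  fun a b => inferInstanceAs (Decidable (a.down ≤ b.down))

instance : DecidableLE (ULift.{w} (Fin 2 × Fin 2)) :=
  fun a b => inferInstanceAs (Decidable (a.down ≤ b.down))

/-- The square `x, y, o, w` in the stair. -/
abbrev sqObj (p : Sq.{w}) : Stair.{w} :=
  ⟨⟨(p.down.1.castSucc, p.down.2)⟩, by revert p; decide⟩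

/-- The square `x, y, o, w` in the stair, as a functor. -/
abbrev sq : Sq.{w} ⥤ Stair.{w} :=
  Monotone.functor (f := sqObj) fun _ _ h => ⟨Fin.castSucc_le_castSucc_iff.2 h.1, h.2⟩

/-- The poset `x < y < z`. -/
abbrev Row : Type w := {p : {p : Stair.{w} // p ≠ w} // p ≠ ⟨o, by decide⟩}

/-- The poset `z > y < w`, which has the shape of a span. -/
abbrev Roof : Type w := {p : {p : Stair.{w} // p ≠ x} // p ≠ ⟨o, by decide⟩}

/-- The span in the square `x, y, o, w`. -/
abbrev span : SpanShape.{w} ⥤ {p : Stair.{w} // p ≠ w} :=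
  Monotone.functor (f := fun p => ⟨sqObj p.1, by revert p; decide⟩) fun _ _ h => sq.monotone h

/-- The cospan in the square `x, y, o, w`. -/
abbrev cospan : CospanShape.{w} ⥤ {p : Stair.{w} // p ≠ x} :=
  Monotone.functor (f := fun p => ⟨sqObj p.1, by revert p; decide⟩) fun _ _ h => sq.monotone h

/-- The diagrams on the stair that vanish at the corner and whose square is cocartesian. -/
def IsCofiber (D : Prederivator.{w, v, u}) : ObjectProperty (D.Coh Stair.{w}) := fun X =>
  Nonempty (Limits.IsInitial ((D.eval o).obj X)) ∧ D.LeftExtended spanIncl ((D.res sq).obj X)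

/-- The slice under `o` of the inclusion of `x < y < z` is empty, and the slice over `w` is the
span in the square. -/
theorem isCofiber_iff_row {D : Prederivator.{w, v, u}} (hD : D.IsStableDerivator)
    (X : D.Coh Stair.{w}) :
    IsCofiber D X ↔ D.LeftExtended (punctureIncl w) X ∧
      D.RightExtended (punctureIncl ⟨o, by decide⟩) ((D.res (punctureIncl w)).obj X) := by
  rw [Prederivator.leftExtended_punctureIncl_iff, Prederivator.rightExtended_punctureIncl_iff,
    hD.isLimAt_sliceUnder_iff_isTerminal _ (by decide), ← hD.isInitial_iff_isTerminal,
    IsCofiber, and_comm]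
  refine and_congr ?_ ?_
  · exact (Prederivator.isColimAt_sliceOver_iff_spanIncl (punctureIncl w) sq span (fun _ => rfl)
      (by decide) X).symm
  · exact ⟨fun ⟨h⟩ => ⟨h.ofIso (D.evalRes (punctureIncl _) ⟨o, by decide⟩ X).symm⟩,
      fun ⟨h⟩ => ⟨h.ofIso (D.evalRes (punctureIncl _) ⟨o, by decide⟩ X)⟩⟩

/-- The slice over `o` of the inclusion of `z > y < w` is empty, and the cospan in the square is
initial in the slice under `x`. -/
theorem isCofiber_iff_roof {D : Prederivator.{w, v, u}} (hD : D.IsStableDerivator)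
    (X : D.Coh Stair.{w}) :
    IsCofiber D X ↔ D.RightExtended (punctureIncl x) X ∧
      D.LeftExtended (punctureIncl ⟨o, by decide⟩) ((D.res (punctureIncl x)).obj X) := by
  rw [Prederivator.rightExtended_punctureIncl_iff, Prederivator.leftExtended_punctureIncl_iff,
    hD.isColimAt_sliceOver_iff_isInitial _ (by decide),
    IsCofiber, and_comm, hD.leftExtended_iff_rightExtended]
  refine and_congr ?_ ?_
  · exact (Prederivator.isLimAt_sliceUnder_iff_cospanIncl (punctureIncl x) sq cospan (fun _ => rfl)
      (by decide) X).symm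
  · exact ⟨fun ⟨h⟩ => ⟨h.ofIso (D.evalRes (punctureIncl _) ⟨o, by decide⟩ X).symm⟩,
      fun ⟨h⟩ => ⟨h.ofIso (D.evalRes (punctureIncl _) ⟨o, by decide⟩ X)⟩⟩

end Stair

theorem stronglyStablyEquivalent_row_roof :
    StronglyStablyEquivalent.{w, v, u} Stair.Row.{w} Stair.Roof.{w} := by
  refine stronglyStablyEquivalent_of_pointwise_property
    (punctureIncl _ ⋙ punctureIncl Stair.w) (punctureIncl _ ⋙ punctureIncl Stair.x)
    (fun D => Stair.IsCofiber D.pre) ?_ ?_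
    (fun D B => D.isStable.isEquivalence_left_right_prod _ _ _
      (Stair.isCofiber_iff_row D.isStable))
    (fun D B => D.isStable.isEquivalence_right_left_prod _ _ _
      (Stair.isCofiber_iff_roof D.isStable))
  · rintro D X X' e ⟨⟨h₁⟩, h₂⟩
    exact ⟨⟨h₁.ofIso ((D.pre.eval _).mapIso e)⟩,
      (Prederivator.leftExtended_iff_of_iso _ ((D.pre.res _).mapIso e)).1 h₂⟩
  · rintro D E F X ⟨h₁, h₂⟩
    obtain ⟨h₁⟩ := F.isExact.right.initial _ h₁
    exact ⟨⟨h₁.ofIso ((F.mor.cohRes (ptAt _)).app X)⟩,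
      (Prederivator.leftExtended_iff_of_iso _ ((F.mor.cohRes Stair.sq).app X)).1
        (F.isExact.right.leftExtended_spanIncl D.isStable.toIsDerivator
          E.isStable.toIsDerivator h₂)⟩

/-! ### Quivers of type `A₃` -/

section Paths

variable {Q P : Type w} [Quiver.{w} Q] [Preorder P] (φ : Q → P)

/-- Paths in a quiver are unique if its arrows are, if the vertices are ranked by a preorder, and
if the last steps of two paths with the same ends start at the same vertex. -/
theorem path_subsingleton [∀ a b : Q, Subsingleton (a ⟶ b)] (hlt : ∀ {a b : Q}, (a ⟶ b) → φ a < φ b)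
    (hU : ∀ {a b c c' : Q}, (c ⟶ b) → (c' ⟶ b) → φ a ≤ φ c → φ a ≤ φ c' → c = c') {a b : Q}
    (p q : Quiver.Path a b) : p = q := by
  have hle {a b : Q} (p : Quiver.Path a b) : φ a ≤ φ b := by
    induction p with
    | nil => exact le_rfl
    | cons _ f h => exact h.trans (hlt f).le
  induction p with
  | nil =>
    cases q with
    | nil => rfl
    | cons q f => exact absurd ((hle q).trans_lt (hlt f)) (lt_irrefl _)
  | cons p f ih =>
    cases q with
    | nil => exact absurd ((hle p).trans_lt (hlt f)) (lt_irrefl _)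
    | cons q g =>
      obtain rfl := hU f g (hle p) (hle q)
      rw [ih q, Subsingleton.elim f g]

/-- The category of paths is equivalent to the preorder that ranks the vertices if parallel paths
are equal and all relations are realized by paths. -/
theorem stronglyStablyEquivalent_paths [∀ a b : Q, Subsingleton (a ⟶ b)]
    (hlt : ∀ {a b : Q}, (a ⟶ b) → φ a < φ b)
    (hU : ∀ {a b c c' : Q}, (c ⟶ b) → (c' ⟶ b) → φ a ≤ φ c → φ a ≤ φ c' → c = c')
    (hfull : ∀ a b : Q, φ a ≤ φ b → Nonempty (Quiver.Path a b)) (hφ : φ.Surjective) :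
    StronglyStablyEquivalent.{w, v, u} P (Paths Q) := by
  let F : Paths Q ⥤ P := Paths.lift { obj := φ, map := fun f => homOfLE (hlt f).le }
  have : F.Faithful := ⟨fun _ => path_subsingleton φ hlt hU _ _⟩
  have : F.Full := ⟨fun {a b} f => ⟨(hfull a b (leOfHom f)).some, Subsingleton.elim _ _⟩⟩
  have : F.EssSurj := ⟨fun y => by
    obtain ⟨x, rfl⟩ := hφ y
    exact ⟨x, ⟨Iso.refl _⟩⟩⟩
  have : F.IsEquivalence := {}
  exact stronglyStablyEquivalent_of_isEquivalence F

/-- The arrows of the quiver on `0 — 1 — 2` where `s` and `t` say whether the edges point to the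
larger vertex. -/
abbrev Arrow₃ (s t : Bool) (i j : Fin 3) : Prop :=
  (i, j) = (bif s then (0, 1) else (1, 0)) ∨ (i, j) = (bif t then (1, 2) else (2, 1))

theorem IsQuiverOfTypeA.exists_orientation (hQ : IsQuiverOfTypeA 3 Q) :
    ∃ (e : Fin 3 ≃ Q) (s t : Bool), (∀ i j, Subsingleton (e i ⟶ e j)) ∧
      ∀ i j, Nonempty (e i ⟶ e j) ↔ Arrow₃ s t i j := by
  obtain ⟨e, h₁, h₂⟩ := hQ
  have key (i j : Fin 3) (h : i.val + 1 = j.val) :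
      Subsingleton (e i ⟶ e j) ∧ Subsingleton (e j ⟶ e i) ∧
        ∃ s : Bool, (Nonempty (e i ⟶ e j) ↔ s = true) ∧ (Nonempty (e j ⟶ e i) ↔ s = false) := by
    obtain ⟨x⟩ := h₁ i j h
    refine ⟨⟨fun f g => Sum.inl_injective ((x.uniq (.inl f)).trans (x.uniq (.inl g)).symm)⟩,
      ⟨fun f g => Sum.inr_injective ((x.uniq (.inr f)).trans (x.uniq (.inr g)).symm)⟩, ?_⟩
    obtain f | f := x.default
    · refine ⟨true, by simpa using ⟨f⟩, ?_⟩
      simpa using ⟨fun g => Sum.inl_ne_inr ((x.uniq (.inl f)).trans (x.uniq (.inr g)).symm)⟩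
    · refine ⟨false, ?_, by simpa using ⟨f⟩⟩
      simpa using ⟨fun g => Sum.inl_ne_inr ((x.uniq (.inl g)).trans (x.uniq (.inr f)).symm)⟩
  obtain ⟨s₁, s₂, s, hs, hs'⟩ := key 0 1 rfl
  obtain ⟨t₁, t₂, t, ht, ht'⟩ := key 1 2 rfl
  have h₀ (i : Fin 3) : IsEmpty (e i ⟶ e i) := h₂ i i (by omega) (by omega)
  have h₃ := h₂ 0 2 (by decide) (by decide)
  have h₄ := h₂ 2 0 (by decide) (by decide)
  refine ⟨e, s, t, fun i j => ?_, fun i j => ?_⟩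
  · match i, j with
    | 0, 0 | 1, 1 | 2, 2 => exact ⟨fun f => ((h₀ _).false f).elim⟩
    | 0, 1 | 1, 0 | 1, 2 | 2, 1 => assumption
    | 0, 2 => exact ⟨fun f => (h₃.false f).elim⟩
    | 2, 0 => exact ⟨fun f => (h₄.false f).elim⟩
  · match i, j with
    | 0, 0 | 1, 1 | 2, 2 =>
      exact iff_of_false (not_nonempty_iff.2 (h₀ _)) (by cases s <;> cases t <;> decide)
    | 0, 1 => exact hs.trans (by cases s <;> cases t <;> decide)
    | 1, 0 => exact hs'.trans (by cases s <;> cases t <;> decide)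
    | 1, 2 => exact ht.trans (by cases s <;> cases t <;> decide)
    | 2, 1 => exact ht'.trans (by cases s <;> cases t <;> decide)
    | 0, 2 => exact iff_of_false (not_nonempty_iff.2 h₃) (by cases s <;> cases t <;> decide)
    | 2, 0 => exact iff_of_false (not_nonempty_iff.2 h₄) (by cases s <;> cases t <;> decide)

/-- The criterion `stronglyStablyEquivalent_paths` in terms of the orientation, where all conditions
are decidable. -/
theorem IsQuiverOfTypeA.stronglyStablyEquivalent {e : Fin 3 ≃ Q} {s t : Bool}
    (h : ∀ i j, Subsingleton (e i ⟶ e j)) (h' : ∀ i j, Nonempty (e i ⟶ e j) ↔ Arrow₃ s t i j)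
    (ψ : Fin 3 → P) (hlt : ∀ i j, Arrow₃ s t i j → ψ i ≤ ψ j ∧ ¬ ψ j ≤ ψ i)
    (hU : ∀ i j k k', Arrow₃ s t k j → Arrow₃ s t k' j → ψ i ≤ ψ k → ψ i ≤ ψ k' → k = k')
    (hfull : ∀ i j, ψ i ≤ ψ j →
      i = j ∨ Arrow₃ s t i j ∨ ∃ k, Arrow₃ s t i k ∧ Arrow₃ s t k j)
    (hψ : ψ.Surjective) : StronglyStablyEquivalent.{w, v, u} P (Paths Q) := by
  have : ∀ a b : Q, Subsingleton (a ⟶ b) := e.forall_congr_right.1 fun i =>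
    e.forall_congr_right.1 fun j => h i j
  have h'' {a b : Q} (f : a ⟶ b) : Arrow₃ s t (e.symm a) (e.symm b) :=
    (h' _ _).1 (by simpa using ⟨f⟩)
  refine stronglyStablyEquivalent_paths (ψ ∘ e.symm) (fun f => lt_iff_le_not_ge.2 (hlt _ _ (h'' f)))
    (fun f g h₁ h₂ => e.symm.injective (hU _ _ _ _ (h'' f) (h'' g) h₁ h₂)) (fun a b hab => ?_)
    (hψ.comp e.symm.surjective)
  obtain ⟨i, rfl⟩ := e.surjective a
  obtain ⟨j, rfl⟩ := e.surjective b
  rw [Function.comp_apply, Function.comp_apply, e.symm_apply_apply, e.symm_apply_apply] at hab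
  obtain rfl | hij | ⟨k, hik, hkj⟩ := hfull i j hab
  · exact ⟨.nil⟩
  · exact ((h' _ _).2 hij).map Quiver.Hom.toPath
  · obtain ⟨f⟩ := (h' _ _).2 hik
    obtain ⟨g⟩ := (h' _ _).2 hkj
    exact ⟨f.toPath.comp g.toPath⟩

end Paths

/-- The points `(1,0)`, `(0,0)`, `(0,1)` of the span. -/
abbrev spanPt : Fin 3 → SpanShape.{w} :=
  ![⟨⟨(1, 0)⟩, by decide⟩, ⟨⟨(0, 0)⟩, by decide⟩, ⟨⟨(0, 1)⟩, by decide⟩]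

/-- The points `(1,0)`, `(1,1)`, `(0,1)` of the cospan. -/
abbrev cospanPt : Fin 3 → CospanShape.{w} :=
  ![⟨⟨(1, 0)⟩, by decide⟩, ⟨⟨(1, 1)⟩, by decide⟩, ⟨⟨(0, 1)⟩, by decide⟩]

/-- The points `x`, `y`, `z` of the row. -/
abbrev Stair.rowPt : Fin 3 → Stair.Row.{w} :=
  fun i => ⟨⟨⟨⟨(i, 0)⟩, by revert i; decide⟩, by revert i; decide⟩, by revert i; decide⟩

/-- The order isomorphism from the span to the roof. -/
abbrev Stair.spanToRoof (p : SpanShape.{w}) : Stair.Roof.{w} :=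
  ⟨⟨⟨⟨(p.1.down.1.succ, p.1.down.2)⟩, by revert p; decide⟩, by revert p; decide⟩,
    by revert p; decide⟩

set_option synthInstance.maxSize 1000 in
theorem stronglyStablyEquivalent_roof_span :
    StronglyStablyEquivalent.{w, v, u} Stair.Roof.{w} SpanShape.{w} := by
  have h : ∀ p q : SpanShape.{w}, p ≤ q ↔ Stair.spanToRoof p ≤ Stair.spanToRoof q := by decide
  have h' : ∀ p : Stair.Roof.{w}, ∃ q, Stair.spanToRoof q = p := by decide
  let F : SpanShape.{w} ⥤ Stair.Roof.{w} :=
    Monotone.functor (f := Stair.spanToRoof) fun p q => (h p q).1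
  have : F.Faithful := ⟨fun _ => Subsingleton.elim _ _⟩
  have : F.Full := ⟨fun {p q} f => ⟨homOfLE ((h p q).2 (leOfHom f)), Subsingleton.elim _ _⟩⟩
  have : F.EssSurj := ⟨fun p => (h' p).imp fun _ e => ⟨eqToIso e⟩⟩
  have : F.IsEquivalence := {}
  exact stronglyStablyEquivalent_of_isEquivalence F

set_option synthInstance.maxSize 1000 in
theorem IsQuiverOfTypeA.stronglyStablyEquivalent_row {Q : Type w} [Quiver.{w} Q]
    (hQ : IsQuiverOfTypeA 3 Q) : StronglyStablyEquivalent.{w, v, u} Stair.Row.{w} (Paths Q) := by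
  have h₁ := stronglyStablyEquivalent_row_roof.{w, v, u}.trans stronglyStablyEquivalent_roof_span
  obtain ⟨e, s, t, h, h'⟩ := hQ.exists_orientation
  cases s <;> cases t
  · exact IsQuiverOfTypeA.stronglyStablyEquivalent h h' (fun i => Stair.rowPt i.rev)
      (by decide) (by decide) (by decide) (by decide)
  · exact h₁.trans (IsQuiverOfTypeA.stronglyStablyEquivalent h h' spanPt
      (by decide) (by decide) (by decide) (by decide))
  · exact (h₁.trans stronglyStablyEquivalent_span_cospan).trans
      (IsQuiverOfTypeA.stronglyStablyEquivalent h h' cospanPt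
        (by decide) (by decide) (by decide) (by decide))
  · exact IsQuiverOfTypeA.stronglyStablyEquivalent h h' Stair.rowPt
      (by decide) (by decide) (by decide) (by decide)

end DerivatorTheory

theorem mainTheorem8 (Q Q' : Type w) [Quiver.{w} Q] [Quiver.{w} Q']
    (hQ : DerivatorTheory.IsQuiverOfTypeA 3 Q) (hQ' : DerivatorTheory.IsQuiverOfTypeA 3 Q') :
    DerivatorTheory.StronglyStablyEquivalent.{w, v, u}
      (CategoryTheory.Paths Q) (CategoryTheory.Paths Q') :=
  hQ.stronglyStablyEquivalent_row.symm.trans hQ'.stronglyStablyEquivalent_row
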